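/- All graphs are finite, simple and undirected, and a graph class is a non-empty family of graphs closed under isomorphism. A class is additive if it contains the disjoint union of any two of its members. Given a graph $G$ (the host) and a graph $H$ (the pattern), an $H$-induced subgraph isomorphic set of $G$ is a set $S\subseteq V(G)$ such that $G[S]$ is isomorphic to $H$. For graph classes $\mathscr G$ and $\mathscr H$, the problem Induced Subgraph Isomorphism (ISIso) for $\mathscr G$ and $\mathscr H$ asks, given $G\in\mathscr G$ and $H\in\mathscr H$, whether $G$ has an $H$-induced subgraph isomorphic set. The problem Induced Subgraph Isomorphism Reconfiguration (ISIsoR) under $k$-Token Jumping ($k$-$\mathsf{TJ}$) for $\mathscr G$ and $\mathscr H$ asks, given $G\in\mathscr G$, $H\in\mathscr H$ and two $H$-induced subgraph isomorphic sets $S_s,S_t$ of $G$, whether there is a sequence $S_s=S_0,S_1,\dots,S_\ell=S_t$ of $H$-induced subgraph isomorphic sets of $G$ with $|S_{i-1}\setminus S_i|\le k$ for every $1\le i\le\ell$. The restrictions $G\in\mathscr G$, $H\in\mathscr H$ (and, below, $|V(H)|>\mu$) are promises on the input. Theorem. Let $\mathscr G$ be the class of all graphs, let $\mathscr H$ be any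 additive graph class, and let $\mu\ge 1$ be any fixed integer. If ISIso is NP-complete for $\mathscr G$ and $\mathscr H$, then ISIsoR for $\mathscr G$ and $\mathscr H$ under $k$-$\mathsf{TJ}$ with $k=|V(H)|-\mu\ge 1$, where $H\in\mathscr H$ is the pattern graph of the instance, is NP-complete. Here NP-hardness is with respect to polynomial-time many-one reductions. -/

import Mathlib

namespace Reconf

/-! ### Decision problems, polynomial-time reductions and NP -/

/-- A decision problem: a type of admissible instances, an encoding of the instances as bit strings,
and the set of yes-instances. Algorithms only have to behave correctly on encodings of admissible
instances. -/
structure DecisionProblem where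
  /-- the admissible instances -/
  Instance : Type
  /-- the bit string that represents an instance -/
  encode : Instance → List Bool
  /-- the yes-instances -/
  yes : Instance → Prop

/-- A language of bit strings, as a decision problem in which every string is an instance. -/
def DecisionProblem.ofLanguage (L : Set (List Bool)) : DecisionProblem where
  Instance := List Bool
  encode := id
  yes := fun x => x ∈ L

/-- The encoding of an instance together with a certificate: the encoded instance, a separator
(the symbol `none`), and the certificate. -/
def DecisionProblem.encodeWithCertificate (P : DecisionProblem) (q : P.Instance × List Bool) :
    List (Option Bool) :=
  (P.encode q.1).map some ++ none :: q.2.map some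

/-- `P` is in NP: there are a polynomial `p` and a verifier `v`, computed by a Turing machine in
polynomial time, such that an instance `a` is a yes-instance if and only if `v` accepts `a` with some
certificate of length at most `p` of the length of the encoding of `a`. -/
def DecisionProblem.InNP (P : DecisionProblem) : Prop :=
  ∃ (v : P.Instance × List Bool → Bool) (p : Polynomial ℕ),
    Nonempty (Turing.TM2ComputableInPolyTime P.encodeWithCertificate
      (fun b : Bool => [b]) v) ∧
    ∀ a : P.Instance,
      P.yes a ↔ ∃ c : List Bool, c.length ≤ p.eval (P.encode a).length ∧ v (a, c) = true

/-- Polynomial-time many-one (Karp) reducibility. -/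
def DecisionProblem.PolyReduces (P Q : DecisionProblem) : Prop :=
  ∃ f : P.Instance → Q.Instance,
    Nonempty (Turing.TM2ComputableInPolyTime P.encode Q.encode f) ∧
    ∀ a : P.Instance, P.yes a ↔ Q.yes (f a)

/-- `P` is NP-hard: every language in NP has a polynomial-time many-one reduction to `P`. -/
def DecisionProblem.NPHard (P : DecisionProblem) : Prop :=
  ∀ L : Set (List Bool), (DecisionProblem.ofLanguage L).InNP →
    (DecisionProblem.ofLanguage L).PolyReduces P

/-- `P` is NP-complete: it is in NP and NP-hard. -/
def DecisionProblem.NPComplete (P : DecisionProblem) : Prop :=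
  P.InNP ∧ P.NPHard

/-! ### Graph classes -/

/-- A graph class: a non-empty, isomorphism-closed family of finite simple graphs. Up to isomorphism
the vertex set of a finite graph is `Fin n`. -/
structure GraphClass where
  /-- the graphs in the class -/
  Mem : ∀ {n : ℕ}, SimpleGraph (Fin n) → Prop
  exists_mem : ∃ (n : ℕ) (G : SimpleGraph (Fin n)), Mem G
  mem_of_iso : ∀ {n m : ℕ} (G : SimpleGraph (Fin n)) (H : SimpleGraph (Fin m)),
    Nonempty (G ≃g H) → Mem G → Mem H

/-- The class of general graphs: all finite simple graphs. -/
def GraphClass.general : GraphClass where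
  Mem := fun _ => True
  exists_mem := ⟨0, ⊥, trivial⟩
  mem_of_iso := fun _ _ _ _ => trivial

/-- A graph class is additive if it contains the disjoint union of any two of its graphs. -/
def GraphClass.Additive (C : GraphClass) : Prop :=
  ∀ {n₁ n₂ n : ℕ} (G₁ : SimpleGraph (Fin n₁)) (G₂ : SimpleGraph (Fin n₂))
    (G : SimpleGraph (Fin n)),
    C.Mem G₁ → C.Mem G₂ → Nonempty (G ≃g SimpleGraph.sum G₁ G₂) → C.Mem G

/-! ### Encodings -/

/-- A graph on `Fin n` as a bit string: `n` in unary, closed by a `false`, followed by the adjacency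
matrix, row by row. -/
noncomputable def encodeGraph {n : ℕ} (G : SimpleGraph (Fin n)) : List Bool :=
  open Classical in
  List.replicate n true ++ false ::
    (List.finRange n).flatMap fun i => (List.finRange n).map fun j => decide (G.Adj i j)

/-- A vertex set as the bit string of its characteristic function. -/
def encodeVertexSet {n : ℕ} (S : Finset (Fin n)) : List Bool :=
  (List.finRange n).map fun i => decide (i ∈ S)

/-! ### Induced Subgraph Isomorphism and its reconfiguration variant -/

/-- `S` is an `H`-induced subgraph isomorphic set of `G`: the graph `H` is isomorphic to the subgraph
of `G` induced by `S`. -/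
def IsInducedIsoSet {V W : Type} (G : SimpleGraph V) (H : SimpleGraph W) (S : Finset V) : Prop :=
  Nonempty (H ≃g G.induce (S : Set V))

/-- An instance of Induced Subgraph Isomorphism: a host graph and a pattern graph. -/
structure ISIsoInstance (𝒢 ℋ : GraphClass) where
  /-- the number of vertices of the host graph -/
  n : ℕ
  /-- the number of vertices of the pattern graph -/
  m : ℕ
  /-- the host graph -/
  host : SimpleGraph (Fin n)
  /-- the pattern graph -/
  pattern : SimpleGraph (Fin m)
  host_mem : 𝒢.Mem host
  pattern_mem : ℋ.Mem pattern

/-- The problem Induced Subgraph Isomorphism for `𝒢` and `ℋ`. -/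
noncomputable def ISIso (𝒢 ℋ : GraphClass) : DecisionProblem where
  Instance := ISIsoInstance 𝒢 ℋ
  encode := fun I => encodeGraph I.host ++ encodeGraph I.pattern
  yes := fun I => ∃ S : Finset (Fin I.n), IsInducedIsoSet I.host I.pattern S

/-- One step of `k`-Token Jumping: `T` arises from `S` by moving at most `k` tokens, that is, the two
sets have the same size and at most `k` vertices of `S` are left. -/
def TokenJump {V : Type} [DecidableEq V] (k : ℕ) (S T : Finset V) : Prop :=
  S.card = T.card ∧ (S \ T).card ≤ k

/-- `S` and `T` are reconfigurable under `k`-Token Jumping: there is a sequence of `H`-induced subgraph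
isomorphic sets of `G` from `S` to `T` in which consecutive sets differ by one step. -/
def ReconfigurableTJ {V W : Type} [DecidableEq V] (G : SimpleGraph V) (H : SimpleGraph W) (k : ℕ)
    (S T : Finset V) : Prop :=
  ∃ (l : ℕ) (σ : ℕ → Finset V), σ 0 = S ∧ σ l = T ∧
    (∀ i ≤ l, IsInducedIsoSet G H (σ i)) ∧ ∀ i < l, TokenJump k (σ i) (σ (i + 1))

/-- An instance of Induced Subgraph Isomorphism Reconfiguration under `k`-Token Jumping with
`k = |V(H)| - μ ≥ 1`, where `H` is the pattern graph: a host graph, a pattern graph, and two induced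
subgraph isomorphic sets. -/
structure ISIsoRInstance (μ : ℕ) (𝒢 ℋ : GraphClass) extends ISIsoInstance 𝒢 ℋ where
  /-- the initial set -/
  source : Finset (Fin n)
  /-- the target set -/
  target : Finset (Fin n)
  source_isInducedIsoSet : IsInducedIsoSet host pattern source
  target_isInducedIsoSet : IsInducedIsoSet host pattern target
  μ_lt : μ < m

/-- The problem Induced Subgraph Isomorphism Reconfiguration for `𝒢` and `ℋ` under `k`-Token Jumping,
where `k = |V(H)| - μ ≥ 1` for the pattern graph `H`. -/
noncomputable def ISIsoR (μ : ℕ) (𝒢 ℋ : GraphClass) : DecisionProblem where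
  Instance := ISIsoRInstance μ 𝒢 ℋ
  encode := fun I => encodeGraph I.host ++ encodeGraph I.pattern ++
    encodeVertexSet I.source ++ encodeVertexSet I.target
  yes := fun I => ReconfigurableTJ I.host I.pattern (I.m - μ) I.source I.target

end Reconf

/-! Hardness. Let `G`, `H` be an instance of the subgraph problem, and fix a graph `K` of the class
with at least `μ` vertices. Put `P = K ⊔ H` and `Q = P ⊔ (K ⊔ G)`. The new pattern is `3P`. The new
host has two sides, each a copy of `3P`, completely joined to each other, together with `Q`, which
is joined to the second and third copy on each side but not to the first. The tokens have to go from
one side to the other.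

If `2P` embeds in `Q`, two copies are parked in `Q`, the remaining first copy changes sides, and the
two parked copies follow. This moves at most `2|P|` tokens at a time, which is allowed because `μ ≤
|P|`. If `2P` does not embed in `Q`, every induced `3P` in the host is a whole side
(`not_both_sides`, `not_meets_right`); since consecutive sets share at least `μ ≥ 1` vertices, the
tokens never leave their side (`gadget_reconfigurable_iff`). Finally, `2P` embeds in `Q` exactly
when `H` embeds in `G`, because a common finite summand can be cancelled from an induced embedding
(`sum_cancel`).

Membership in NP. Two consecutive sets share a `μ`-set. In a shortest sequence these `μ`-sets are
pairwise distinct, as a repetition would give a shortcut, so the length is at most `n ^ μ`, a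
polynomial because `μ` is fixed (`ReconfigurableTJ.exists_short`). The certificate lists the
embeddings along such a sequence.

Polynomial time. Both the reduction and the verifier are described by arithmetic expressions with
bounded sums over the input word. Such expressions are compiled to counter programs and these to
stack machines (`WordExpr.computableInPolyTime`); `comp_computableInPolyTime` composes the resulting
reduction with a given one. -/

namespace Reconf

open Turing Function

/-! ### Counter programs with a read-only input -/

/-- The state of a counter program: the position of the input head, the output written so far
(the last symbol written first), and the counters. -/
@[ext] structure CState where
  pos : ℕ
  out : List Bool
  reg : ℕ → ℕ

/-- The elementary actions of counter programs. -/
inductive Act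
  | nop
  | inc (r : ℕ)
  | dec (r : ℕ)
  | fwd
  | back
  | emit (b : Bool)

/-- The tests of counter programs. -/
inductive Test (A : Type)
  | pos (r : ℕ)
  | top (p : Option A → Bool)

/-- Counter programs over the input alphabet `A`. -/
inductive Cmd (A : Type)
  | act (a : Act)
  | seq (P Q : Cmd A)
  | ite (t : Test A) (P Q : Cmd A)
  | while (t : Test A) (P : Cmd A)

variable {A : Type}

/-- Moves and decrements saturate at the ends, as a pop does on an empty stack. -/
def Act.exec (w : List A) (s : CState) : Act → CState
  | .nop => s
  | .inc r => { s with reg := update s.reg r (s.reg r + 1) }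
  | .dec r => { s with reg := update s.reg r (s.reg r - 1) }
  | .fwd => { s with pos := min (s.pos + 1) w.length }
  | .back => { s with pos := s.pos - 1 }
  | .emit b => { s with out := b :: s.out }

def Test.holds (w : List A) (s : CState) : Test A → Bool
  | .pos r => decide (s.reg r ≠ 0)
  | .top p => p w[s.pos]?

/-- `Run w P s t n`: on input `w`, the program `P` leads from `s` to `t` in `n` steps. -/
inductive Run (w : List A) : Cmd A → CState → CState → ℕ → Prop
  | act (a s) : Run w (.act a) s (a.exec w s) 1
  | seq {P Q s t u n m} : Run w P s t n → Run w Q t u m → Run w (.seq P Q) s u (n + m)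
  | ite_true {c P Q s t n} : c.holds w s = true → Run w P s t n → Run w (.ite c P Q) s t (n + 1)
  | ite_false {c P Q s t n} : c.holds w s = false → Run w Q s t n → Run w (.ite c P Q) s t (n + 1)
  | while_false {c P s} : c.holds w s = false → Run w (.while c P) s s 1
  | while_true {c P s t u n m} : c.holds w s = true → Run w P s t n → Run w (.while c P) t u m →
      Run w (.while c P) s u (n + m + 1)

def Act.width : Act → ℕ
  | .inc r => r + 1
  | .dec r => r + 1
  | _ => 0

def Test.width : Test A → ℕ
  | .pos r => r + 1
  | .top _ => 0

/-- A bound on the counters that a program uses. -/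
def Cmd.width : Cmd A → ℕ
  | .act a => a.width
  | .seq P Q => max P.width Q.width
  | .ite t P Q => max t.width (max P.width Q.width)
  | .while t P => max t.width P.width

/-- The labels of the machine that runs a program. -/
def Cmd.Label : Cmd A → Type
  | .act _ => Unit
  | .seq P Q => P.Label ⊕ Q.Label
  | .ite _ P Q => Option (P.Label ⊕ Q.Label)
  | .while _ P => Option P.Label

noncomputable instance Cmd.fintypeLabel : ∀ P : Cmd A, Fintype P.Label
  | .act _ => inferInstanceAs (Fintype Unit)
  | .seq P Q =>
    have := fintypeLabel P
    have := fintypeLabel Q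
    inferInstanceAs (Fintype (P.Label ⊕ Q.Label))
  | .ite _ P Q =>
    have := fintypeLabel P
    have := fintypeLabel Q
    inferInstanceAs (Fintype (Option (P.Label ⊕ Q.Label)))
  | .while _ P =>
    have := fintypeLabel P
    inferInstanceAs (Fintype (Option P.Label))

def Cmd.entry : ∀ P : Cmd A, P.Label
  | .act _ => ()
  | .seq P _ => Sum.inl P.entry
  | .ite _ _ _ => none
  | .while _ _ => none

/-- The stacks of the machine that runs a program with `N` counters. -/
inductive Stk (N : ℕ)
  | left
  | right
  | out
  | reg (i : Fin N)
  deriving DecidableEq, Fintype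

/-- The stack alphabets. -/
abbrev Stk.Sym (A : Type) {N : ℕ} : Stk N → Type
  | .left => A
  | .right => A
  | .out => Bool
  | .reg _ => Unit

/-- Beyond the end of the input, the two stacks that hold it would no longer determine the head
position, so the simulation needs this invariant. -/
theorem Run.pos_le {w : List A} {P : Cmd A} {s t : CState} {n : ℕ} (h : Run w P s t n)
    (hs : s.pos ≤ w.length) : t.pos ≤ w.length := by
  induction h with
  | act a s => cases a <;> simp [Act.exec] <;> omega
  | seq _ _ ih₁ ih₂ => exact ih₂ (ih₁ hs)
  | ite_true _ _ ih => exact ih hs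
  | ite_false _ _ ih => exact ih hs
  | while_false _ => exact hs
  | while_true _ _ _ ih₁ ih₂ => exact ih₂ (ih₁ hs)

/-! ### Simulation of counter programs by stack machines -/

section Compile

variable [Inhabited A] {N : ℕ} {L : Type}

/-- The input is split at the head into two stacks, so a head move is a pop from one and a push onto
the other. The branches for `r ≥ N` are junk, excluded later by the bound on the width. -/
def Act.code (a : Act) (q : TM2.Stmt (Stk.Sym A (N := N)) L (Option A)) :
    TM2.Stmt (Stk.Sym A (N := N)) L (Option A) :=
  match a with
  | .nop => q
  | .inc r => if h : r < N then .push (Stk.reg ⟨r, h⟩) (fun _ => ()) q else q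
  | .dec r => if h : r < N then .pop (Stk.reg ⟨r, h⟩) (fun v _ => v) q else q
  | .fwd => .pop Stk.right (fun _ x => x)
      (.branch Option.isSome (.push Stk.left (fun v => v.getD default) q) q)
  | .back => .pop Stk.left (fun _ x => x)
      (.branch Option.isSome (.push Stk.right (fun v => v.getD default) q) q)
  | .emit b => .push Stk.out (fun _ => b) q

/-- The internal state serves as a flag: `some default` for success, `none` for failure. -/
def Test.code (t : Test A) (q₁ q₂ : TM2.Stmt (Stk.Sym A (N := N)) L (Option A)) :
    TM2.Stmt (Stk.Sym A (N := N)) L (Option A) :=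
  match t with
  | .pos r => if h : r < N then
      .peek (Stk.reg ⟨r, h⟩) (fun _ x => if x.isSome then some default else none)
        (.branch Option.isSome q₁ q₂) else q₁
  | .top p => .peek Stk.right (fun _ x => if p x then some default else none)
        (.branch Option.isSome q₁ q₂)

/-- The statements of the machine that runs a program and then continues at `exit`. -/
def Cmd.code : ∀ (P : Cmd A), (P.Label → L) → L → P.Label →
    TM2.Stmt (Stk.Sym A (N := N)) L (Option A)
  | .act a, _, exit, _ => a.code (.goto fun _ => exit)
  | .seq P Q, inj, exit, l => match l with
    | Sum.inl l => P.code (fun l => inj (Sum.inl l)) (inj (Sum.inr Q.entry)) l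
    | Sum.inr l => Q.code (fun l => inj (Sum.inr l)) exit l
  | .ite t P Q, inj, exit, l => match l with
    | none => t.code (.goto fun _ => inj (some (Sum.inl P.entry)))
        (.goto fun _ => inj (some (Sum.inr Q.entry)))
    | some (Sum.inl l) => P.code (fun l => inj (some (Sum.inl l))) exit l
    | some (Sum.inr l) => Q.code (fun l => inj (some (Sum.inr l))) exit l
  | .while t P, inj, exit, l => match l with
    | none => t.code (.goto fun _ => inj (some P.entry)) (.goto fun _ => exit)
    | some l => P.code (fun l => inj (some l)) (inj none) l

/-- The stacks that represent a state. -/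
def CState.stacks (w : List A) (s : CState) : ∀ k : Stk N, List (k.Sym A)
  | .left => (w.take s.pos).reverse
  | .right => w.drop s.pos
  | .out => s.out
  | .reg i => List.replicate (s.reg i) ()

/-- `n` steps of a partial function. -/
def StepsTo {C : Type*} (f : C → Option C) (n : ℕ) (c c' : C) : Prop :=
  (flip bind f)^[n] (some c) = some c'

theorem StepsTo.trans {C : Type*} {f : C → Option C} {n m : ℕ} {c c' c'' : C}
    (h : StepsTo f n c c') (h' : StepsTo f m c' c'') : StepsTo f (n + m) c c'' := by
  unfold StepsTo at *
  rw [Nat.add_comm, iterate_add_apply, h, h']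

theorem StepsTo.single {C : Type*} {f : C → Option C} {c c' : C} (h : f c = some c') :
    StepsTo f 1 c c' := h

/-- The internal state that is left behind is irrelevant, because compiled code overwrites it before
reading it; hence the existential `v'`. -/
theorem Act.stepAux_code (w : List A) (a : Act) (ha : a.width ≤ N) (s : CState)
    (hs : s.pos ≤ w.length) (v : Option A) (q : TM2.Stmt (Stk.Sym A (N := N)) L (Option A)) :
    ∃ v', TM2.stepAux (a.code q) v (s.stacks w) = TM2.stepAux q v' ((a.exec w s).stacks w) := by
  cases a with
  | nop => exact ⟨v, rfl⟩
  | inc r =>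
    have h : r < N := ha
    refine ⟨v, ?_⟩
    simp only [Act.code, h, dif_pos, TM2.stepAux]
    congr 1
    funext k
    cases k with
    | reg i =>
      by_cases hi : i = ⟨r, h⟩
      · subst hi
        simp [CState.stacks, Act.exec, List.replicate_succ]
      · have : (i : ℕ) ≠ r := fun h' => hi (Fin.ext h')
        rw [update_of_ne (by simpa using hi)]
        simp [CState.stacks, Act.exec, update_of_ne this]
    | _ => rfl
  | dec r =>
    have h : r < N := ha
    refine ⟨v, ?_⟩
    simp only [Act.code, h, dif_pos, TM2.stepAux]
    congr 1
    funext k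
    cases k with
    | reg i =>
      by_cases hi : i = ⟨r, h⟩
      · subst hi
        simp [CState.stacks, Act.exec]
      · have : (i : ℕ) ≠ r := fun h' => hi (Fin.ext h')
        rw [update_of_ne (by simpa using hi)]
        simp [CState.stacks, Act.exec, update_of_ne this]
    | _ => rfl
  | fwd =>
    rcases hs.lt_or_eq with h | h
    · refine ⟨some w[s.pos], ?_⟩
      have h1 : w.drop s.pos = w[s.pos] :: w.drop (s.pos + 1) := List.drop_eq_getElem_cons h
      have h2 : min (s.pos + 1) w.length = s.pos + 1 := min_eq_left h
      have h3 : (CState.stacks w s (Stk.right : Stk N)) = w[s.pos] :: w.drop (s.pos + 1) := h1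
      simp only [Act.code, TM2.stepAux, h3, List.head?_cons, Option.isSome_some, cond_true,
        Option.getD_some]
      congr 1
      funext k
      cases k with
      | left =>
        rw [update_self, update_of_ne (by simp)]
        show _ = (w.take (min (s.pos + 1) w.length)).reverse
        rw [h2, List.take_succ_eq_append_getElem h, List.reverse_append]
        rfl
      | right =>
        rw [update_of_ne (by simp), update_self]
        simp [CState.stacks, Act.exec, h2]
      | _ => rfl
    · refine ⟨none, ?_⟩
      have h3 : (CState.stacks w s (Stk.right : Stk N)) = [] := by
        simp [CState.stacks, h]
      simp only [Act.code, TM2.stepAux, h3, List.head?_nil, Option.isSome_none, cond_false]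
      congr 1
      funext k
      cases k with
      | left => 
        rw [update_of_ne (by simp)]
        simp [CState.stacks, Act.exec, h]
      | right =>
        rw [update_self]
        simp [CState.stacks, Act.exec, h]
      | _ => rfl
  | back =>
    rcases Nat.eq_zero_or_pos s.pos with h | h
    · refine ⟨none, ?_⟩
      have h3 : (CState.stacks w s (Stk.left : Stk N)) = [] := by
        simp [CState.stacks, h]
      simp only [Act.code, TM2.stepAux, h3, List.head?_nil, Option.isSome_none, cond_false]
      congr 1
      funext k
      cases k with
      | right => 
        rw [update_of_ne (by simp)]
        simp [CState.stacks, Act.exec, h]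
      | left =>
        rw [update_self]
        simp [CState.stacks, Act.exec, h]
      | _ => rfl
    · obtain ⟨p, hp⟩ : ∃ p, s.pos = p + 1 := ⟨s.pos - 1, by omega⟩
      have hlt : p < w.length := by omega
      refine ⟨some w[p], ?_⟩
      have h3 : (CState.stacks w s (Stk.left : Stk N)) = w[p] :: (w.take p).reverse := by
        show (w.take s.pos).reverse = _
        rw [hp, List.take_succ_eq_append_getElem hlt, List.reverse_append]
        rfl
      simp only [Act.code, TM2.stepAux, h3, List.head?_cons, Option.isSome_some, cond_true,
        Option.getD_some]
      congr 1
      funext k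
      cases k with
      | right =>
        rw [update_self, update_of_ne (by simp)]
        simp [CState.stacks, Act.exec, hp]
      | left =>
        rw [update_of_ne (by simp), update_self]
        simp [CState.stacks, Act.exec, hp]
      | _ => rfl
  | emit b =>
    refine ⟨v, ?_⟩
    simp only [Act.code, TM2.stepAux]
    congr 1
    funext k
    cases k with
    | out => rw [update_self]; rfl
    | _ => rfl

theorem Test.stepAux_code (w : List A) (t : Test A) (ht : t.width ≤ N) (s : CState)
    (v : Option A) (q₁ q₂ : TM2.Stmt (Stk.Sym A (N := N)) L (Option A)) :
    ∃ v', TM2.stepAux (t.code q₁ q₂) v (s.stacks w) =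
      TM2.stepAux (if t.holds w s then q₁ else q₂) v' (s.stacks w) := by
  cases t with
  | pos r =>
    have h : r < N := ht
    have hd : (CState.stacks w s (Stk.reg ⟨r, h⟩)).head?.isSome = decide (s.reg r ≠ 0) := by
      cases h' : s.reg r <;> simp [CState.stacks, h', List.replicate_succ]
    simp only [Test.code, h, dif_pos, TM2.stepAux, Test.holds, hd]
    by_cases h0 : s.reg r = 0
    · exact ⟨none, by simp [h0]⟩
    · exact ⟨some default, by simp [h0]⟩
  | top p =>
    have hd : (CState.stacks w s (Stk.right : Stk N)).head? = w[s.pos]? := by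
      simp [CState.stacks]
    simp only [Test.code, TM2.stepAux, Test.holds, hd]
    by_cases h : p w[s.pos]? = true
    · exact ⟨some default, by simp [h]⟩
    · exact ⟨none, by simp [h]⟩

/-- The machine simulates the program. -/
theorem Run.stepsTo {w : List A} {P : Cmd A} {s t : CState} {n : ℕ} (h : Run w P s t n)
    (M : L → TM2.Stmt (Stk.Sym A (N := N)) L (Option A)) (inj : P.Label → L) (exit : L)
    (hM : ∀ l, M (inj l) = P.code inj exit l) (hN : P.width ≤ N) (hs : s.pos ≤ w.length)
    (v : Option A) :
    ∃ v', StepsTo (TM2.step M) n ⟨some (inj P.entry), v, s.stacks w⟩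
      ⟨some exit, v', t.stacks w⟩ := by
  -- The exit label has to vary: the first part of a sequence exits to the entry of the second, and
  -- a loop body exits to the test of the loop.
  induction h generalizing v exit with
  | act a s =>
    obtain ⟨v', hv⟩ := Act.stepAux_code w a hN s hs v (.goto fun _ => exit)
    refine ⟨v', StepsTo.single ?_⟩
    have := hM ()
    rw [TM2.step]
    erw [this]
    exact congrArg some hv
  | @seq P Q s t u n m h₁ h₂ ih₁ ih₂ =>
    obtain ⟨v₁, h₁'⟩ := ih₁ (fun l => inj (Sum.inl l)) (inj (Sum.inr Q.entry))
      (fun l => hM (Sum.inl l)) ((le_max_left _ _).trans hN) hs v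
    obtain ⟨v₂, h₂'⟩ := ih₂ (fun l => inj (Sum.inr l)) exit
      (fun l => hM (Sum.inr l)) ((le_max_right _ _).trans hN) (h₁.pos_le hs) v₁
    exact ⟨v₂, h₁'.trans h₂'⟩
  | @ite_true c P Q s t n hc h ih =>
    have hw := max_le_iff.1 hN
    have hw' := max_le_iff.1 hw.2
    obtain ⟨v₁, h₁⟩ := Test.stepAux_code w c hw.1 s v
      (.goto fun _ => inj (some (Sum.inl P.entry))) (.goto fun _ => inj (some (Sum.inr Q.entry)))
    obtain ⟨v₂, h₂⟩ := ih (fun l => inj (some (Sum.inl l))) exit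
      (fun l => hM (some (Sum.inl l))) hw'.1 hs v₁
    refine ⟨v₂, ?_⟩
    rw [Nat.add_comm]
    refine StepsTo.trans (StepsTo.single ?_) h₂
    rw [TM2.step]
    erw [hM none]
    rw [hc] at h₁
    exact congrArg some h₁
  | @ite_false c P Q s t n hc h ih =>
    have hw := max_le_iff.1 hN
    have hw' := max_le_iff.1 hw.2
    obtain ⟨v₁, h₁⟩ := Test.stepAux_code w c hw.1 s v
      (.goto fun _ => inj (some (Sum.inl P.entry))) (.goto fun _ => inj (some (Sum.inr Q.entry)))
    obtain ⟨v₂, h₂⟩ := ih (fun l => inj (some (Sum.inr l))) exit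
      (fun l => hM (some (Sum.inr l))) hw'.2 hs v₁
    refine ⟨v₂, ?_⟩
    rw [Nat.add_comm]
    refine StepsTo.trans (StepsTo.single ?_) h₂
    rw [TM2.step]
    erw [hM none]
    rw [hc] at h₁
    exact congrArg some h₁
  | @while_false c P s hc =>
    have hw := max_le_iff.1 hN
    obtain ⟨v₁, h₁⟩ := Test.stepAux_code w c hw.1 s v
      (.goto fun _ => inj (some P.entry)) (.goto fun _ => exit)
    refine ⟨v₁, StepsTo.single ?_⟩
    rw [TM2.step]
    erw [hM none]
    rw [hc] at h₁
    exact congrArg some h₁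
  | @while_true c P s t u n m hc h₁ h₂ ih₁ ih₂ =>
    have hw := max_le_iff.1 hN
    obtain ⟨v₁, h₁'⟩ := Test.stepAux_code w c hw.1 s v
      (.goto fun _ => inj (some P.entry)) (.goto fun _ => exit)
    obtain ⟨v₂, h₂'⟩ := ih₁ (fun l => inj (some l)) (inj none)
      (fun l => hM (some l)) hw.2 hs v₁
    obtain ⟨v₃, h₃'⟩ := ih₂ inj exit hM hN (h₁.pos_le hs) v₂
    refine ⟨v₃, ?_⟩
    rw [show n + m + 1 = 1 + (n + m) by ring]
    refine StepsTo.trans (StepsTo.single ?_) (h₂'.trans h₃')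
    rw [TM2.step]
    erw [hM none]
    rw [hc] at h₁'
    exact congrArg some h₁'

end Compile

/-! ### From counter programs to polynomial-time machines -/

section Machine

variable [Inhabited A]

/-- The machine that runs `P` and then clears the input. -/
noncomputable def Cmd.machine [Fintype A] (P : Cmd A) : FinTM2 where
  K := Stk P.width
  k₀ := Stk.right
  k₁ := Stk.out
  Γ := Stk.Sym A
  Λ := Option P.Label
  main := some P.entry
  σ := Option A
  initialState := none
  Γk₀Fin := inferInstanceAs (Fintype A)
  m l := match l with
    | some l => P.code some none l
    | none => .pop Stk.right (fun _ x => x)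
        (.branch Option.isSome (.goto fun _ => none) .halt)

variable [Fintype A]

/-- In a halting configuration every stack but the output is empty. With the head at `0` and all
counters at `0`, only the right stack remains to be cleared; the extra step is the pop that finds it
empty. -/
theorem stepsTo_clear (P : Cmd A) (w : List A) (o : List Bool) (v : Option A) :
    StepsTo P.machine.step (w.length + 1)
      ⟨some none, v, CState.stacks w ⟨0, o, fun _ => 0⟩⟩
      (haltList P.machine o) := by
  induction w generalizing v with
  | nil =>
    refine StepsTo.single (congrArg some ?_)
    change (⟨none, none, _⟩ : P.machine.Cfg) = ⟨none, none, _⟩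
    congr 1
    funext k
    cases k <;> rfl
  | cons a w ih =>
    rw [List.length_cons, Nat.add_comm]
    refine StepsTo.trans (StepsTo.single (congrArg some ?_)) (ih (some a))
    change (⟨some none, some a, _⟩ : P.machine.Cfg) = ⟨some none, some a, _⟩
    congr 1
    funext k
    cases k <;> rfl

/-- A program that computes `f` in polynomial time gives a machine that does. -/
theorem Cmd.computableInPolyTime {α β : Type} {ea : α → List A} {eb : β → List Bool} {f : α → β}
    (P : Cmd A) (p : Polynomial ℕ)
    (h : ∀ a, ∃ n ≤ p.eval (ea a).length,
      Run (ea a) P ⟨0, [], fun _ => 0⟩ ⟨0, eb (f a), fun _ => 0⟩ n) :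
    Nonempty (TM2ComputableInPolyTime ea eb f) := by
  -- `p` pays for the program, `X + 1` for clearing the input.
  refine ⟨⟨⟨P.machine, Equiv.refl _, Equiv.refl _⟩, p + .X + 1, fun a => ?_⟩⟩
  choose n hn hr using h
  have hsim := fun a => (hr a).stepsTo P.machine.m some none (fun _ => rfl) le_rfl (Nat.zero_le _) none
  choose v hv using hsim
  have hinit : initList P.machine (ea a) =
      ⟨some (some P.entry), none, CState.stacks (ea a) ⟨0, [], fun _ => 0⟩⟩ := by
    simp only [initList, Cmd.machine]
    congr 1
    funext k
    cases k <;> rfl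
  have key : StepsTo P.machine.step (n a + ((ea a).length + 1))
      (initList P.machine (ea a)) (haltList P.machine (eb (f a))) := by
    refine StepsTo.trans ?_ (stepsTo_clear P (ea a) (eb (f a)) (v a))
    rw [hinit]
    exact hv a
  refine ⟨⟨n a + ((ea a).length + 1), ?_⟩, ?_⟩
  · have h1 : List.map (Equiv.refl A).invFun (ea a) = ea a := List.map_id _
    have h2 : List.map (Equiv.refl Bool).invFun (eb (f a)) = eb (f a) := List.map_id _
    erw [h1, h2]
    exact key
  · have := hn a
    simp
    omega

end Machine

end Reconf

namespace Reconf

open Turing Function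

variable {A : Type}

/-! ### Arithmetic expressions over an input word -/

/-- `P` leads from `s` to `t` in at most `T` steps. -/
def RunIn (w : List A) (P : Cmd A) (s t : CState) (T : ℕ) : Prop :=
  ∃ n ≤ T, Run w P s t n

theorem RunIn.mono {w : List A} {P : Cmd A} {s t : CState} {T T' : ℕ} (h : RunIn w P s t T)
    (hT : T ≤ T') : RunIn w P s t T' :=
  let ⟨n, hn, h⟩ := h
  ⟨n, hn.trans hT, h⟩

theorem RunIn.act {w : List A} (a : Act) {s t : CState} (h : a.exec w s = t) :
    RunIn w (.act a) s t 1 := ⟨1, le_rfl, h ▸ Run.act a s⟩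

theorem RunIn.seq {w : List A} {P Q : Cmd A} {s t u : CState} {T T' : ℕ} (h : RunIn w P s t T)
    (h' : RunIn w Q t u T') : RunIn w (.seq P Q) s u (T + T') :=
  let ⟨n, hn, h⟩ := h
  let ⟨m, hm, h'⟩ := h'
  ⟨n + m, add_le_add hn hm, h.seq h'⟩

theorem RunIn.ite {w : List A} {c : Test A} {P Q : Cmd A} {s t : CState} {T : ℕ}
    (h : c.holds w s = true → RunIn w P s t T) (h' : c.holds w s = false → RunIn w Q s t T) :
    RunIn w (.ite c P Q) s t (T + 1) := by
  cases hc : c.holds w s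
  · obtain ⟨n, hn, h⟩ := h' hc
    exact ⟨n + 1, by omega, Run.ite_false hc h⟩
  · obtain ⟨n, hn, h⟩ := h hc
    exact ⟨n + 1, by omega, Run.ite_true hc h⟩

/-- The states are indexed by the number of passes still to come, which suits loops that count down.
-/
theorem RunIn.while {w : List A} {c : Test A} {P : Cmd A} {s t : CState} {T : ℕ}
    (f : ℕ → CState) (N : ℕ) (hs : f N = s) (ht : f 0 = t)
    (h0 : c.holds w (f 0) = false) (hc : ∀ i < N, c.holds w (f (i + 1)) = true)
    (hP : ∀ i < N, RunIn w P (f (i + 1)) (f i) T) :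
    RunIn w (.while c P) s t (N * (T + 1) + 1) := by
  subst hs ht
  induction N with
  | zero => exact ⟨1, by omega, Run.while_false h0⟩
  | succ N ih =>
    obtain ⟨n, hn, h⟩ := ih (fun i hi => hc i (by omega)) (fun i hi => hP i (by omega))
    obtain ⟨m, hm, h'⟩ := hP N (by omega)
    exact ⟨m + n + 1, by nlinarith, Run.while_true (hc N (by omega)) h' h⟩

/-- Run `P` while counting down the counter `r`. -/
def Cmd.loop (r : ℕ) (P : Cmd A) : Cmd A :=
  .while (.pos r) (.seq (.act (.dec r)) P)

/-- The decrement precedes the body, so the body sees the indices `N - 1, …, 0` in the counter `r`.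
Bounded sums and concatenations use `r` as their bound variable for this reason. -/
theorem RunIn.loop {w : List A} {P : Cmd A} {r T : ℕ} {s t : CState} (f : ℕ → CState) (N : ℕ)
    (hs : f N = s) (ht : f 0 = t) (hr : ∀ i ≤ N, (f i).reg r = i)
    (hP : ∀ i < N, RunIn w P ((Act.dec r).exec w (f (i + 1))) (f i) T) :
    RunIn w (.loop r P) s t (N * (T + 2) + 1) := by
  subst hs ht
  refine (RunIn.while (T := 1 + T) f N rfl rfl ?_ ?_ ?_).mono (by ring_nf; omega)
  · simp [Test.holds, hr]
  · intro i hi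
    simp [Test.holds, hr (i + 1) (by omega)]
  · intro i hi
    exact (RunIn.act _ rfl).seq (hP i hi)

/-- Arithmetic expressions over an input word `w`: `bit p e` is `1` if the symbol of `w` at the
position `e` satisfies `p` and `0` otherwise, and `sum x b e` is the sum of `e` over `x < b`. -/
inductive Expr (A : Type)
  | const (c : ℕ)
  | var (x : ℕ)
  | len
  | bit (p : Option A → Bool) (e : Expr A)
  | add (a b : Expr A)
  | sub (a b : Expr A)
  | mul (a b : Expr A)
  | ite (c a b : Expr A)
  | sum (x : ℕ) (b e : Expr A)

/-- The value of an expression. -/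
def Expr.eval (w : List A) : Expr A → (ℕ → ℕ) → ℕ
  | .const c, _ => c
  | .var x, ρ => ρ x
  | .len, _ => w.length
  | .bit p e, ρ => if p w[e.eval w ρ]? then 1 else 0
  | .add a b, ρ => a.eval w ρ + b.eval w ρ
  | .sub a b, ρ => a.eval w ρ - b.eval w ρ
  | .mul a b, ρ => a.eval w ρ * b.eval w ρ
  | .ite c a b, ρ => if c.eval w ρ ≠ 0 then a.eval w ρ else b.eval w ρ
  | .sum x b e, ρ => ∑ i ∈ Finset.range (b.eval w ρ), e.eval w (update ρ x i)

theorem eval_mono (p : Polynomial ℕ) {m n : ℕ} (h : m ≤ n) : p.eval m ≤ p.eval n := by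
  induction p using Polynomial.induction_on' with
  | add p q hp hq => simpa using add_le_add hp hq
  | monomial k c => simpa using Nat.mul_le_mul_left c (Nat.pow_le_pow_left h k)

/-- Values of expressions are polynomially bounded. -/
theorem Expr.exists_eval_le (e : Expr A) : ∃ p : Polynomial ℕ, ∀ (w : List A) (ρ : ℕ → ℕ) (B : ℕ),
    w.length ≤ B → (∀ x, ρ x ≤ B) → e.eval w ρ ≤ p.eval B := by
  induction e with
  | const c => exact ⟨.C c, fun w ρ B _ _ => by simp [eval]⟩
  | var x => exact ⟨.X, fun w ρ B _ h => by simpa [eval] using h x⟩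
  | len => exact ⟨.X, fun w ρ B h _ => by simpa [eval] using h⟩
  | bit p e => exact ⟨1, fun w ρ B h _ => by simp only [eval, Polynomial.eval_one]; split_ifs <;> simp⟩
  | add a b iha ihb =>
    obtain ⟨p, hp⟩ := iha
    obtain ⟨q, hq⟩ := ihb
    exact ⟨p + q, fun w ρ B hB hρ => by
      simpa [eval] using add_le_add (hp w ρ B hB hρ) (hq w ρ B hB hρ)⟩
  | sub a b iha ihb =>
    obtain ⟨p, hp⟩ := iha
    exact ⟨p, fun w ρ B hB hρ => (Nat.sub_le _ _).trans (hp w ρ B hB hρ)⟩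
  | mul a b iha ihb =>
    obtain ⟨p, hp⟩ := iha
    obtain ⟨q, hq⟩ := ihb
    exact ⟨p * q, fun w ρ B hB hρ => by
      simpa [eval] using Nat.mul_le_mul (hp w ρ B hB hρ) (hq w ρ B hB hρ)⟩
  | ite c a b _ iha ihb =>
    obtain ⟨p, hp⟩ := iha
    obtain ⟨q, hq⟩ := ihb
    refine ⟨p + q, fun w ρ B hB hρ => ?_⟩
    have h1 := hp w ρ B hB hρ
    have h2 := hq w ρ B hB hρ
    simp only [eval, Polynomial.eval_add]
    split_ifs <;> omega
  | sum x b e ihb ihe =>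
    obtain ⟨p, hp⟩ := ihb
    obtain ⟨q, hq⟩ := ihe
    -- Inside the sum the new variable is below `p.eval B`, so the environment is bounded by `B +
    -- p.eval B`.
    refine ⟨p * q.comp (.X + p), fun w ρ B hB hρ => ?_⟩
    have h1 := hp w ρ B hB hρ
    simp only [eval, Polynomial.eval_mul, Polynomial.eval_comp, Polynomial.eval_add,
      Polynomial.eval_X]
    calc _ ≤ ∑ i ∈ Finset.range (b.eval w ρ), q.eval (B + p.eval B) := by
          refine Finset.sum_le_sum fun i hi => hq w _ _ (by omega) fun y => ?_
          have hi := Finset.mem_range.1 hi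
          rcases eq_or_ne y x with rfl | h
          · rw [update_self]; omega
          · rw [update_of_ne h]; have := hρ y; omega
      _ = b.eval w ρ * q.eval (B + p.eval B) := by simp
      _ ≤ _ := Nat.mul_le_mul_right _ h1

/-- Add `c` to a counter. -/
def Cmd.addConst (t : ℕ) : ℕ → Cmd A
  | 0 => .act .nop
  | c + 1 => .seq (.act (.inc t)) (addConst t c)

/-- A program that adds the value of an expression to the counter `t`. The variable `x` is kept in the
counter `θ x`; the counters from `r` on are free. -/
def Expr.cmd : Expr A → (ℕ → ℕ) → ℕ → ℕ → Cmd A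
  | .const c, _, t, _ => .addConst t c
  -- Reading a counter destroys it; its value is moved to `t` and to the scratch counter `r`, and
  -- from there back.
  | .var x, θ, t, r =>
    .seq (.loop (θ x) (.seq (.act (.inc t)) (.act (.inc r)))) (.loop r (.act (.inc (θ x))))
  | .len, _, t, r =>
    .seq (.while (.top Option.isSome) (.seq (.act .fwd) (.seq (.act (.inc t)) (.act (.inc r)))))
      (.loop r (.act .back))
  -- The counter `r + 1` records the forward moves, so that the head can be returned to `0`.
  | .bit p e, θ, t, r =>
    .seq (e.cmd θ r (r + 1)) (.seq (.loop r (.seq (.act .fwd) (.act (.inc (r + 1)))))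
      (.seq (.ite (.top p) (.act (.inc t)) (.act .nop)) (.loop (r + 1) (.act .back))))
  | .add a b, θ, t, r => .seq (a.cmd θ t r) (b.cmd θ t r)
  | .sub a b, θ, t, r =>
    .seq (a.cmd θ r (r + 1)) (.seq (b.cmd θ (r + 1) (r + 2))
      (.seq (.loop (r + 1) (.act (.dec r))) (.loop r (.act (.inc t)))))
  | .mul a b, θ, t, r => .seq (a.cmd θ r (r + 1)) (.loop r (b.cmd θ t (r + 1)))
  | .ite c a b, θ, t, r =>
    .seq (c.cmd θ r (r + 1))
      (.ite (.pos r) (.seq (.loop r (.act .nop)) (a.cmd θ t r)) (b.cmd θ t r))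
  | .sum x b e, θ, t, r => .seq (b.cmd θ r (r + 1)) (.loop r (e.cmd (update θ x r) t (r + 1)))

/-- Increase a counter. -/
def CState.add (s : CState) (t v : ℕ) : CState :=
  { s with reg := update s.reg t (s.reg t + v) }

theorem RunIn.addConst (w : List A) (t c : ℕ) (s : CState) :
    RunIn w (.addConst t c) s (s.add t c) (c + 1) := by
  induction c generalizing s with
  | zero => exact RunIn.act _ (by simp [Act.exec, CState.add])
  | succ c ih =>
    have h : (s.add t 1).add t c = s.add t (c + 1) := by
      simp [CState.add, Nat.add_assoc, Nat.add_comm 1 c]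
    rw [← h]
    exact ((RunIn.act (.inc t) rfl).seq (ih _)).mono (by omega)

/-- The program `P θ t r` adds `v w ρ` to the counter `t`, where `ρ` is the content of the counters
`θ`, in time `T`. -/
def Adds (P : (ℕ → ℕ) → ℕ → ℕ → Cmd A) (v : List A → (ℕ → ℕ) → ℕ) (p : Polynomial ℕ) : Prop :=
  ∀ (w : List A) (θ : ℕ → ℕ) (t r : ℕ) (s : CState) (B : ℕ), s.pos = 0 → (∀ k, r ≤ k → s.reg k = 0) →
    (∀ x, θ x < r) → (∀ x, θ x ≠ t) → t < r → w.length ≤ B → (∀ x, s.reg (θ x) ≤ B) →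
    RunIn w (P θ t r) s (s.add t (v w (s.reg ∘ θ))) (p.eval B)

theorem CState.ext_reg {s t : CState} (h₁ : s.pos = t.pos) (h₂ : s.out = t.out)
    (h₃ : ∀ k, s.reg k = t.reg k) : s = t := CState.ext h₁ h₂ (funext h₃)


theorem Expr.adds_var (x : ℕ) :
    Adds (Expr.var x : Expr A).cmd (Expr.var x).eval (7 * .X + 2) := by
  intro w θ t r s B _ hr hθ hθt ht _ hB
  have h1 := hθ x
  have h2 := hθt x
  have h3 := hr r le_rfl
  have h4 := hB x
  simp only [Expr.cmd, Expr.eval, comp_apply]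
  generalize θ x = y at *
  refine (RunIn.seq (T := s.reg y * (2 + 2) + 1) (T' := s.reg y * (1 + 2) + 1)
    (RunIn.loop (fun i => ⟨s.pos, s.out, fun k => if k = y then i else if k = t then
            s.reg t + (s.reg y - i) else if k = r then s.reg y - i else s.reg k⟩) (s.reg y)
      ?_ rfl ?_ ?_)
    (RunIn.loop (fun i => ⟨s.pos, s.out, fun k => if k = y then s.reg y - i else if k = t then
            s.reg t + s.reg y else if k = r then i else s.reg k⟩) (s.reg y) ?_ ?_ ?_ ?_)).mono ?_
  · refine CState.ext_reg rfl rfl fun k => ?_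
    dsimp only
    split_ifs <;> simp_all
  · simp
  · intro i hi
    refine (RunIn.act _ rfl).seq (RunIn.act _ ?_)
    refine CState.ext_reg rfl rfl fun k => ?_
    simp only [Act.exec, update_apply]
    split_ifs <;> omega
  · refine CState.ext_reg rfl rfl fun k => ?_
    dsimp only
    split_ifs <;> simp_all
  · refine CState.ext_reg rfl rfl fun k => ?_
    simp only [CState.add, update_apply]
    split_ifs <;> simp_all
  · intro i hi
    dsimp only
    split_ifs <;> omega
  · intro i hi
    refine RunIn.act _ ?_
    refine CState.ext_reg rfl rfl fun k => ?_
    simp only [Act.exec, update_apply]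
    split_ifs <;> omega
  · simp
    omega

theorem Expr.adds_len : Adds (Expr.len : Expr A).cmd Expr.len.eval (8 * .X + 2) := by
  intro w θ t r s B hs hr hθ hθt ht hB _
  have h3 := hr r le_rfl
  simp only [Expr.cmd, Expr.eval]
  refine (RunIn.seq (T := w.length * (3 + 1) + 1) (T' := w.length * (1 + 2) + 1)
    (t := ⟨w.length, s.out, fun k => if k = t then
            s.reg t + w.length else if k = r then w.length else s.reg k⟩)
    (RunIn.while
      (fun i => ⟨w.length - i, s.out, fun k => if k = t then
            s.reg t + (w.length - i) else if k = r then w.length - i else s.reg k⟩) w.length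
      ?_ ?_ ?_ ?_ ?_)
    (RunIn.loop (fun i => ⟨i, s.out, fun k => if k = t then
            s.reg t + w.length else if k = r then i else s.reg k⟩) w.length ?_ ?_ ?_ ?_)).mono ?_
  · refine CState.ext_reg (by simp [hs]) rfl fun k => ?_
    dsimp only
    split_ifs <;> simp_all
  · rfl
  · simp [Test.holds]
  · intro i hi
    simp [Test.holds]
    omega
  · intro i hi
    refine (RunIn.act _ rfl).seq ((RunIn.act _ rfl).seq (RunIn.act _ ?_))
    refine CState.ext_reg ?_ rfl fun k => ?_
    · simp only [Act.exec]
      omega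
    simp only [Act.exec, update_apply]
    split_ifs <;> omega
  · rfl
  · refine CState.ext_reg hs.symm rfl fun k => ?_
    simp only [CState.add, update_apply]
    split_ifs <;> simp_all
  · intro i hi
    dsimp only
    split_ifs <;> omega
  · intro i hi
    refine RunIn.act _ ?_
    refine CState.ext_reg rfl rfl fun k => ?_
    simp only [Act.exec, update_apply]
    split_ifs <;> omega
  · simp
    omega

theorem CState.add_reg_of_ne {s : CState} {t v k : ℕ} (h : k ≠ t) : (s.add t v).reg k = s.reg k := by
  simp [CState.add, h]

/-- Running a program that adds a value to a fresh counter. -/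
theorem Adds.run_fresh {P : (ℕ → ℕ) → ℕ → ℕ → Cmd A} {v : List A → (ℕ → ℕ) → ℕ}
    {p : Polynomial ℕ} (h : Adds P v p) {w : List A} {θ : ℕ → ℕ} {r : ℕ} {s : CState} {B : ℕ}
    (hs : s.pos = 0) (hr : ∀ k, r ≤ k → s.reg k = 0) (hθ : ∀ x, θ x < r) (hw : w.length ≤ B)
    (hB : ∀ x, s.reg (θ x) ≤ B) :
    RunIn w (P θ r (r + 1)) s (s.add r (v w (s.reg ∘ θ))) (p.eval B) :=
  h w θ r (r + 1) s B hs (fun k hk => hr k (by omega)) (fun x => (hθ x).trans (by omega))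
    (fun x => (hθ x).ne) (by omega) hw hB

/-- A position `v` past the end does no harm: the head stops at the end, where it reads no symbol,
in agreement with `w[v]?`, and `v` backward moves still lead to `0`. -/
theorem Expr.adds_bit {e : Expr A} {p q : Polynomial ℕ} (h : Adds e.cmd e.eval p)
    (hq : ∀ (w : List A) (ρ : ℕ → ℕ) (B : ℕ), w.length ≤ B → (∀ x, ρ x ≤ B) → e.eval w ρ ≤ q.eval B)
    (f : Option A → Bool) :
    Adds (Expr.bit f e).cmd (Expr.bit f e).eval (p + 7 * q + 4) := by
  intro w θ t r s B hs hr hθ hθt ht hw hB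
  have h3 := hr r le_rfl
  have h4 := hr (r + 1) (by omega)
  have h5 := hq w (s.reg ∘ θ) B hw hB
  have h6 := h.run_fresh hs hr hθ hw hB
  simp only [Expr.cmd, Expr.eval]
  generalize e.eval w (s.reg ∘ θ) = v at *
  refine (h6.seq (RunIn.seq (T := v * (2 + 2) + 1) (T' := 2 + (v * (1 + 2) + 1))
    (t := { s with pos := min v w.length, reg := update s.reg (r + 1) v })
    (RunIn.loop (fun i => ⟨min (v - i) w.length, s.out, fun k => if k = r then
            i else if k = r + 1 then v - i else s.reg k⟩) v ?_ ?_ ?_ ?_)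
    (RunIn.seq (RunIn.ite (T := 1) (t := ⟨min v w.length, s.out, fun k =>
        if k = r + 1 then v else if k = t then s.reg t + (if f w[v]? then 1 else 0) else s.reg k⟩)
        (fun hc => RunIn.act _ ?_) (fun hc => RunIn.act _ ?_))
      (RunIn.loop (fun i => ⟨min v w.length - (v - i), s.out, fun k => if k = r + 1 then
            i else if k = t then s.reg t + (if f w[v]? then 1 else 0) else s.reg k⟩) v ?_ ?_ ?_ ?_)))).mono ?_
  · refine CState.ext_reg (by simp [CState.add, hs]) rfl fun k => ?_
    simp only [CState.add, update_apply]
    split_ifs <;> simp_all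
  · refine CState.ext_reg (by simp) rfl fun k => ?_
    simp only [update_apply]
    split_ifs <;> simp_all
  · intro i hi
    simp
  · intro i hi
    refine (RunIn.act _ rfl).seq (RunIn.act _ ?_)
    refine CState.ext_reg ?_ rfl fun k => ?_
    · simp only [Act.exec]
      omega
    simp only [Act.exec, update_apply]
    split_ifs <;> omega
  · have hf : f w[v]? = true := by
      rw [← hc, Test.holds]
      rcases le_total v w.length with h' | h'
      · simp [h']
      · simp [h']
    refine CState.ext_reg rfl rfl fun k => ?_
    simp only [Act.exec, update_apply, hf, if_true]
    split_ifs <;> simp_all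
  · have hf : f w[v]? = false := by
      rw [← hc, Test.holds]
      rcases le_total v w.length with h' | h'
      · simp [h']
      · simp [h']
    refine CState.ext_reg rfl rfl fun k => ?_
    simp only [Act.exec, update_apply, hf]
    split_ifs <;> simp_all
  · refine CState.ext_reg (by simp) rfl fun k => ?_
    dsimp only
  · refine CState.ext_reg (by simp [CState.add, hs]) rfl fun k => ?_
    simp only [CState.add, update_apply]
    split_ifs <;> simp_all
  · intro i hi
    simp
  · intro i hi
    refine RunIn.act _ ?_
    refine CState.ext_reg ?_ rfl fun k => ?_
    · simp only [Act.exec]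
      omega
    simp only [Act.exec, update_apply]
    split_ifs <;> omega
  · simp
    omega

/-- The index runs downwards, so with `i` passes left the terms over `Finset.Ico i N` have been
added. Products are the case of constant `g`. -/
theorem RunIn.loop_add {w : List A} {Q : Cmd A} {s : CState} {t r N T : ℕ} (g : ℕ → ℕ) (htr : t ≠ r)
    (hs : s.reg r = 0)
    (hQ : ∀ i < N, ∀ v, RunIn w Q ((s.add r i).add t v) (((s.add r i).add t v).add t (g i)) T) :
    RunIn w (.loop r Q) (s.add r N) (s.add t (∑ i ∈ Finset.range N, g i)) (N * (T + 2) + 1) := by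
  refine RunIn.loop (fun i => (s.add r i).add t (∑ j ∈ Finset.Ico i N, g j)) N ?_ ?_ ?_ ?_
  · simp [CState.add]
  · refine CState.ext_reg rfl rfl fun k => ?_
    simp only [CState.add, update_apply, Finset.range_eq_Ico]
    split_ifs <;> simp_all
  · intro i _
    simp [CState.add, htr.symm, hs]
  · intro i hi
    have h := hQ i hi (∑ j ∈ Finset.Ico (i + 1) N, g j)
    convert h using 1
    · refine CState.ext_reg rfl rfl fun k => ?_
      simp only [Act.exec, CState.add, update_apply]
      split_ifs <;> omega
    · refine CState.ext_reg rfl rfl fun k => ?_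
      simp only [CState.add, update_apply, Finset.sum_eq_sum_Ico_succ_bot hi]
      split_ifs <;> omega

theorem Expr.adds_add {a b : Expr A} {p q : Polynomial ℕ} (ha : Adds a.cmd a.eval p)
    (hb : Adds b.cmd b.eval q) : Adds (Expr.add a b).cmd (Expr.add a b).eval (p + q) := by
  intro w θ t r s B hs hr hθ hθt ht hw hB
  have hreg : ∀ v x, (s.add t v).reg (θ x) = s.reg (θ x) := fun v x =>
    CState.add_reg_of_ne (hθt x)
  have h1 := ha w θ t r s B hs hr hθ hθt ht hw hB
  have h2 := hb w θ t r (s.add t (a.eval w (s.reg ∘ θ))) B hs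
    (fun k hk => by rw [CState.add_reg_of_ne (by omega)]; exact hr k hk) hθ hθt ht hw
    (fun x => by rw [hreg]; exact hB x)
  have h3 : (s.add t (a.eval w (s.reg ∘ θ))).reg ∘ θ = s.reg ∘ θ := funext fun x => hreg _ x
  rw [h3] at h2
  have h4 : s.add t ((Expr.add a b).eval w (s.reg ∘ θ)) =
      (s.add t (a.eval w (s.reg ∘ θ))).add t (b.eval w (s.reg ∘ θ)) := by
    simp [CState.add, Expr.eval, Nat.add_assoc]
  rw [Polynomial.eval_add, h4]
  exact h1.seq h2

theorem Expr.adds_sub {a b : Expr A} {p q p' q' : Polynomial ℕ} (ha : Adds a.cmd a.eval p)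
    (hb : Adds b.cmd b.eval q)
    (ha' : ∀ (w : List A) (ρ : ℕ → ℕ) (B : ℕ), w.length ≤ B → (∀ x, ρ x ≤ B) → a.eval w ρ ≤ p'.eval B)
    (hb' : ∀ (w : List A) (ρ : ℕ → ℕ) (B : ℕ), w.length ≤ B → (∀ x, ρ x ≤ B) → b.eval w ρ ≤ q'.eval B) :
    Adds (Expr.sub a b).cmd (Expr.sub a b).eval (p + q + 3 * p' + 3 * q' + 2) := by
  intro w θ t r s B hs hr hθ hθt ht hw hB
  have h1 := ha.run_fresh hs hr hθ hw hB
  have hreg : ∀ v x, (s.add r v).reg (θ x) = s.reg (θ x) := fun v x =>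
    CState.add_reg_of_ne (hθ x).ne
  have h2 := hb.run_fresh (θ := θ) (r := r + 1) (s := s.add r (a.eval w (s.reg ∘ θ))) hs
    (fun k hk => by rw [CState.add_reg_of_ne (by omega)]; exact hr k (by omega))
    (fun x => (hθ x).trans (by omega)) hw (fun x => by rw [hreg]; exact hB x)
  have h3 : (s.add r (a.eval w (s.reg ∘ θ))).reg ∘ θ = s.reg ∘ θ := funext fun x => hreg _ x
  rw [h3] at h2
  have h4 := ha' w (s.reg ∘ θ) B hw hB
  have h5 := hb' w (s.reg ∘ θ) B hw hB
  have hr0 := hr r le_rfl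
  have hr1 := hr (r + 1) (by omega)
  simp only [Expr.cmd, Expr.eval]
  generalize a.eval w (s.reg ∘ θ) = x at *
  generalize b.eval w (s.reg ∘ θ) = y at *
  refine (h1.seq (h2.seq (RunIn.seq (T := y * (1 + 2) + 1) (T' := (x - y) * (1 + 2) + 1)
    (RunIn.loop (fun i => (s.add r (x - (y - i))).add (r + 1) i) y ?_ rfl ?_ ?_)
    (RunIn.loop (fun i => (s.add r i).add t (x - y - i)) (x - y) ?_ ?_ ?_ ?_)))).mono ?_
  · simp
  · intro i _
    simp [CState.add, hr1]
  · intro i hi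
    refine RunIn.act _ (CState.ext_reg rfl rfl fun k => ?_)
    simp only [Act.exec, CState.add, update_apply]
    split_ifs <;> subst_vars <;> omega
  · refine CState.ext_reg rfl rfl fun k => ?_
    simp only [CState.add, update_apply]
    split_ifs <;> subst_vars <;> omega
  · refine CState.ext_reg rfl rfl fun k => ?_
    simp only [CState.add, update_apply]
    split_ifs <;> subst_vars <;> omega
  · intro i _
    simp [CState.add, hr0, ht.ne']
  · intro i hi
    refine RunIn.act _ (CState.ext_reg rfl rfl fun k => ?_)
    simp only [Act.exec, CState.add, update_apply]
    split_ifs <;> subst_vars <;> omega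
  · simp
    omega

theorem Expr.adds_mul {a b : Expr A} {p q p' : Polynomial ℕ} (ha : Adds a.cmd a.eval p)
    (hb : Adds b.cmd b.eval q)
    (ha' : ∀ (w : List A) (ρ : ℕ → ℕ) (B : ℕ), w.length ≤ B → (∀ x, ρ x ≤ B) → a.eval w ρ ≤ p'.eval B) :
    Adds (Expr.mul a b).cmd (Expr.mul a b).eval (p + p' * (q + 2) + 1) := by
  intro w θ t r s B hs hr hθ hθt ht hw hB
  have h1 := ha.run_fresh hs hr hθ hw hB
  have h4 := ha' w (s.reg ∘ θ) B hw hB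
  simp only [Expr.cmd, Expr.eval]
  generalize a.eval w (s.reg ∘ θ) = x at *
  refine (h1.seq (T' := x * (q.eval B + 2) + 1) ?_).mono ?_
  · have := RunIn.loop_add (w := w) (Q := b.cmd θ t (r + 1)) (N := x) (T := q.eval B)
      (fun _ => b.eval w (s.reg ∘ θ)) ht.ne (hr r le_rfl) fun i _ v => by
        have hreg : ∀ x, ((s.add r i).add t v).reg (θ x) = s.reg (θ x) := fun x => by
          rw [CState.add_reg_of_ne (hθt x), CState.add_reg_of_ne (hθ x).ne]
        have h3 : ((s.add r i).add t v).reg ∘ θ = s.reg ∘ θ := funext hreg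
        rw [← h3]
        refine hb w θ t (r + 1) _ B hs (fun k hk => ?_) (fun x => (hθ x).trans (by omega)) hθt
          (by omega) hw (fun x => by rw [hreg]; exact hB x)
        rw [CState.add_reg_of_ne (by omega), CState.add_reg_of_ne (by omega)]
        exact hr k (by omega)
    simpa using this
  · simp
    nlinarith

theorem Expr.adds_ite {c a b : Expr A} {p q o o' : Polynomial ℕ} (hc : Adds c.cmd c.eval o)
    (ha : Adds a.cmd a.eval p) (hb : Adds b.cmd b.eval q)
    (hc' : ∀ (w : List A) (ρ : ℕ → ℕ) (B : ℕ), w.length ≤ B → (∀ x, ρ x ≤ B) → c.eval w ρ ≤ o'.eval B) :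
    Adds (Expr.ite c a b).cmd (Expr.ite c a b).eval (o + 3 * o' + p + q + 2) := by
  intro w θ t r s B hs hr hθ hθt ht hw hB
  have h1 := hc.run_fresh hs hr hθ hw hB
  have h4 := hc' w (s.reg ∘ θ) B hw hB
  have h5 := ha w θ t r s B hs hr hθ hθt ht hw hB
  have h6 := hb w θ t r s B hs hr hθ hθt ht hw hB
  have hr0 := hr r le_rfl
  simp only [Expr.cmd, Expr.eval]
  generalize c.eval w (s.reg ∘ θ) = x at *
  refine (h1.seq (RunIn.ite (T := x * (1 + 2) + 1 + (p.eval B + q.eval B)) (fun h => ?_)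
    fun h => ?_)).mono ?_
  · have hx : x ≠ 0 := by simpa [Test.holds, CState.add, hr0] using h
    rw [if_pos hx]
    refine (RunIn.loop (fun i => s.add r i) x rfl ?_ ?_ ?_).seq (h5.mono (by omega))
    · simp [CState.add]
    · intro i _
      simp [CState.add, hr0]
    · intro i hi
      refine RunIn.act _ (CState.ext_reg rfl rfl fun k => ?_)
      simp only [Act.exec, CState.add, update_apply]
      split_ifs <;> omega
  · have hx : x = 0 := by simpa [Test.holds, CState.add, hr0] using h
    subst hx
    rw [if_neg (by simp)]
    have : s.add r 0 = s := by simp [CState.add]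
    rw [this]
    exact h6.mono (by omega)
  · simp
    omega

theorem Expr.adds_sum {b e : Expr A} {p q p' : Polynomial ℕ} (x : ℕ) (hb : Adds b.cmd b.eval p)
    (he : Adds e.cmd e.eval q)
    (hb' : ∀ (w : List A) (ρ : ℕ → ℕ) (B : ℕ), w.length ≤ B → (∀ x, ρ x ≤ B) → b.eval w ρ ≤ p'.eval B) :
    Adds (Expr.sum x b e).cmd (Expr.sum x b e).eval (p + p' * (q.comp (.X + p') + 2) + 1) := by
  intro w θ t r s B hs hr hθ hθt ht hw hB
  have h1 := hb.run_fresh hs hr hθ hw hB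
  have h4 := hb' w (s.reg ∘ θ) B hw hB
  simp only [Expr.cmd, Expr.eval]
  generalize b.eval w (s.reg ∘ θ) = N at *
  refine (h1.seq (RunIn.loop_add (T := q.eval (B + p'.eval B))
    (fun i => e.eval w (update (s.reg ∘ θ) x i)) ht.ne (hr r le_rfl) fun i hi v => ?_)).mono ?_
  -- Storing the bound variable in the loop counter turns the counter contents into the updated
  -- environment.
  · have hreg : ((s.add r i).add t v).reg ∘ (update θ x r) = update (s.reg ∘ θ) x i := by
      funext y
      rcases eq_or_ne y x with rfl | hy
      · simp [CState.add, ht.ne', hr r le_rfl]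
      · simp [hy, CState.add, hθt y, (hθ y).ne]
    rw [← hreg]
    have hθ' : ∀ y, update θ x r y < r + 1 := fun y => by
      rcases eq_or_ne y x with rfl | hy
      · simp
      · rw [update_of_ne hy]; have := hθ y; omega
    refine he w _ t (r + 1) _ _ hs (fun k hk => ?_) hθ' (fun y => ?_) (by omega) (by omega)
      (fun y => ?_)
    · rw [CState.add_reg_of_ne (by omega), CState.add_reg_of_ne (by omega)]
      exact hr k (by omega)
    · rcases eq_or_ne y x with rfl | hy
      · simpa using ht.ne'
      · rw [update_of_ne hy]; exact hθt y
    · have := congrFun hreg y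
      rw [comp_apply] at this
      rw [this]
      rcases eq_or_ne y x with rfl | hy
      · rw [update_self]; omega
      · rw [update_of_ne hy]; have := hB y; simp only [comp_apply]; omega
  · simp
    nlinarith

/-- The program of an expression is correct and runs in polynomial time. -/
theorem Expr.exists_adds (e : Expr A) : ∃ p, Adds e.cmd e.eval p := by
  induction e with
  | const c =>
    exact ⟨.C (c + 1), fun w θ t r s B _ _ _ _ _ _ _ =>
      (RunIn.addConst w t c s).mono (by simp)⟩
  | var x => exact ⟨_, adds_var x⟩
  | len => exact ⟨_, adds_len⟩
  | bit f e ih =>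
    obtain ⟨p, hp⟩ := ih
    obtain ⟨q, hq⟩ := e.exists_eval_le
    exact ⟨_, adds_bit hp hq f⟩
  | add a b iha ihb =>
    obtain ⟨p, hp⟩ := iha
    obtain ⟨q, hq⟩ := ihb
    exact ⟨_, adds_add hp hq⟩
  | sub a b iha ihb =>
    obtain ⟨p, hp⟩ := iha
    obtain ⟨q, hq⟩ := ihb
    obtain ⟨p', hp'⟩ := a.exists_eval_le
    obtain ⟨q', hq'⟩ := b.exists_eval_le
    exact ⟨_, adds_sub hp hq hp' hq'⟩
  | mul a b iha ihb =>
    obtain ⟨p, hp⟩ := iha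
    obtain ⟨q, hq⟩ := ihb
    obtain ⟨p', hp'⟩ := a.exists_eval_le
    exact ⟨_, adds_mul hp hq hp'⟩
  | ite c a b ihc iha ihb =>
    obtain ⟨o, ho⟩ := ihc
    obtain ⟨p, hp⟩ := iha
    obtain ⟨q, hq⟩ := ihb
    obtain ⟨o', ho'⟩ := c.exists_eval_le
    exact ⟨_, adds_ite ho hp hq ho'⟩
  | sum x b e ihb ihe =>
    obtain ⟨p, hp⟩ := ihb
    obtain ⟨q, hq⟩ := ihe
    obtain ⟨p', hp'⟩ := b.exists_eval_le
    exact ⟨_, adds_sum x hp hq hp'⟩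

/-! ### Programs that write words -/

/-- Descriptions of words: a single symbol that tells whether an expression is positive, a
concatenation, or the concatenation of the words for all values below a bound of a variable. -/
inductive WordExpr (A : Type)
  | bit (e : Expr A)
  | append (P Q : WordExpr A)
  | concat (x : ℕ) (b : Expr A) (P : WordExpr A)

/-- The word that is described. -/
def WordExpr.eval (w : List A) : WordExpr A → (ℕ → ℕ) → List Bool
  | .bit e, ρ => [decide (e.eval w ρ ≠ 0)]
  | .append P Q, ρ => P.eval w ρ ++ Q.eval w ρ
  | .concat x b P, ρ => (List.range (b.eval w ρ)).flatMap fun i => P.eval w (update ρ x i)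

/-- A program that writes the word, from its end to its beginning. -/
def WordExpr.cmd : WordExpr A → (ℕ → ℕ) → ℕ → Cmd A
  | .bit e, θ, r => .seq (e.cmd θ r (r + 1))
      (.ite (.pos r) (.seq (.loop r (.act .nop)) (.act (.emit true))) (.act (.emit false)))
  | .append P Q, θ, r => .seq (Q.cmd θ r) (P.cmd θ r)
  | .concat x b P, θ, r => .seq (b.cmd θ r (r + 1)) (.loop r (P.cmd (update θ x r) (r + 1)))

/-- Write a word in front of the output. -/
def CState.write (s : CState) (l : List Bool) : CState := { s with out := l ++ s.out }

/-- The output grows at its front, so the later parts of a word are written first. This matches the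
downward order of the loops: with `i` passes left, the words of the indices from `i` on are in
place. -/
theorem WordExpr.exists_run (P : WordExpr A) : ∃ p : Polynomial ℕ,
    ∀ (w : List A) (θ : ℕ → ℕ) (r : ℕ) (s : CState) (B : ℕ), s.pos = 0 →
      (∀ k, r ≤ k → s.reg k = 0) → (∀ x, θ x < r) → w.length ≤ B → (∀ x, s.reg (θ x) ≤ B) →
      RunIn w (P.cmd θ r) s (s.write (P.eval w (s.reg ∘ θ))) (p.eval B) := by
  induction P with
  | bit e =>
    obtain ⟨p, hp⟩ := e.exists_adds
    obtain ⟨q, hq⟩ := e.exists_eval_le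
    refine ⟨p + 3 * q + 3, fun w θ r s B hs hr hθ hw hB => ?_⟩
    have h1 := hp.run_fresh hs hr hθ hw hB
    have h4 := hq w (s.reg ∘ θ) B hw hB
    have hr0 := hr r le_rfl
    simp only [cmd, eval]
    generalize e.eval w (s.reg ∘ θ) = x at *
    refine (h1.seq (RunIn.ite (T := x * (1 + 2) + 1 + 1) (fun h => ?_) fun h => ?_)).mono ?_
    · have hx : x ≠ 0 := by simpa [Test.holds, CState.add, hr0] using h
      refine (RunIn.loop (t := s) (fun i => s.add r i) x rfl ?_ ?_ ?_).seq (RunIn.act _ ?_)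
      · simp [CState.add]
      · intro i _
        simp [CState.add, hr0]
      · intro i hi
        refine RunIn.act _ (CState.ext_reg rfl rfl fun k => ?_)
        simp only [Act.exec, CState.add, update_apply]
        split_ifs <;> omega
      · simp [Act.exec, CState.write, hx]
    · have hx : x = 0 := by simpa [Test.holds, CState.add, hr0] using h
      subst hx
      exact (RunIn.act _ (by simp [Act.exec, CState.write, CState.add])).mono (by omega)
    · simp
      omega
  | append P Q ihP ihQ =>
    obtain ⟨p, hp⟩ := ihP
    obtain ⟨q, hq⟩ := ihQ
    refine ⟨q + p, fun w θ r s B hs hr hθ hw hB => ?_⟩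
    have h1 := hq w θ r s B hs hr hθ hw hB
    have h2 := hp w θ r (s.write (Q.eval w (s.reg ∘ θ))) B hs hr hθ hw hB
    have h3 : s.write ((append P Q).eval w (s.reg ∘ θ)) =
        (s.write (Q.eval w (s.reg ∘ θ))).write (P.eval w (s.reg ∘ θ)) := by
      simp [CState.write, eval]
    rw [Polynomial.eval_add, h3]
    exact h1.seq h2
  | concat x b P ih =>
    obtain ⟨p, hp⟩ := b.exists_adds
    obtain ⟨q, hq⟩ := ih
    obtain ⟨p', hp'⟩ := b.exists_eval_le
    refine ⟨p + p' * (q.comp (.X + p') + 2) + 1, fun w θ r s B hs hr hθ hw hB => ?_⟩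
    have h1 := hp.run_fresh hs hr hθ hw hB
    have h4 := hp' w (s.reg ∘ θ) B hw hB
    have hr0 := hr r le_rfl
    simp only [cmd, eval]
    generalize b.eval w (s.reg ∘ θ) = N at *
    refine (h1.seq (RunIn.loop (T := q.eval (B + p'.eval B)) (fun i => (s.add r i).write
      ((List.range' i (N - i)).flatMap fun i => P.eval w (update (s.reg ∘ θ) x i))) N ?_ ?_ ?_
      ?_)).mono ?_
    · simp [CState.write]
    · simp [CState.write, CState.add, List.range_eq_range']
    · intro i _
      simp [CState.write, CState.add, hr0]
    · intro i hi
      have hreg : (s.add r i).reg ∘ (update θ x r) = update (s.reg ∘ θ) x i := by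
        funext y
        rcases eq_or_ne y x with rfl | hy
        · simp [CState.add, hr r le_rfl]
        · simp [hy, CState.add, (hθ y).ne]
      have hθ' : ∀ y, update θ x r y < r + 1 := fun y => by
        rcases eq_or_ne y x with rfl | hy
        · simp
        · rw [update_of_ne hy]; have := hθ y; omega
      have h := hq w (update θ x r) (r + 1) ((s.add r i).write
        ((List.range' (i + 1) (N - (i + 1))).flatMap fun i => P.eval w (update (s.reg ∘ θ) x i)))
        (B + p'.eval B) hs (fun k hk => ?_) hθ' (by omega) (fun y => ?_)
      · convert h using 1
        · refine CState.ext_reg rfl rfl fun k => ?_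
          simp only [Act.exec, CState.add, CState.write, update_apply]
          split_ifs <;> omega
        · have h5 : N - i = (N - (i + 1)) + 1 := by omega
          refine CState.ext_reg rfl ?_ fun k => rfl
          change _ = P.eval w ((s.add r i).reg ∘ (update θ x r)) ++ _
          rw [hreg, h5, List.range'_succ]
          simp [CState.write]
      · exact (CState.add_reg_of_ne (by omega)).trans (hr k (by omega))
      · refine (congrFun hreg y).trans_le ?_
        rcases eq_or_ne y x with rfl | hy
        · rw [update_self]; omega
        · rw [update_of_ne hy]; have := hB y; simp only [comp_apply]; omega
    · simp
      nlinarith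

/-- A function that is described by a `WordExpr` is computable in polynomial time. -/
theorem WordExpr.computableInPolyTime [Inhabited A] [Fintype A] {α β : Type} {ea : α → List A}
    {eb : β → List Bool} {f : α → β} (P : WordExpr A)
    (h : ∀ a, P.eval (ea a) (fun _ => 0) = eb (f a)) :
    Nonempty (TM2ComputableInPolyTime ea eb f) := by
  obtain ⟨p, hp⟩ := P.exists_run
  -- All variables start with the value `0`, so they can share the counter `0`; the counters from
  -- `1` on are free.
  refine (P.cmd (fun _ => 0) 1).computableInPolyTime p fun a => ?_
  have := hp (ea a) (fun _ => 0) 1 ⟨0, [], fun _ => 0⟩ (ea a).length rfl (fun _ _ => rfl)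
    (fun _ => by omega) le_rfl (fun _ => Nat.zero_le _)
  have h' : P.eval (ea a) ((fun _ => 0) ∘ fun _ => 0) = eb (f a) := h a
  rw [h'] at this
  simpa [CState.write, RunIn] using this

end Reconf

namespace Reconf

open Turing Function

/-! ### Composition of polynomial-time machines -/

section Lift

variable {K K' : Type} {Γ' : K' → Type} {Λ Λ' σ σ' : Type}

/-- A statement that jumps to a label, or halts. -/
def exitStmt : Option Λ' → TM2.Stmt Γ' Λ' σ'
  | some l => .goto fun _ => l
  | none => .halt

/-- A statement of a machine as a statement of a machine with more stacks and a larger state, which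
continues at `exit` instead of halting. -/
def liftStmt (ι : K → K') (get : σ' → σ) (set : σ → σ' → σ') (lab : Λ → Λ') (exit : Option Λ') :
    TM2.Stmt (fun k => Γ' (ι k)) Λ σ → TM2.Stmt Γ' Λ' σ'
  | .push k f q => .push (ι k) (fun v => f (get v)) (liftStmt ι get set lab exit q)
  | .peek k f q => .peek (ι k) (fun v x => set (f (get v) x) v) (liftStmt ι get set lab exit q)
  | .pop k f q => .pop (ι k) (fun v x => set (f (get v) x) v) (liftStmt ι get set lab exit q)
  | .load f q => .load (fun v => set (f (get v)) v) (liftStmt ι get set lab exit q)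
  | .branch f q₁ q₂ => .branch (fun v => f (get v)) (liftStmt ι get set lab exit q₁)
      (liftStmt ι get set lab exit q₂)
  | .goto f => .goto fun v => lab (f (get v))
  | .halt => exitStmt exit

variable [DecidableEq K] [DecidableEq K'] {ι : K → K'} {get : σ' → σ} {set : σ → σ' → σ'}
  {lab : Λ → Λ'} {exit : Option Λ'}

theorem restrict_update (hι : Injective ι) (S : ∀ k, List (Γ' k)) (k : K) (l : List (Γ' (ι k))) :
    (fun j => update S (ι k) l (ι j)) = update (fun j => S (ι j)) k l := by
  funext j
  rcases eq_or_ne j k with rfl | h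
  · simp
  · rw [update_of_ne h, update_of_ne (hι.ne h)]

/-- The lens laws for `get` and `set` confine the changes to one component of the internal state,
and injectivity of `ι` keeps the embedded stacks apart. -/
theorem stepAux_liftStmt (hι : Injective ι) (hgs : ∀ v s, get (set v s) = v)
    (hss : ∀ u v s, set u (set v s) = set u s) (hsg : ∀ s, set (get s) s = s)
    (q : TM2.Stmt (fun k => Γ' (ι k)) Λ σ) (v : σ') (S : ∀ k, List (Γ' k)) :
    ∃ S' : ∀ k, List (Γ' k), (∀ k ∉ Set.range ι, S' k = S k) ∧
      (fun k => S' (ι k)) = (TM2.stepAux q (get v) fun k => S (ι k)).stk ∧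
      TM2.stepAux (liftStmt ι get set lab exit q) v S =
        ⟨(TM2.stepAux q (get v) fun k => S (ι k)).l.elim exit (some ∘ lab),
          set (TM2.stepAux q (get v) fun k => S (ι k)).var v, S'⟩ := by
  induction q generalizing v S with
  | push k f q ih =>
    obtain ⟨S', h1, h2, h3⟩ := ih v (update S (ι k) (f (get v) :: S (ι k)))
    rw [restrict_update hι] at h2 h3
    refine ⟨S', fun j hj => ?_, h2, h3⟩
    rw [h1 j hj, update_of_ne]
    rintro rfl
    exact hj ⟨k, rfl⟩
  | peek k f q ih =>
    obtain ⟨S', h1, h2, h3⟩ := ih (set (f (get v) (S (ι k)).head?) v) S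
    rw [hgs] at h2 h3
    rw [hss] at h3
    exact ⟨S', h1, h2, h3⟩
  | pop k f q ih =>
    obtain ⟨S', h1, h2, h3⟩ := ih (set (f (get v) (S (ι k)).head?) v)
      (update S (ι k) (S (ι k)).tail)
    rw [restrict_update hι, hgs] at h2 h3
    rw [hss] at h3
    refine ⟨S', fun j hj => ?_, h2, h3⟩
    rw [h1 j hj, update_of_ne]
    rintro rfl
    exact hj ⟨k, rfl⟩
  | load f q ih =>
    obtain ⟨S', h1, h2, h3⟩ := ih (set (f (get v)) v) S
    rw [hgs] at h2 h3
    rw [hss] at h3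
    exact ⟨S', h1, h2, h3⟩
  | branch f q₁ q₂ ih₁ ih₂ =>
    simp only [liftStmt, TM2.stepAux]
    cases f (get v)
    · exact ih₂ v S
    · exact ih₁ v S
  | goto f => exact ⟨S, fun _ _ => rfl, rfl, by simp [liftStmt, TM2.stepAux, hsg]⟩
  | halt => exact ⟨S, fun _ _ => rfl, rfl, by
      cases exit <;> simp [liftStmt, exitStmt, TM2.stepAux, hsg]⟩

theorem stepsTo_lift (hι : Injective ι) (hgs : ∀ v s, get (set v s) = v)
    (hss : ∀ u v s, set u (set v s) = set u s) (hsg : ∀ s, set (get s) s = s)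
    {M : Λ → TM2.Stmt (fun k => Γ' (ι k)) Λ σ} {M' : Λ' → TM2.Stmt Γ' Λ' σ'}
    (hM : ∀ l, M' (lab l) = liftStmt ι get set lab exit (M l)) (n : ℕ)
    (l : Option Λ) (v : σ') (S : ∀ k, List (Γ' k)) (u : σ) (T : ∀ k, List (Γ' (ι k)))
    (h : StepsTo (TM2.step M) n ⟨l, get v, fun k => S (ι k)⟩ ⟨none, u, T⟩) :
    ∃ S' : ∀ k, List (Γ' k), (∀ k ∉ Set.range ι, S' k = S k) ∧ (fun k => S' (ι k)) = T ∧
      StepsTo (TM2.step M') n ⟨l.elim exit (some ∘ lab), v, S⟩ ⟨exit, set u v, S'⟩ := by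
  induction n generalizing l v S with
  | zero =>
    have h' : (⟨l, get v, fun k => S (ι k)⟩ : TM2.Cfg _ _ _) = ⟨none, u, T⟩ := Option.some.inj h
    injection h' with h1 h2 h3
    subst h1 h2 h3
    exact ⟨S, fun _ _ => rfl, rfl, by rw [hsg]; rfl⟩
  | succ n ih =>
    cases l with
    -- A halted configuration has no successor, so no run of `n + 1` steps starts from it.
    | none =>
      exfalso
      have : ∀ m, (flip bind (TM2.step M))^[m] none = none := fun m =>
        iterate_fixed rfl m
      unfold StepsTo at h
      rw [iterate_succ_apply] at h
      exact Option.some_ne_none _ (h.symm.trans (this n))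
    | some l =>
      obtain ⟨S', h1, h2, h3⟩ := stepAux_liftStmt (lab := lab) (exit := exit) hι hgs hss hsg (M l) v S
      have h4 : StepsTo (TM2.step M) n (TM2.stepAux (M l) (get v) fun k => S (ι k)) ⟨none, u, T⟩ := h
      generalize TM2.stepAux (M l) (get v) (fun k => S (ι k)) = c at *
      obtain ⟨cl, cv, cs⟩ := c
      dsimp only at h2 h3
      subst h2
      obtain ⟨S'', h5, h6, h7⟩ := ih cl (set cv v) S' (by rwa [hgs])
      refine ⟨S'', fun k hk => (h5 k hk).trans (h1 k hk), h6, ?_⟩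
      rw [hss] at h7
      rw [Nat.add_comm]
      refine StepsTo.trans (StepsTo.single (congrArg some ?_)) h7
      rw [← h3, hM]

end Lift

/-! ### Stack growth along a computation -/

section Growth

variable {K : Type} [DecidableEq K] {Γ : K → Type} {Λ σ : Type}

/-- A bound on the number of symbols that a statement pushes. -/
def pushes : TM2.Stmt Γ Λ σ → ℕ
  | .push _ _ q => pushes q + 1
  | .peek _ _ q => pushes q
  | .pop _ _ q => pushes q
  | .load _ q => pushes q
  | .branch _ q₁ q₂ => pushes q₁ + pushes q₂
  | .goto _ => 0
  | .halt => 0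

theorem length_stepAux_le (q : TM2.Stmt Γ Λ σ) (v : σ) (S : ∀ k, List (Γ k)) (k : K) :
    ((TM2.stepAux q v S).stk k).length ≤ (S k).length + pushes q := by
  induction q generalizing v S with
  | push j f q ih =>
    refine (ih v _).trans ?_
    rcases eq_or_ne k j with rfl | h
    · simp [pushes]; omega
    · simp [pushes, h]
  | peek j f q ih => exact ih _ _
  | pop j f q ih =>
    refine (ih _ _).trans ?_
    rcases eq_or_ne k j with rfl | h
    · simp [pushes]
    · simp [pushes, h]
  | load f q ih => exact ih _ _
  | branch f q₁ q₂ ih₁ ih₂ =>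
    simp only [TM2.stepAux, pushes]
    cases f v
    · exact (ih₂ v S).trans (by omega)
    · exact (ih₁ v S).trans (by omega)
  | goto f => simp [TM2.stepAux, pushes]
  | halt => simp [TM2.stepAux, pushes]

/-- In a composition this bounds the input length of the second machine by the input length and
running time of the first. -/
theorem length_le_of_stepsTo {M : Λ → TM2.Stmt Γ Λ σ} {C : ℕ} (hC : ∀ l, pushes (M l) ≤ C) {n : ℕ}
    {c c' : TM2.Cfg Γ Λ σ} (h : StepsTo (TM2.step M) n c c') (k : K) :
    (c'.stk k).length ≤ (c.stk k).length + n * C := by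
  induction n generalizing c with
  | zero =>
    have : c = c' := Option.some.inj h
    simp [this]
  | succ n ih =>
    obtain ⟨l, v, S⟩ := c
    cases l with
    | none =>
      exfalso
      have : ∀ m, (flip bind (TM2.step M))^[m] none = none := fun m => iterate_fixed rfl m
      unfold StepsTo at h
      rw [iterate_succ_apply] at h
      exact Option.some_ne_none _ (h.symm.trans (this n))
    | some l =>
      have h4 : StepsTo (TM2.step M) n (TM2.stepAux (M l) v S) c' := h
      have h1 := ih h4
      have h2 := length_stepAux_le (M l) v S k
      have h3 := hC l
      dsimp only
      nlinarith

end Growth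

theorem initList_stk (tm : FinTM2) (s : List (tm.Γ tm.k₀)) :
    (initList tm s).stk = update (fun _ => []) tm.k₀ s := by
  funext k
  simp only [initList]
  by_cases h : k = tm.k₀
  · subst h
    simp
  · simp [h]

theorem haltList_stk (tm : FinTM2) (s : List (tm.Γ tm.k₁)) :
    (haltList tm s).stk = update (fun _ => []) tm.k₁ s := by
  funext k
  simp only [haltList]
  by_cases h : k = tm.k₁
  · subst h
    simp
  · simp [h]

/-! ### The composed machine -/

section Comp

variable (M₁ M₂ : FinTM2) (B : Type) [Inhabited B] (e₁ : M₁.Γ M₁.k₁ ≃ B)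
  (e₂ : M₂.Γ M₂.k₀ ≃ B)

/-- The stack alphabets of the composed machine: those of both machines, and that of an auxiliary
stack. -/
abbrev CompSym : M₁.K ⊕ Option M₂.K → Type
  | .inl k => M₁.Γ k
  | .inr none => B
  | .inr (some k) => M₂.Γ k

/-- The program that runs `M₁`, moves the output of `M₁` to the input of `M₂`, and runs `M₂`. -/
def compProgram : M₁.Λ ⊕ Bool ⊕ M₂.Λ →
    TM2.Stmt (CompSym M₁ M₂ B) (M₁.Λ ⊕ Bool ⊕ M₂.Λ) (M₁.σ × Option B × M₂.σ)
  | .inl l => liftStmt (Γ' := CompSym M₁ M₂ B) Sum.inl Prod.fst (fun u v => (u, v.2)) Sum.inl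
      (some (.inr (.inl false))) (M₁.m l)
  | .inr (.inl false) => .pop (.inl M₁.k₁) (fun v x => (v.1, x.map e₁, v.2.2))
      (.branch (fun v => v.2.1.isSome)
        (.push (.inr none) (fun v => v.2.1.getD default) (.goto fun _ => .inr (.inl false)))
        (.goto fun _ => .inr (.inl true)))
  | .inr (.inl true) => .pop (.inr none) (fun v x => (v.1, x, v.2.2))
      (.branch (fun v => v.2.1.isSome)
        (.push (.inr (some M₂.k₀)) (fun v => e₂.symm (v.2.1.getD default))
          (.goto fun _ => .inr (.inl true)))
        (.goto fun _ => .inr (.inr M₂.main)))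
  | .inr (.inr l) => liftStmt (Γ' := CompSym M₁ M₂ B) (fun k => Sum.inr (some k))
      (fun v => v.2.2) (fun u v => (v.1, v.2.1, u)) (fun l => Sum.inr (Sum.inr l)) none (M₂.m l)

theorem StepsTo.congr_right {C : Type*} {f : C → Option C} {n : ℕ} {c c' c'' : C}
    (h : StepsTo f n c c') (h' : c' = c'') : StepsTo f n c c'' := h' ▸ h

/-- A transfer between stacks reverses the word. The auxiliary stack exists so that a second
transfer can restore the order. -/
theorem stepsTo_unload (v : M₁.σ × Option B × M₂.σ) (S : ∀ k, List (CompSym M₁ M₂ B k))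
    (L : List B) (h : S (.inl M₁.k₁) = L.map e₁.symm) :
    StepsTo (TM2.step (compProgram M₁ M₂ B e₁ e₂)) (L.length + 1) ⟨some (.inr (.inl false)), v, S⟩
      ⟨some (.inr (.inl true)), (v.1, none, v.2.2),
        update (update S (.inl M₁.k₁) []) (.inr none) (L.reverse ++ S (.inr none))⟩ := by
  induction L generalizing v S with
  | nil =>
    refine StepsTo.single (congrArg some ?_)
    simp only [compProgram, TM2.stepAux]
    rw [h]
    simp only [List.map_nil, List.head?_nil, Option.map_none, Option.isSome_none, cond_false,
      List.tail_nil, List.reverse_nil, List.nil_append]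
    congr 1
    exact (update_eq_iff.2 ⟨by simp, fun _ _ => rfl⟩).symm
  | cons a L ih =>
    rw [List.length_cons, Nat.add_comm]
    have := ih (v.1, some a, v.2.2)
      (update (update S (.inl M₁.k₁) (L.map e₁.symm)) (.inr none) (a :: S (.inr none))) (by simp)
    refine StepsTo.congr_right (StepsTo.trans (StepsTo.single (congrArg some ?_)) this) ?_
    · simp only [compProgram, TM2.stepAux]
      rw [h]
      simp
    · congr 1
      funext k
      rcases k with k | _ | k
      · by_cases hk : k = M₁.k₁
        · subst hk; simp
        · simp [hk]
      · simp
      · simp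

theorem stepsTo_load (v : M₁.σ × Option B × M₂.σ) (S : ∀ k, List (CompSym M₁ M₂ B k))
    (L : List B) (h : S (.inr none) = L) :
    StepsTo (TM2.step (compProgram M₁ M₂ B e₁ e₂)) (L.length + 1) ⟨some (.inr (.inl true)), v, S⟩
      ⟨some (.inr (.inr M₂.main)), (v.1, none, v.2.2),
        update (update S (.inr none) []) (.inr (some M₂.k₀))
          ((L.map e₂.symm).reverse ++ S (.inr (some M₂.k₀)))⟩ := by
  induction L generalizing v S with
  | nil =>
    refine StepsTo.single (congrArg some ?_)
    simp only [compProgram, TM2.stepAux]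
    rw [h]
    simp only [List.map_nil, List.head?_nil, Option.isSome_none, cond_false,
      List.tail_nil, List.reverse_nil, List.nil_append]
    congr 1
    exact (update_eq_iff.2 ⟨by simp, fun _ _ => rfl⟩).symm
  | cons a L ih =>
    rw [List.length_cons, Nat.add_comm]
    have := ih (v.1, some a, v.2.2)
      (update (update S (.inr none) L) (.inr (some M₂.k₀)) (e₂.symm a :: S (.inr (some M₂.k₀))))
      (by simp)
    refine StepsTo.congr_right (StepsTo.trans (StepsTo.single (congrArg some ?_)) this) ?_
    · simp only [compProgram, TM2.stepAux]
      rw [h]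
      simp
    · congr 1
      funext k
      rcases k with k | _ | k
      · simp
      · simp
      · by_cases hk : k = M₂.k₀
        · subst hk; simp
        · simp [hk]

/-- A halting configuration carries the initial internal state and leaves all stacks but the output
empty, so the internal state is `v₀` at every hand-over and `M₂` finds clean stacks. -/
theorem stepsTo_compProgram {x : List (M₁.Γ M₁.k₀)} {y : List B} {z : List (M₂.Γ M₂.k₁)} {n₁ n₂ : ℕ}
    (h₁ : StepsTo M₁.step n₁ (initList M₁ x) (haltList M₁ (y.map e₁.symm)))
    (h₂ : StepsTo M₂.step n₂ (initList M₂ (y.map e₂.symm)) (haltList M₂ z)) :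
    StepsTo (TM2.step (compProgram M₁ M₂ B e₁ e₂)) (n₁ + ((y.length + 1) + ((y.length + 1) + n₂)))
      ⟨some (.inl M₁.main), (M₁.initialState, none, M₂.initialState),
        update (fun _ => []) (.inl M₁.k₀) x⟩
      ⟨none, (M₁.initialState, none, M₂.initialState),
        update (fun _ => []) (.inr (some M₂.k₁)) z⟩ := by
  set v₀ : M₁.σ × Option B × M₂.σ := (M₁.initialState, none, M₂.initialState) with hv₀
  obtain ⟨S₁, hS₁, hS₁', hs₁⟩ := stepsTo_lift (Γ' := CompSym M₁ M₂ B) (M := M₁.m)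
    (M' := compProgram M₁ M₂ B e₁ e₂)
    (ι := Sum.inl) (get := Prod.fst) (set := fun u v => (u, v.2)) (lab := Sum.inl)
    (exit := some (.inr (.inl false))) Sum.inl_injective (fun _ _ => rfl) (fun _ _ _ => rfl)
    (fun _ => rfl) (fun _ => rfl) n₁ (some M₁.main) v₀
    (update (fun _ => []) (.inl M₁.k₀) x) M₁.initialState (haltList M₁ (y.map e₁.symm)).stk (by
      rw [restrict_update (Γ' := CompSym M₁ M₂ B) Sum.inl_injective, ← initList_stk]
      exact h₁)
  have h₃ := stepsTo_unload M₁ M₂ B e₁ e₂ v₀ S₁ y (by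
    refine (congrFun hS₁' M₁.k₁).trans ?_
    rw [haltList_stk, update_self])
  have h₄ := stepsTo_load M₁ M₂ B e₁ e₂ v₀
    (update (update S₁ (.inl M₁.k₁) []) (.inr none) (y.reverse ++ S₁ (.inr none))) y.reverse (by
    rw [update_self, hS₁ _ (by simp), update_of_ne (by simp), List.append_nil])
  obtain ⟨S₂, hS₂, hS₂', hs₂⟩ := stepsTo_lift (Γ' := CompSym M₁ M₂ B) (M := M₂.m)
    (M' := compProgram M₁ M₂ B e₁ e₂)
    (ι := fun k => Sum.inr (some k)) (get := fun v => v.2.2) (set := fun u v => (v.1, v.2.1, u))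
    (lab := fun l => Sum.inr (Sum.inr l))
    (exit := none) (Sum.inr_injective.comp (Option.some_injective _)) (fun _ _ => rfl)
    (fun _ _ _ => rfl) (fun _ => rfl) (fun _ => rfl) n₂ (some M₂.main) v₀
    (update (fun _ => []) (.inr (some M₂.k₀)) (y.map e₂.symm)) M₂.initialState (haltList M₂ z).stk (by
      rw [restrict_update (Γ' := CompSym M₁ M₂ B) (ι := fun k => Sum.inr (some k))
        (Sum.inr_injective.comp (Option.some_injective _)), ← initList_stk]
      exact h₂)
  have hhalt : S₂ = update (β := fun k => List (CompSym M₁ M₂ B k)) (fun _ => [])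
      (Sum.inr (some M₂.k₁)) z := by
    funext k
    rcases k with k | _ | k
    · rw [hS₂ _ (by simp), update_of_ne (by simp), update_of_ne (by simp)]
    · rw [hS₂ _ (by simp), update_of_ne (by simp), update_of_ne (by simp)]
    · refine (congrFun hS₂' k).trans ?_
      rw [haltList_stk]
      exact (congrFun (restrict_update (Γ' := CompSym M₁ M₂ B) (ι := fun k => Sum.inr (some k))
        (Sum.inr_injective.comp (Option.some_injective _)) (fun _ => []) M₂.k₁ z) k).symm
  rw [← hhalt]
  refine hs₁.trans (h₃.trans (StepsTo.trans ?_ hs₂))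
  rw [List.length_reverse] at h₄
  convert! h₄ using 2
  funext k
  rcases k with k | _ | k
  · rw [update_of_ne (by simp), update_of_ne (by simp), update_of_ne (by simp),
      update_of_ne (by simp)]
    by_cases hk : k = M₁.k₁
    · subst hk
      rw [update_self]
    · rw [update_of_ne (by simpa using hk)]
      refine Eq.symm ((congrFun hS₁' k).trans ?_)
      rw [haltList_stk, update_of_ne hk]
  · rw [update_of_ne (by simp), update_of_ne (by simp), update_self]
  · by_cases hk : k = M₂.k₀
    · subst hk
      rw [update_self, update_self, update_of_ne (by simp), update_of_ne (by simp),
        hS₁ _ (by simp), update_of_ne (by simp)]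
      simp
    · rw [update_of_ne (by simpa using hk), update_of_ne (by simpa using hk),
        update_of_ne (by simp), update_of_ne (by simp), update_of_ne (by simp), hS₁ _ (by simp),
        update_of_ne (by simp)]

/-- The machine that runs `M₁` and then `M₂` on the output of `M₁`. -/
noncomputable def compMachine [Fintype B] : FinTM2 where
  K := M₁.K ⊕ Option M₂.K
  kFin := have := M₁.kFin; have := M₂.kFin; inferInstance
  k₀ := .inl M₁.k₀
  k₁ := .inr (some M₂.k₁)
  Γ := CompSym M₁ M₂ B
  Λ := M₁.Λ ⊕ Bool ⊕ M₂.Λ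
  ΛFin := have := M₁.ΛFin; have := M₂.ΛFin; inferInstance
  main := .inl M₁.main
  σ := M₁.σ × Option B × M₂.σ
  σFin := have := M₁.σFin; have := M₂.σFin; inferInstance
  initialState := (M₁.initialState, none, M₂.initialState)
  Γk₀Fin := M₁.Γk₀Fin
  m := compProgram M₁ M₂ B e₁ e₂

theorem stepsTo_compMachine [Fintype B] {x : List (M₁.Γ M₁.k₀)} {y : List B}
    {z : List (M₂.Γ M₂.k₁)} {n₁ n₂ : ℕ}
    (h₁ : StepsTo M₁.step n₁ (initList M₁ x) (haltList M₁ (y.map e₁.symm)))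
    (h₂ : StepsTo M₂.step n₂ (initList M₂ (y.map e₂.symm)) (haltList M₂ z)) :
    StepsTo (compMachine M₁ M₂ B e₁ e₂).step (n₁ + ((y.length + 1) + ((y.length + 1) + n₂)))
      (initList (compMachine M₁ M₂ B e₁ e₂) x) (haltList (compMachine M₁ M₂ B e₁ e₂) z) := by
  have hinit : initList (compMachine M₁ M₂ B e₁ e₂) x = ⟨some (.inl M₁.main),
      (M₁.initialState, none, M₂.initialState), update (fun _ => []) (.inl M₁.k₀) x⟩ :=
    congrArg (TM2.Cfg.mk _ _) (initList_stk (compMachine M₁ M₂ B e₁ e₂) x)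
  have hhalt : haltList (compMachine M₁ M₂ B e₁ e₂) z = ⟨none,
      (M₁.initialState, none, M₂.initialState), update (fun _ => []) (.inr (some M₂.k₁)) z⟩ :=
    congrArg (TM2.Cfg.mk _ _) (haltList_stk (compMachine M₁ M₂ B e₁ e₂) z)
  rw [hinit, hhalt]
  exact stepsTo_compProgram M₁ M₂ B e₁ e₂ h₁ h₂

end Comp

/-- Functions that are computable in polynomial time are closed under composition. -/
theorem comp_computableInPolyTime {α β γ αΓ βΓ γΓ : Type} [Fintype βΓ] [Inhabited βΓ]
    {ea : α → List αΓ} {eb : β → List βΓ} {ec : γ → List γΓ} {f : α → β} {g : β → γ}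
    (h₁ : TM2ComputableInPolyTime ea eb f) (h₂ : TM2ComputableInPolyTime eb ec g) :
    Nonempty (TM2ComputableInPolyTime ea ec (g ∘ f)) := by
  obtain ⟨C, hC⟩ : ∃ C, ∀ l, pushes (h₁.tm.m l) ≤ C := by
    have := h₁.tm.ΛFin
    exact ⟨∑ l, pushes (h₁.tm.m l), fun l =>
      Finset.single_le_sum (f := fun l => pushes (h₁.tm.m l)) (fun _ _ => Nat.zero_le _)
        (Finset.mem_univ l)⟩
  -- `q` bounds the length of the intermediate word. The two transfers cost at most `q + 1` steps
  -- each, and the second machine runs on an input of length at most `q`.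
  let q : Polynomial ℕ := .X + h₁.time * .C C
  refine ⟨⟨⟨compMachine h₁.tm h₂.tm βΓ h₁.outputAlphabet h₂.inputAlphabet, h₁.inputAlphabet,
    h₂.outputAlphabet⟩, h₁.time + 2 * (q + 1) + h₂.time.comp q, fun a => ?_⟩⟩
  have o₁ := h₁.outputsFun a
  have o₂ := h₂.outputsFun (f a)
  have s₁ : StepsTo h₁.tm.step o₁.steps _ (haltList h₁.tm _) := o₁.evals_in_steps
  have s₂ : StepsTo h₂.tm.step o₂.steps _ (haltList h₂.tm _) := o₂.evals_in_steps
  have hlen : (eb (f a)).length ≤ q.eval (ea a).length := by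
    have h := length_le_of_stepsTo hC s₁ h₁.tm.k₁
    rw [haltList_stk, update_self, initList_stk, List.length_map] at h
    -- The output stack may be the input stack, in which case it starts with the input on it.
    have h' : (update (fun _ => []) h₁.tm.k₀ (List.map h₁.inputAlphabet.invFun (ea a))
        h₁.tm.k₁).length ≤ (ea a).length := by
      by_cases hk : h₁.tm.k₁ = h₁.tm.k₀
      · rw [hk, update_self, List.length_map]
      · rw [update_of_ne hk]
        exact Nat.zero_le _
    have h'' := Nat.mul_le_mul_right C o₁.steps_le_m
    simp only [q, Polynomial.eval_add, Polynomial.eval_X, Polynomial.eval_mul, Polynomial.eval_C]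
    omega
  refine ⟨⟨_, stepsTo_compMachine h₁.tm h₂.tm βΓ h₁.outputAlphabet h₂.inputAlphabet s₁ s₂⟩, ?_⟩
  have t₁ := o₁.steps_le_m
  have t₂ := o₂.steps_le_m.trans (eval_mono h₂.time hlen)
  simp
  omega

end Reconf

namespace Reconf

open Function

/-! ### Cancellation of a common summand -/

section Cancel

variable {V W U : Type} {K : SimpleGraph V} {H : SimpleGraph W} {G : SimpleGraph U}

/-- `Trace φ n x g`: iterating `φ`, starting at `x`, one stays in the first summand for `n` steps and
arrives at `g` in the second summand in the next one. -/
def Trace (φ : V ⊕ W → V ⊕ U) : ℕ → V ⊕ W → U → Prop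
  | 0, x, g => φ x = Sum.inr g
  | n + 1, x, g => ∃ k, φ x = Sum.inl k ∧ Trace φ n (Sum.inl k) g

/-- Both sums carry the same graph `K` on their first summand, so a value of `φ` there can be fed
back into `φ` without changing adjacencies. -/
theorem Trace.adj_iff (φ : (K.sum H) ↪g (K.sum G)) {n : ℕ} {x y : V ⊕ W} {g g' : U}
    (hx : Trace φ n x g) (hy : Trace φ n y g') : (K.sum H).Adj x y ↔ G.Adj g g' := by
  induction n generalizing x y with
  | zero =>
    rw [← φ.map_adj_iff, hx, hy]
    rfl
  | succ n ih =>
    obtain ⟨k, hk, hx⟩ := hx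
    obtain ⟨k', hk', hy⟩ := hy
    rw [← ih hx hy, ← φ.map_adj_iff, hk, hk']
    rfl

theorem Trace.inj (φ : (K.sum H) ↪g (K.sum G)) {n : ℕ} {x y : V ⊕ W} {g : U}
    (hx : Trace φ n x g) (hy : Trace φ n y g) : x = y := by
  induction n generalizing x y with
  | zero => exact φ.injective (hx.trans hy.symm)
  | succ n ih =>
    obtain ⟨k, hk, hx⟩ := hx
    obtain ⟨k', hk', hy⟩ := hy
    have := ih hx hy
    exact φ.injective (by rw [hk, hk', Sum.inl.inj this])

theorem Trace.exists_inl {φ : V ⊕ W → V ⊕ U} {n m : ℕ} {x : V ⊕ W} {g : U}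
    (h : Trace φ (m + 1 + n) x g) : ∃ k, Trace φ n (Sum.inl k) g := by
  induction m generalizing x with
  | zero =>
    rw [Nat.zero_add, Nat.add_comm] at h
    exact ⟨h.choose, h.choose_spec.2⟩
  | succ m ih =>
    rw [show m + 1 + 1 + n = (m + 1 + n) + 1 by ring] at h
    obtain ⟨k, -, h⟩ := h
    exact ih h

/-- When the shorter trace enters the second summand, the longer one is still in the first, and
there are no edges between the summands. -/
theorem Trace.not_adj (φ : (K.sum H) ↪g (K.sum G)) {n m : ℕ} {x y : V ⊕ W} {g g' : U}
    (hx : Trace φ n x g) (hy : Trace φ (m + 1 + n) y g') : ¬ (K.sum H).Adj x y := by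
  induction n generalizing x y with
  | zero =>
    obtain ⟨k, hk, -⟩ := hy
    rw [← φ.map_adj_iff, hx, hk]
    simp
  | succ n ih =>
    obtain ⟨k, hk, hx⟩ := hx
    obtain ⟨k', hk', hy⟩ := hy
    rw [← φ.map_adj_iff, hk, hk']
    exact ih hx hy

/-- On the finite set of points whose iteration never leaves the first summand, `φ` induces an
injective, hence surjective, self-map. Its values lie in the first summand, so no `Sum.inr h`
belongs to this set. -/
theorem exists_trace [Finite V] [Finite W] (φ : (K.sum H) ↪g (K.sum G)) (h : W) :
    ∃ n g, Trace φ n (Sum.inr h) g := by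
  by_contra hcon
  push Not at hcon
  have hbad : ∀ x, (∀ n g, ¬ Trace φ n x g) → ∃ k, φ x = Sum.inl k ∧ ∀ n g, ¬ Trace φ n (Sum.inl k) g := by
    intro x hx
    rcases hφ : φ x with k | g
    · exact ⟨k, rfl, fun n g hk => hx (n + 1) g ⟨k, hφ, hk⟩⟩
    · exact absurd hφ (hx 0 g)
  choose k hk hk' using hbad
  let ψ : {x : V ⊕ W // ∀ n g, ¬ Trace φ n x g} → {x : V ⊕ W // ∀ n g, ¬ Trace φ n x g} :=
    fun x => ⟨Sum.inl (k x.1 x.2), hk' x.1 x.2⟩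
  have hψ : Injective ψ := fun x y hxy => by
    have h1 : k x.1 x.2 = k y.1 y.2 := Sum.inl.inj (congrArg Subtype.val hxy)
    exact Subtype.ext (φ.injective (by rw [hk x.1 x.2, hk y.1 y.2, h1]))
  obtain ⟨x, hx⟩ := Finite.surjective_of_injective hψ ⟨Sum.inr h, hcon⟩
  exact Sum.inl_ne_inr (congrArg Subtype.val hx)

/-- If the disjoint union of `K` and `H` is an induced subgraph of the disjoint union of `K` and `G`,
then `H` is an induced subgraph of `G`. -/
theorem sum_cancel [Finite V] [Finite W] (φ : (K.sum H) ↪g (K.sum G)) : Nonempty (H ↪g G) := by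
  choose n g hg using exists_trace φ
  -- The longer trace passes through some `Sum.inl k` with exactly `n h` steps left. This point is
  -- distinct from and not adjacent to `Sum.inr h`, and traces of equal length preserve both facts.
  have key : ∀ h h', n h < n h' → g h ≠ g h' ∧ ¬ G.Adj (g h) (g h') := by
    intro h h' hlt
    obtain ⟨m, hm⟩ : ∃ m, n h' = m + 1 + n h := ⟨n h' - n h - 1, by omega⟩
    obtain ⟨k, hk⟩ := Trace.exists_inl (hm ▸ hg h')
    refine ⟨fun heq => ?_, fun hadj => ?_⟩
    · rw [← heq] at hk
      exact Sum.inr_ne_inl (Trace.inj φ (hg h) hk)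
    · exact (by simp : ¬ (K.sum H).Adj (Sum.inr h) (Sum.inl k)) ((Trace.adj_iff φ (hg h) hk).2 hadj)
  refine ⟨⟨⟨g, fun h h' heq => ?_⟩, fun {h h'} => ?_⟩⟩
  · rcases lt_trichotomy (n h) (n h') with hlt | hlt | hlt
    · exact absurd heq (key h h' hlt).1
    · have := hg h'
      rw [← hlt, ← heq] at this
      exact Sum.inr.inj (Trace.inj φ (hg h) this)
    · exact absurd heq.symm (key h' h hlt).1
  · change G.Adj (g h) (g h') ↔ H.Adj h h'
    rcases lt_trichotomy (n h) (n h') with hlt | hlt | hlt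
    · refine iff_of_false (key h h' hlt).2 fun hadj => ?_
      obtain ⟨m, hm⟩ : ∃ m, n h' = m + 1 + n h := ⟨n h' - n h - 1, by omega⟩
      exact Trace.not_adj φ (hg h) (hm ▸ hg h') (by simpa using hadj)
    · have := hg h'
      rw [← hlt] at this
      rw [← Trace.adj_iff φ (hg h) this]
      rfl
    · refine iff_of_false (fun hadj => (key h' h hlt).2 hadj.symm) fun hadj => ?_
      obtain ⟨m, hm⟩ : ∃ m, n h = m + 1 + n h' := ⟨n h - n h' - 1, by omega⟩
      exact Trace.not_adj φ (hg h') (hm ▸ hg h) (by simpa using hadj.symm)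

end Cancel

/-! ### Induced copies and token jumping -/

theorem isInducedIsoSet_iff {V W : Type} [Fintype W] {G : SimpleGraph V} {H : SimpleGraph W}
    {S : Finset V} : IsInducedIsoSet G H S ↔ ∃ f : H ↪g G, Finset.univ.map f.toEmbedding = S := by
  constructor
  · rintro ⟨e⟩
    refine ⟨(SimpleGraph.Embedding.induce (S : Set V)).comp e.toEmbedding, ?_⟩
    ext v
    simp only [Finset.mem_map, Finset.mem_univ, true_and]
    constructor
    · rintro ⟨w, rfl⟩
      exact (e w).2
    · intro hv
      exact ⟨e.symm ⟨v, hv⟩, by simp⟩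
  · rintro ⟨f, rfl⟩
    refine ⟨⟨Equiv.ofBijective (fun w => ⟨f w, by simp⟩) ⟨?_, ?_⟩, ?_⟩⟩
    · intro w w' h
      exact f.injective (congrArg Subtype.val h)
    · rintro ⟨v, hv⟩
      obtain ⟨w, hw⟩ : ∃ w, f w = v := by simpa using hv
      exact ⟨w, Subtype.ext hw⟩
    · intro w w'
      exact f.map_adj_iff

theorem IsInducedIsoSet.card_eq {V W : Type} [Fintype W] {G : SimpleGraph V} {H : SimpleGraph W}
    {S : Finset V} (h : IsInducedIsoSet G H S) : S.card = Fintype.card W := by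
  obtain ⟨f, rfl⟩ := isInducedIsoSet_iff.1 h
  simp

theorem IsInducedIsoSet.map {V V' W W' : Type} {G : SimpleGraph V} {G' : SimpleGraph V'}
    {H : SimpleGraph W} {H' : SimpleGraph W'} (e : G ≃g G') (e' : H ≃g H') {S : Finset V}
    (h : IsInducedIsoSet G H S) : IsInducedIsoSet G' H' (S.map e.toEquiv.toEmbedding) := by
  obtain ⟨f⟩ := h
  have h1 : (S.map e.toEquiv.toEmbedding : Set V') = e.toEquiv '' S := by simp
  rw [IsInducedIsoSet, h1]
  exact ⟨(e'.symm.trans f).trans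
    ⟨e.toEquiv.image S, by rintro ⟨a, ha⟩ ⟨b, hb⟩; exact e.map_adj_iff⟩⟩

theorem ReconfigurableTJ.map {V V' W W' : Type} [DecidableEq V] [DecidableEq V']
    {G : SimpleGraph V} {G' : SimpleGraph V'} {H : SimpleGraph W} {H' : SimpleGraph W'}
    (e : G ≃g G') (e' : H ≃g H') {k : ℕ} {S T : Finset V} (h : ReconfigurableTJ G H k S T) :
    ReconfigurableTJ G' H' k (S.map e.toEquiv.toEmbedding) (T.map e.toEquiv.toEmbedding) := by
  obtain ⟨l, σ, h0, hl, hσ, hstep⟩ := h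
  refine ⟨l, fun i => (σ i).map e.toEquiv.toEmbedding, by simp [h0], by simp [hl],
    fun i hi => (hσ i hi).map e e', fun i hi => ?_⟩
  obtain ⟨h1, h2⟩ := hstep i hi
  refine ⟨by simpa using h1, ?_⟩
  rw [← Finset.map_sdiff]
  simpa using h2

theorem reconfigurableTJ_map_iff {V V' W W' : Type} [DecidableEq V] [DecidableEq V']
    {G : SimpleGraph V} {G' : SimpleGraph V'} {H : SimpleGraph W} {H' : SimpleGraph W'}
    (e : G ≃g G') (e' : H ≃g H') {k : ℕ} {S T : Finset V} :
    ReconfigurableTJ G' H' k (S.map e.toEquiv.toEmbedding) (T.map e.toEquiv.toEmbedding) ↔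
      ReconfigurableTJ G H k S T := by
  refine ⟨fun h => ?_, fun h => h.map e e'⟩
  have := h.map e.symm e'.symm
  have hmap : ∀ S : Finset V,
      (S.map e.toEquiv.toEmbedding).map e.symm.toEquiv.toEmbedding = S := by
    intro S
    rw [Finset.map_map]
    convert Finset.map_refl
    ext v
    simp
  rwa [hmap, hmap] at this

theorem exists_isInducedIsoSet_iff {V W : Type} [Fintype W] {G : SimpleGraph V}
    {H : SimpleGraph W} : (∃ S, IsInducedIsoSet G H S) ↔ Nonempty (H ↪g G) := by
  simp only [isInducedIsoSet_iff]
  exact ⟨fun ⟨_, f, _⟩ => ⟨f⟩, fun ⟨f⟩ => ⟨_, f, rfl⟩⟩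

/-! ### The gadget -/

section Gadget

variable {V U : Type}

/-- Three disjoint copies of a graph. -/
abbrev triple (P : SimpleGraph V) : SimpleGraph (V ⊕ (V ⊕ V)) := P.sum (P.sum P)

/-- Two sides, each consisting of three disjoint copies of `P`, that are completely joined to each
other, and a graph `Q` that is completely joined to the second and the third copy on both sides. -/
def gadget (P : SimpleGraph V) (Q : SimpleGraph U) :
    SimpleGraph ((Bool × (V ⊕ (V ⊕ V))) ⊕ U) where
  Adj
    | .inl (s, x), .inl (s', x') => s ≠ s' ∨ (triple P).Adj x x'
    | .inl (_, x), .inr _ => x.isRight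
    | .inr _, .inl (_, x) => x.isRight
    | .inr u, .inr u' => Q.Adj u u'
  symm := ⟨by
    rintro (⟨s, x⟩ | u) (⟨s', x'⟩ | u') h
    · exact h.imp Ne.symm SimpleGraph.Adj.symm
    · exact h
    · exact h
    · exact SimpleGraph.Adj.symm h⟩
  loopless := ⟨by
    rintro (⟨s, x⟩ | u) h
    · exact h.elim (fun h => h rfl) ((triple P).loopless.irrefl x)
    · exact Q.loopless.irrefl u h⟩

variable (P : SimpleGraph V) (Q : SimpleGraph U)

/-- The copy in which a vertex lies. -/
def copyOf : V ⊕ (V ⊕ V) → Fin 3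
  | .inl _ => 0
  | .inr (.inl _) => 1
  | .inr (.inr _) => 2

variable {P Q}

theorem copyOf_eq_of_adj {x y : V ⊕ (V ⊕ V)} (h : (triple P).Adj x y) : copyOf x = copyOf y := by
  rcases x with x | x | x <;> rcases y with y | y | y <;> simp_all [copyOf, triple]

/-- Two of the three copies. -/
theorem exists_double_embedding (P : SimpleGraph V) (c : Fin 3) :
    ∃ f : P.sum P ↪g triple P, ∀ x, copyOf (f x) ≠ c := by
  fin_cases c
  · refine ⟨SimpleGraph.Embedding.sumInr, ?_⟩
    rintro (x | x)
    · exact (by decide : (1 : Fin 3) ≠ 0)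
    · exact (by decide : (2 : Fin 3) ≠ 0)
  · refine ⟨SimpleGraph.Embedding.sum SimpleGraph.Embedding.refl SimpleGraph.Embedding.sumInr, ?_⟩
    rintro (x | x)
    · exact (by decide : (0 : Fin 3) ≠ 1)
    · exact (by decide : (2 : Fin 3) ≠ 1)
  · refine ⟨SimpleGraph.Embedding.sum SimpleGraph.Embedding.refl SimpleGraph.Embedding.sumInl, ?_⟩
    rintro (x | x)
    · exact (by decide : (0 : Fin 3) ≠ 2)
    · exact (by decide : (1 : Fin 3) ≠ 2)

/-- An induced copy of the three copies does not meet both sides. -/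
theorem not_both_sides (hPQ : IsEmpty (P.sum P ↪g Q)) (f : triple P ↪g gadget P Q)
    {a b : V ⊕ (V ⊕ V)} {x y : V ⊕ (V ⊕ V)} {s : Bool} (ha : f a = .inl (s, x))
    (hb : f b = .inl (!s, y)) : False := by
  -- Every vertex on a side is adjacent to `f a` or to `f b`, whichever is opposite, and adjacent
  -- vertices belong to one copy of `P`.
  have hside : ∀ c s' z, f c = .inl (s', z) → copyOf c = copyOf a := by
    have hab : copyOf b = copyOf a := by
      refine copyOf_eq_of_adj (P := P) (f.map_adj_iff.1 ?_)
      rw [ha, hb]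
      exact Or.inl (by simp)
    intro c s' z hc
    by_cases hs : s' = s
    · rw [← hab]
      refine copyOf_eq_of_adj (P := P) (f.map_adj_iff.1 ?_)
      rw [hc, hb]
      exact Or.inl (by simp [hs])
    · refine copyOf_eq_of_adj (P := P) (f.map_adj_iff.1 ?_)
      rw [hc, ha]
      exact Or.inl hs
  -- The two other copies then miss both sides and embed `2P` in `Q`.
  obtain ⟨g, hg⟩ := exists_double_embedding P (copyOf a)
  have hU : ∀ z, ∃ u, f (g z) = .inr u := by
    intro z
    rcases h : f (g z) with ⟨s', w⟩ | u
    · exact absurd (hside _ _ _ h) (hg z)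
    · exact ⟨u, rfl⟩
  choose u hu using hU
  refine hPQ.false ⟨⟨u, fun z z' h => ?_⟩, fun {z z'} => ?_⟩
  · exact g.injective (f.injective (by rw [hu, hu, h]))
  · rw [← g.map_adj_iff, ← f.map_adj_iff, hu, hu]
    rfl

/-- An induced copy of the three copies does not meet `Q`. -/
theorem not_meets_right [Fintype V] [Nonempty V] (hPQ : IsEmpty (P.sum P ↪g Q))
    (f : triple P ↪g gadget P Q) {a : V ⊕ (V ⊕ V)} {u : U} (ha : f a = .inr u) : False := by
  obtain ⟨s, hs⟩ : ∃ s, ∀ c s' x, f c = .inl (s', x) → s' = s := by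
    by_cases h : ∃ c x, f c = .inl (true, x)
    · obtain ⟨c, x, hc⟩ := h
      refine ⟨true, fun c' s' x' hc' => ?_⟩
      by_contra hs'
      rw [Bool.not_eq_true] at hs'
      exact not_both_sides hPQ f hc (hs' ▸ hc')
    · refine ⟨false, fun c' s' x' hc' => ?_⟩
      by_contra hs'
      rw [Bool.not_eq_false] at hs'
      exact h ⟨c', x', hs' ▸ hc'⟩
  -- Suppose a vertex goes to the part of the side that is joined to `Q`. It is adjacent to `f a`,
  -- so `a` and `b` lie in one copy of `P`. The other two copies can meet neither `Q` nor that part,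
  -- and their `2|V|` vertices would have to fit into the first copy.
  by_cases hr : ∃ b x, f b = .inl (s, .inr x)
  · obtain ⟨b, x, hb⟩ := hr
    obtain ⟨g, hg⟩ := exists_double_embedding P (copyOf a)
    have hab : copyOf b = copyOf a := by
      refine copyOf_eq_of_adj (P := P) (f.map_adj_iff.1 ?_)
      rw [ha, hb]
      rfl
    have hV : ∀ z, ∃ v, f (g z) = .inl (s, .inl v) := by
      intro z
      rcases h : f (g z) with ⟨s', v | w⟩ | u'
      · exact ⟨v, by rw [hs _ _ _ h]⟩
      · refine absurd (copyOf_eq_of_adj (P := P) (f.map_adj_iff.1 ?_)) (hg z)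
        rw [h, ha]
        rfl
      · refine absurd ((copyOf_eq_of_adj (P := P) (f.map_adj_iff.1 ?_)).trans hab) (hg z)
        rw [h, hb]
        rfl
    choose v hv using hV
    have hinj : Injective v := fun z z' h => g.injective (f.injective (by rw [hv, hv, h]))
    have := Fintype.card_le_of_injective v hinj
    rw [Fintype.card_sum] at this
    have := Fintype.card_pos (α := V)
    omega
  -- Otherwise the image lies in `Q` and the first copy on one side, with no edges between the two.
  -- So `3P` embeds in `P ⊔ Q`, and one `P` cancels.
  · have hW : ∀ z, ∃ y : V ⊕ U, f z = y.map (fun v => (s, .inl v)) id := by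
      intro z
      rcases h : f z with ⟨s', v | w⟩ | u'
      · exact ⟨.inl v, by rw [hs _ _ _ h]; rfl⟩
      · rw [hs _ _ _ h] at h
        exact absurd ⟨z, w, h⟩ hr
      · exact ⟨.inr u', rfl⟩
    choose y hy using hW
    have φ : triple P ↪g P.sum Q := by
      refine ⟨⟨y, fun z z' h => f.injective (by rw [hy, hy, h])⟩, fun {z z'} => ?_⟩
      rw [← f.map_adj_iff, hy, hy]
      change (P.sum Q).Adj (y z) (y z') ↔ _
      rcases y z with v | u₁ <;> rcases y z' with v' | u₂ <;> simp [gadget]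
    exact hPQ.elim (sum_cancel φ).some

/-- The vertices of one side. -/
def side [Fintype V] (s : Bool) : Finset ((Bool × (V ⊕ (V ⊕ V))) ⊕ U) :=
  Finset.univ.map ⟨fun x => .inl (s, x), fun x y h => by simpa using h⟩

/-- Only tokens on the image of `C` can move. -/
theorem tokenJump_map {V W : Type} [Fintype W] [DecidableEq V] (f g : W ↪ V) (C : Finset W) {k : ℕ}
    (h : ∀ x ∉ C, f x = g x) (hC : C.card ≤ k) :
    TokenJump k (Finset.univ.map f) (Finset.univ.map g) := by
  refine ⟨by simp, (Finset.card_le_card (t := C.map f) fun v hv => ?_).trans (by simpa using hC)⟩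
  simp only [Finset.mem_sdiff, Finset.mem_map, Finset.mem_univ, true_and, not_exists] at hv ⊢
  obtain ⟨⟨x, rfl⟩, hx⟩ := hv
  refine ⟨x, ?_, rfl⟩
  by_contra hxC
  exact hx x (h x hxC).symm

/-- One copy on a side, and a copy of two copies in `Q`. -/
def gadgetEmbedding (g : P.sum P ↪g Q) (s : Bool) : triple P ↪g gadget P Q where
  toFun
    | .inl v => .inl (s, .inl v)
    | .inr y => .inr (g y)
  inj' := by
    rintro (x | x) (y | y) h
    · simpa using h
    · simp at h
    · simp at h
    · exact congrArg _ (g.injective (Sum.inr.inj h))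
  map_rel_iff' := by
    rintro (x | x) (y | y)
    · exact or_iff_right (by simp)
    · exact iff_of_false (by exact Bool.false_ne_true) (by simp)
    · exact iff_of_false (by exact Bool.false_ne_true) (by simp)
    · exact g.map_adj_iff

/-- A whole side. -/
def sideEmbedding (P : SimpleGraph V) (Q : SimpleGraph U) (s : Bool) : triple P ↪g gadget P Q where
  toFun x := .inl (s, x)
  inj' := fun x y h => by simpa using h
  map_rel_iff' := by
    intro x y
    exact or_iff_right (by simp)

theorem side_isInducedIsoSet [Fintype V] (P : SimpleGraph V) (Q : SimpleGraph U) (s : Bool) :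
    IsInducedIsoSet (gadget P Q) (triple P) (side s) :=
  isInducedIsoSet_iff.2 ⟨sideEmbedding P Q s, rfl⟩

theorem gadget_reconfigurable_iff [Fintype V] [DecidableEq V] [DecidableEq U] (P : SimpleGraph V)
    (Q : SimpleGraph U) {μ : ℕ} (hμ : 1 ≤ μ) (hV : μ ≤ Fintype.card V) :
    ReconfigurableTJ (gadget P Q) (triple P) (Fintype.card V + (Fintype.card V + Fintype.card V) - μ)
      (side false) (side true) ↔ Nonempty (P.sum P ↪g Q) := by
  have hne : Nonempty V := Fintype.card_pos_iff.1 (by omega)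
  constructor
  · rintro ⟨l, σ, h0, hl, hσ, hstep⟩
    by_contra hPQ
    rw [not_nonempty_iff] at hPQ
    have hside : ∀ i ≤ l, ∀ s x, Sum.inl (s, x) ∈ σ i → ∀ y ∈ σ i, ∃ z, y = .inl (s, z) := by
      intro i hi s x hx y hy
      obtain ⟨f, hf⟩ := isInducedIsoSet_iff.1 (hσ i hi)
      rw [← hf] at hx hy
      simp only [Finset.mem_map, Finset.mem_univ, true_and] at hx hy
      obtain ⟨a, ha⟩ := hx
      obtain ⟨b, hb⟩ := hy
      rcases y with ⟨s', z⟩ | u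
      · by_cases hs : s' = s
        · exact ⟨z, by rw [hs]⟩
        · have : s' = !s := by revert hs; cases s <;> cases s' <;> simp
          exact (not_both_sides hPQ f ha (this ▸ hb)).elim
      · exact (not_meets_right hPQ f hb).elim
    have hall : ∀ i ≤ l, ∀ y ∈ σ i, ∃ z, y = .inl (false, z) := by
      intro i
      induction i with
      | zero =>
        intro _ y hy
        rw [h0] at hy
        simp only [side, Finset.mem_map, Finset.mem_univ, true_and] at hy
        obtain ⟨z, hz⟩ := hy
        exact ⟨z, hz.symm⟩
      | succ i ih =>
        intro hi
        have hstep' := hstep i (by omega)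
        -- As `μ ≥ 1`, a jump cannot move all tokens; the one that stays fixes the side of the next
        -- set.
        obtain ⟨x, hx, hx'⟩ : ∃ x ∈ σ i, x ∈ σ (i + 1) := by
          by_contra hcon
          push Not at hcon
          have h1 := hstep'.2
          rw [Finset.sdiff_eq_self_of_disjoint (Finset.disjoint_left.2 hcon),
            (hσ i (by omega)).card_eq] at h1
          simp only [Fintype.card_sum] at h1
          omega
        obtain ⟨z, rfl⟩ := ih (by omega) x hx
        exact hside (i + 1) hi false z hx'
    obtain ⟨v⟩ := hne
    obtain ⟨z, hz⟩ := hall l le_rfl (.inl (true, .inl v)) 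
      (by rw [hl]; exact Finset.mem_map.2 ⟨.inl v, Finset.mem_univ _, rfl⟩)
    simp at hz
  · rintro ⟨g⟩
    -- The three jumps move `2|V|`, `|V|` and `2|V|` tokens, each at most `3|V| - μ` because `μ ≤
    -- |V|`.
    let f : ℕ → (triple P ↪g gadget P Q) := fun i => match i with
      | 0 => sideEmbedding P Q false
      | 1 => gadgetEmbedding g false
      | 2 => gadgetEmbedding g true
      | _ => sideEmbedding P Q true
    refine ⟨3, fun i => Finset.univ.map (f i).toEmbedding, rfl, rfl,
      fun i _ => isInducedIsoSet_iff.2 ⟨f i, rfl⟩, fun i hi => ?_⟩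
    have hl : (Finset.univ.map (Embedding.inl : V ↪ V ⊕ (V ⊕ V))).card ≤
        Fintype.card V + (Fintype.card V + Fintype.card V) - μ := by
      simp only [Finset.card_map, Finset.card_univ]
      omega
    have hr : (Finset.univ.map (Embedding.inr : V ⊕ V ↪ V ⊕ (V ⊕ V))).card ≤
        Fintype.card V + (Fintype.card V + Fintype.card V) - μ := by
      simp only [Finset.card_map, Finset.card_univ, Fintype.card_sum]
      omega
    interval_cases i
    · refine tokenJump_map _ _ _ ?_ hr
      rintro (x | x) hx
      · rfl
      · simp at hx
    · refine tokenJump_map _ _ _ ?_ hl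
      rintro (x | x) hx
      · simp at hx
      · rfl
    · refine tokenJump_map _ _ _ ?_ hr
      rintro (x | x) hx
      · rfl
      · simp at hx

end Gadget

end Reconf

namespace Reconf

open Function Turing

/-! ### Graphs on initial segments -/

/-- The disjoint union of two graphs, on an initial segment. -/
def sumFin {a b : ℕ} (G : SimpleGraph (Fin a)) (H : SimpleGraph (Fin b)) :
    SimpleGraph (Fin (a + b)) := (G.sum H).comap finSumFinEquiv.symm

def sumFinIso {a b : ℕ} (G : SimpleGraph (Fin a)) (H : SimpleGraph (Fin b)) :
    G.sum H ≃g sumFin G H where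
  toEquiv := finSumFinEquiv
  map_rel_iff' := by simp [sumFin]

/-- A relation on the natural numbers that agrees with the adjacency of a graph. -/
def ReprBy {n : ℕ} (R : ℕ → ℕ → Prop) (G : SimpleGraph (Fin n)) : Prop :=
  ∀ i j : Fin n, R i j ↔ G.Adj i j

/-- The relation of a disjoint union. -/
def sumRel (a : ℕ) (R R' : ℕ → ℕ → Prop) (i j : ℕ) : Prop :=
  (i < a ∧ j < a ∧ R i j) ∨ (a ≤ i ∧ a ≤ j ∧ R' (i - a) (j - a))

theorem ReprBy.sumFin {a b : ℕ} {R R' : ℕ → ℕ → Prop} {G : SimpleGraph (Fin a)}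
    {H : SimpleGraph (Fin b)} (h : ReprBy R G) (h' : ReprBy R' H) :
    ReprBy (sumRel a R R') (sumFin G H) := by
  intro i j
  obtain ⟨x, rfl⟩ := finSumFinEquiv.surjective i
  obtain ⟨y, rfl⟩ := finSumFinEquiv.surjective j
  rw [← SimpleGraph.Iso.map_adj_iff (sumFinIso G H).symm]
  simp only [sumFinIso, SimpleGraph.Iso.symm]
  rcases x with x | x <;> rcases y with y | y <;> simp [sumRel]
  · have := x.2
    rw [← h x y]
    grind
  · exact h' x y

/-- Three copies of a graph on an initial segment. -/
abbrev tripleFin {p : ℕ} (P : SimpleGraph (Fin p)) : SimpleGraph (Fin (p + (p + p))) :=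
  sumFin P (sumFin P P)

def tripleFinIso {p : ℕ} (P : SimpleGraph (Fin p)) : triple P ≃g tripleFin P :=
  (SimpleGraph.Iso.sumCongr SimpleGraph.Iso.refl (sumFinIso P P)).trans (sumFinIso P (sumFin P P))

/-- An enumeration of the vertices of the gadget. -/
def gadgetEquiv {V U : Type} {q u : ℕ} (e : V ≃ Fin q) (e' : U ≃ Fin u) :
    (Bool × V) ⊕ U ≃ Fin (q + (q + u)) :=
  (((Equiv.boolProdEquivSum V).sumCongr (Equiv.refl U)).trans (Equiv.sumAssoc V V U)).trans
    ((Equiv.sumCongr e ((Equiv.sumCongr e e').trans finSumFinEquiv)).trans finSumFinEquiv)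

/-- The gadget on an initial segment. -/
def gadgetFin {p u : ℕ} (P : SimpleGraph (Fin p)) (Q : SimpleGraph (Fin u)) :
    SimpleGraph (Fin ((p + (p + p)) + ((p + (p + p)) + u))) :=
  (gadget P Q).comap (gadgetEquiv (tripleFinIso P).toEquiv (Equiv.refl _)).symm

def gadgetFinIso {p u : ℕ} (P : SimpleGraph (Fin p)) (Q : SimpleGraph (Fin u)) :
    gadget P Q ≃g gadgetFin P Q where
  toEquiv := gadgetEquiv (tripleFinIso P).toEquiv (Equiv.refl _)
  map_rel_iff' := by simp [gadgetFin]

/-- The relation of the gadget. -/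
def gadgetRel (p q : ℕ) (R R' : ℕ → ℕ → Prop) (i j : ℕ) : Prop :=
  (i < q ∧ j < q ∧ R i j) ∨
  (q ≤ i ∧ i < q + q ∧ q ≤ j ∧ j < q + q ∧ R (i - q) (j - q)) ∨
  (i < q ∧ q ≤ j ∧ j < q + q) ∨ (q ≤ i ∧ i < q + q ∧ j < q) ∨
  (q + q ≤ i ∧ q + q ≤ j ∧ R' (i - (q + q)) (j - (q + q))) ∨
  -- Each side begins with its first copy of `P`, which is the part not joined to `Q`.
  (q + q ≤ i ∧ j < q + q ∧ ((p ≤ j ∧ j < q) ∨ q + p ≤ j)) ∨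
  (q + q ≤ j ∧ i < q + q ∧ ((p ≤ i ∧ i < q) ∨ q + p ≤ i))

section GadgetRel

variable {p q a b : ℕ} {R R' : ℕ → ℕ → Prop}

theorem gadgetRel_left_left (ha : a < q) (hb : b < q) : gadgetRel p q R R' a b ↔ R a b := by
  unfold gadgetRel
  grind

theorem gadgetRel_left_right (ha : a < q) (hb : b < q) : gadgetRel p q R R' a (q + b) := by
  unfold gadgetRel
  grind

theorem gadgetRel_right_left (ha : a < q) (hb : b < q) : gadgetRel p q R R' (q + a) b := by
  unfold gadgetRel
  grind

theorem gadgetRel_right_right (ha : a < q) (hb : b < q) :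
    gadgetRel p q R R' (q + a) (q + b) ↔ R a b := by
  unfold gadgetRel
  rw [Nat.add_sub_cancel_left, Nat.add_sub_cancel_left]
  grind

theorem gadgetRel_left_last (ha : a < q) : gadgetRel p q R R' a (q + (q + b)) ↔ p ≤ a := by
  unfold gadgetRel
  grind

theorem gadgetRel_right_last (ha : a < q) : gadgetRel p q R R' (q + a) (q + (q + b)) ↔ p ≤ a := by
  unfold gadgetRel
  grind

theorem gadgetRel_last_left (hb : b < q) : gadgetRel p q R R' (q + (q + a)) b ↔ p ≤ b := by
  unfold gadgetRel
  grind

theorem gadgetRel_last_right (hb : b < q) : gadgetRel p q R R' (q + (q + a)) (q + b) ↔ p ≤ b := by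
  unfold gadgetRel
  grind

theorem gadgetRel_last_last : gadgetRel p q R R' (q + (q + a)) (q + (q + b)) ↔ R' a b := by
  unfold gadgetRel
  rw [← Nat.add_assoc, ← Nat.add_assoc, Nat.add_sub_cancel_left, Nat.add_sub_cancel_left]
  grind

end GadgetRel

theorem isRight_iff_le {p : ℕ} (P : SimpleGraph (Fin p)) (x : Fin p ⊕ (Fin p ⊕ Fin p)) :
    x.isRight = true ↔ p ≤ (tripleFinIso P x : ℕ) := by
  rcases x with x | x
  · simp [tripleFinIso, sumFinIso, SimpleGraph.Iso.sumCongr]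
  · simp [tripleFinIso, sumFinIso, SimpleGraph.Iso.sumCongr]

theorem ReprBy.gadgetFin {p u : ℕ} {R R' : ℕ → ℕ → Prop} {P : SimpleGraph (Fin p)}
    {Q : SimpleGraph (Fin u)} (h : ReprBy R (tripleFin P)) (h' : ReprBy R' Q) :
    ReprBy (gadgetRel p (p + (p + p)) R R') (gadgetFin P Q) := by
  intro i j
  obtain ⟨x, rfl⟩ := (gadgetFinIso P Q).surjective i
  obtain ⟨y, rfl⟩ := (gadgetFinIso P Q).surjective j
  rw [SimpleGraph.Iso.map_adj_iff]
  have hR : ∀ z z', (triple P).Adj z z' ↔ R (tripleFinIso P z) (tripleFinIso P z') :=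
    fun z z' => ((h _ _).trans (tripleFinIso P).map_adj_iff).symm
  have hlt : ∀ z, (tripleFinIso P z : ℕ) < p + (p + p) := fun z => (tripleFinIso P z).2
  rcases x with ⟨_ | _, x⟩ | x <;> rcases y with ⟨_ | _, y⟩ | y
  · exact (gadgetRel_left_left (hlt x) (hlt y)).trans
      ((hR x y).symm.trans (or_iff_right (by simp)).symm)
  · exact iff_of_true (gadgetRel_left_right (hlt x) (hlt y)) (Or.inl (by simp))
  · exact (gadgetRel_left_last (hlt x)).trans (isRight_iff_le P x).symm
  · exact iff_of_true (gadgetRel_right_left (hlt x) (hlt y)) (Or.inl (by simp))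
  · exact (gadgetRel_right_right (hlt x) (hlt y)).trans
      ((hR x y).symm.trans (or_iff_right (by simp)).symm)
  · exact (gadgetRel_right_last (hlt x)).trans (isRight_iff_le P x).symm
  · exact (gadgetRel_last_left (hlt y)).trans (isRight_iff_le P y).symm
  · exact (gadgetRel_last_right (hlt y)).trans (isRight_iff_le P y).symm
  · exact gadgetRel_last_last.trans (h' x y)

end Reconf

namespace Reconf

open Function Turing

/-! ### Functions given by expressions -/

/-- Values of finitely many variables, for each point of a space `Y` over `X`. -/
structure Context (X Y : Type) where
  base : Y → X
  depth : ℕ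
  val : Y → ℕ → ℕ

/-- The context with one more variable. -/
def Context.extend {X Y : Type} (Γ : Context X Y) : Context X (Y × ℕ) where
  base := fun y => Γ.base y.1
  depth := Γ.depth + 1
  val := fun y i => if i = Γ.depth then y.2 else Γ.val y.1 i

/-- The context without variables. -/
def Context.empty (X : Type) : Context X X where
  base := id
  depth := 0
  val := fun _ _ => 0

section Expressible

variable {A X Y : Type} (w : X → List A) (Γ : Context X Y)

/-- The environment `ρ` assigns to the variables of the context their values at `y`. -/
def Context.Agrees (y : Y) (ρ : ℕ → ℕ) : Prop := ∀ i < Γ.depth, ρ i = Γ.val y i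

/-- The function `f` is the value of an expression in the word attached to a point. -/
def Expressible (f : Y → ℕ) : Prop :=
  ∃ e : Expr A, ∀ y ρ, Γ.Agrees y ρ → e.eval (w (Γ.base y)) ρ = f y

open Classical in
/-- The predicate `R` is decided by an expression. -/
def Decides (R : Y → Prop) : Prop := Expressible w Γ fun y => if R y then 1 else 0

/-- The word `f` is the value of a word expression. -/
def Writes (f : Y → List Bool) : Prop :=
  ∃ P : WordExpr A, ∀ y ρ, Γ.Agrees y ρ → P.eval (w (Γ.base y)) ρ = f y

variable {w Γ}

theorem Context.Agrees.extend {y : Y} {ρ : ℕ → ℕ} (h : Γ.Agrees y ρ) (i : ℕ) :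
    Γ.extend.Agrees (y, i) (update ρ Γ.depth i) := by
  intro j hj
  by_cases hjk : j = Γ.depth
  · simp [Context.extend, hjk]
  · have : j < Γ.depth := by simp only [Context.extend] at hj; omega
    simp [Context.extend, hjk, h j this]

theorem Expressible.congr {f g : Y → ℕ} (h : Expressible w Γ f) (hfg : ∀ y, f y = g y) :
    Expressible w Γ g := funext hfg ▸ h

theorem Decides.congr {R S : Y → Prop} (h : Decides w Γ R) (hRS : ∀ y, R y ↔ S y) :
    Decides w Γ S := (funext fun y => propext (hRS y) : R = S) ▸ h

theorem Expressible.const (c : ℕ) : Expressible w Γ fun _ => c := ⟨.const c, fun _ _ _ => rfl⟩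

theorem Expressible.var : Expressible w Γ.extend fun y => y.2 :=
  ⟨.var Γ.depth, fun y ρ h => by simpa [Context.extend, Expr.eval] using h Γ.depth (Nat.lt_succ_self _)⟩

theorem Expressible.weaken {f : Y → ℕ} (h : Expressible w Γ f) :
    Expressible w Γ.extend fun y => f y.1 := by
  obtain ⟨e, he⟩ := h
  refine ⟨e, fun y ρ hρ => he y.1 ρ fun i hi => ?_⟩
  simpa [Context.extend, hi.ne] using hρ i (Nat.lt_succ_of_lt hi)

theorem Expressible.length : Expressible w Γ fun y => (w (Γ.base y)).length :=
  ⟨.len, fun _ _ _ => rfl⟩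

theorem Decides.bit (p : Option A → Bool) {f : Y → ℕ} (h : Expressible w Γ f) :
    Decides w Γ fun y => p (w (Γ.base y))[f y]? = true := by
  obtain ⟨e, he⟩ := h
  exact ⟨.bit p e, fun y ρ hρ => by simp [Expr.eval, he y ρ hρ]⟩

theorem Expressible.add {f g : Y → ℕ} (hf : Expressible w Γ f) (hg : Expressible w Γ g) :
    Expressible w Γ fun y => f y + g y := by
  obtain ⟨e, he⟩ := hf
  obtain ⟨e', he'⟩ := hg
  exact ⟨.add e e', fun y ρ hρ => by rw [Expr.eval, he y ρ hρ, he' y ρ hρ]⟩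

theorem Expressible.sub {f g : Y → ℕ} (hf : Expressible w Γ f) (hg : Expressible w Γ g) :
    Expressible w Γ fun y => f y - g y := by
  obtain ⟨e, he⟩ := hf
  obtain ⟨e', he'⟩ := hg
  exact ⟨.sub e e', fun y ρ hρ => by rw [Expr.eval, he y ρ hρ, he' y ρ hρ]⟩

theorem Expressible.mul {f g : Y → ℕ} (hf : Expressible w Γ f) (hg : Expressible w Γ g) :
    Expressible w Γ fun y => f y * g y := by
  obtain ⟨e, he⟩ := hf
  obtain ⟨e', he'⟩ := hg
  exact ⟨.mul e e', fun y ρ hρ => by rw [Expr.eval, he y ρ hρ, he' y ρ hρ]⟩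

theorem Expressible.pow {f : Y → ℕ} (hf : Expressible w Γ f) (k : ℕ) :
    Expressible w Γ fun y => f y ^ k := by
  induction k with
  | zero => exact .const 1
  | succ k ih => exact ih.mul hf

theorem Expressible.sum {f : Y → ℕ} {g : Y × ℕ → ℕ} (hf : Expressible w Γ f)
    (hg : Expressible w Γ.extend g) :
    Expressible w Γ fun y => ∑ i ∈ Finset.range (f y), g (y, i) := by
  obtain ⟨e, he⟩ := hf
  obtain ⟨e', he'⟩ := hg
  refine ⟨.sum Γ.depth e e', fun y ρ hρ => ?_⟩
  rw [Expr.eval, he y ρ hρ]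
  exact Finset.sum_congr rfl fun i _ => he' (y, i) _ (hρ.extend i)

theorem Decides.ne_zero {f : Y → ℕ} (hf : Expressible w Γ f) : Decides w Γ fun y => f y ≠ 0 := by
  obtain ⟨e, he⟩ := hf
  exact ⟨.ite e (.const 1) (.const 0), fun y ρ hρ => by simp [Expr.eval, he y ρ hρ]⟩

theorem Decides.not {R : Y → Prop} (h : Decides w Γ R) : Decides w Γ fun y => ¬ R y := by
  obtain ⟨e, he⟩ := h
  refine ⟨.sub (.const 1) e, fun y ρ hρ => ?_⟩
  rw [Expr.eval, he y ρ hρ]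
  by_cases hR : R y <;> simp [hR, Expr.eval]

theorem Decides.and {R S : Y → Prop} (h : Decides w Γ R) (h' : Decides w Γ S) :
    Decides w Γ fun y => R y ∧ S y :=
  Expressible.congr (h.mul h') fun y => by by_cases hR : R y <;> by_cases hS : S y <;> simp [hR, hS]

theorem Decides.or {R S : Y → Prop} (h : Decides w Γ R) (h' : Decides w Γ S) :
    Decides w Γ fun y => R y ∨ S y :=
  (h.not.and h'.not).not.congr fun _ => by tauto

theorem Decides.imp {R S : Y → Prop} (h : Decides w Γ R) (h' : Decides w Γ S) :
    Decides w Γ fun y => R y → S y :=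
  (h.not.or h').congr fun _ => by tauto

theorem Decides.iff {R S : Y → Prop} (h : Decides w Γ R) (h' : Decides w Γ S) :
    Decides w Γ fun y => (R y ↔ S y) :=
  ((h.imp h').and (h'.imp h)).congr fun _ => by tauto

theorem Decides.lt {f g : Y → ℕ} (hf : Expressible w Γ f) (hg : Expressible w Γ g) :
    Decides w Γ fun y => f y < g y :=
  (Decides.ne_zero (hg.sub hf)).congr fun _ => by omega

theorem Decides.le {f g : Y → ℕ} (hf : Expressible w Γ f) (hg : Expressible w Γ g) :
    Decides w Γ fun y => f y ≤ g y :=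
  (Decides.lt hg hf).not.congr fun _ => by omega

theorem Decides.eq {f g : Y → ℕ} (hf : Expressible w Γ f) (hg : Expressible w Γ g) :
    Decides w Γ fun y => f y = g y :=
  ((Decides.le hf hg).and (Decides.le hg hf)).congr fun _ => by omega

theorem Decides.exists {f : Y → ℕ} {R : Y × ℕ → Prop} (hf : Expressible w Γ f)
    (hR : Decides w Γ.extend R) : Decides w Γ fun y => ∃ i < f y, R (y, i) :=
  (Decides.ne_zero (hf.sum hR)).congr fun y => by simp

theorem Decides.forall {f : Y → ℕ} {R : Y × ℕ → Prop} (hf : Expressible w Γ f)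
    (hR : Decides w Γ.extend R) : Decides w Γ fun y => ∀ i < f y, R (y, i) :=
  (Decides.exists hf hR.not).not.congr fun y => by simp

/-- The truth value of a proposition that does not depend on the input is built into the expression.
-/
theorem Decides.const (R : Prop) : Decides w Γ fun _ => R := Expressible.const _

open Classical in
theorem Writes.bit {R : Y → Prop} (h : Decides w Γ R) : Writes w Γ fun y => [decide (R y)] := by
  obtain ⟨e, he⟩ := h
  refine ⟨.bit e, fun y ρ hρ => ?_⟩
  rw [WordExpr.eval, he y ρ hρ]
  simp

theorem Writes.singleton (b : Bool) : Writes w Γ fun _ => [b] :=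
  ⟨.bit (.const b.toNat), fun _ _ _ => by cases b <;> simp [WordExpr.eval, Expr.eval]⟩

theorem Writes.append {f g : Y → List Bool} (h : Writes w Γ f) (h' : Writes w Γ g) :
    Writes w Γ fun y => f y ++ g y := by
  obtain ⟨e, he⟩ := h
  obtain ⟨e', he'⟩ := h'
  exact ⟨.append e e', fun y ρ hρ => by rw [WordExpr.eval, he y ρ hρ, he' y ρ hρ]⟩

theorem Writes.concat {f : Y → ℕ} {g : Y × ℕ → List Bool} (hf : Expressible w Γ f)
    (hg : Writes w Γ.extend g) :
    Writes w Γ fun y => (List.range (f y)).flatMap fun i => g (y, i) := by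
  obtain ⟨e, he⟩ := hf
  obtain ⟨e', he'⟩ := hg
  refine ⟨.concat Γ.depth e e', fun y ρ hρ => ?_⟩
  rw [WordExpr.eval, he y ρ hρ]
  exact congrArg (fun h => List.flatMap h _) (funext fun i => he' (y, i) _ (hρ.extend i))

theorem Writes.congr {f g : Y → List Bool} (h : Writes w Γ f) (hfg : ∀ y, f y = g y) :
    Writes w Γ g := funext hfg ▸ h

theorem Writes.computableInPolyTime [Inhabited A] [Fintype A] {β : Type} {eb : β → List Bool}
    {f : X → β} (h : Writes w (Context.empty X) fun x => eb (f x)) :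
    Nonempty (TM2ComputableInPolyTime w eb f) := by
  obtain ⟨P, hP⟩ := h
  exact P.computableInPolyTime fun x => hP x _ fun i hi => absurd hi (Nat.not_lt_zero i)

variable (w)

/-- A number attached to every point of the base, given by expressions in all contexts. -/
def Scalar (f : X → ℕ) : Prop := ∀ (Y : Type) (Γ : Context X Y), Expressible w Γ fun y => f (Γ.base y)

/-- A set of numbers attached to every point of the base, given by expressions in all contexts. -/
structure Predicate (S : X → ℕ → Prop) : Prop where
  decides : ∀ {Y : Type} {Γ : Context X Y} {a : Y → ℕ}, Expressible w Γ a → Decides w Γ fun y => S (Γ.base y) (a y)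

/-- A relation attached to every point of the base, given by expressions in all contexts. -/
structure Relation (R : X → ℕ → ℕ → Prop) : Prop where
  decides : ∀ {Y : Type} {Γ : Context X Y} {a b : Y → ℕ}, Expressible w Γ a → Expressible w Γ b → Decides w Γ fun y => R (Γ.base y) (a y) (b y)

end Expressible

/-! ### Reading and writing graphs -/

/-- The adjacency relation of a graph on an initial segment, as a relation on the natural numbers. -/
def adjRel {n : ℕ} (G : SimpleGraph (Fin n)) (i j : ℕ) : Prop :=
  ∃ (hi : i < n) (hj : j < n), G.Adj ⟨i, hi⟩ ⟨j, hj⟩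

theorem reprBy_adjRel {n : ℕ} (G : SimpleGraph (Fin n)) : ReprBy (adjRel G) G :=
  fun i j => ⟨fun ⟨_, _, h⟩ => h, fun h => ⟨i.2, j.2, h⟩⟩

/-- A set of vertices, as a set of natural numbers. -/
def memRel {n : ℕ} (S : Finset (Fin n)) (i : ℕ) : Prop := ∃ hi : i < n, (⟨i, hi⟩ : Fin n) ∈ S

theorem memRel_val {n : ℕ} (S : Finset (Fin n)) (i : Fin n) : memRel S i ↔ i ∈ S :=
  ⟨fun ⟨_, h⟩ => h, fun h => ⟨i.2, h⟩⟩

theorem flatMap_finRange {α : Type} {n : ℕ} (f : Fin n → List α) (g : ℕ → List α)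
    (h : ∀ i, f i = g i) : (List.finRange n).flatMap f = (List.range n).flatMap g := by
  rw [← List.map_coe_finRange_eq_range, List.flatMap_map]
  exact congrArg (fun k => List.flatMap k _) (funext h)

theorem map_eq_flatMap_singleton {α β : Type} (f : α → β) (l : List α) :
    l.map f = l.flatMap fun a => [f a] := by
  induction l with
  | nil => rfl
  | cons a l ih => simp [ih]

open Classical in
theorem encodeVertexSet_eq {n : ℕ} {S : Finset (Fin n)} {R : ℕ → Prop} (h : ∀ i : Fin n, R i ↔ i ∈ S) :
    encodeVertexSet S = (List.range n).flatMap fun i => [decide (R i)] := by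
  rw [encodeVertexSet, map_eq_flatMap_singleton]
  exact flatMap_finRange _ _ fun i => by simp [h]

-- Over ranges of natural numbers the encoding takes the shape that a `WordExpr` produces.
open Classical in
theorem encodeGraph_eq {n : ℕ} {G : SimpleGraph (Fin n)} {R : ℕ → ℕ → Prop} (h : ReprBy R G) :
    encodeGraph G = ((List.range n).flatMap fun _ => [true]) ++ ([false] ++
      (List.range n).flatMap fun i => (List.range n).flatMap fun j => [decide (R i j)]) := by
  rw [encodeGraph]
  congr 1
  · rw [← map_eq_flatMap_singleton]
    simp
  · rw [List.singleton_append]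
    refine congrArg _ (flatMap_finRange _ _ fun i => ?_)
    rw [map_eq_flatMap_singleton]
    exact flatMap_finRange _ _ fun j => by simp [h i j]

section Write

variable {A X Y : Type} {w : X → List A} {n : X → ℕ}

theorem Writes.encodeVertexSet {S : ∀ x, Finset (Fin (n x))} {R : X → ℕ → Prop} (hn : Scalar w n)
    (hR : Predicate w R) (h : ∀ x (i : Fin (n x)), R x i ↔ i ∈ S x) (Γ : Context X Y) :
    Writes w Γ fun y => encodeVertexSet (S (Γ.base y)) :=
  (Writes.concat (hn _ Γ) (Writes.bit (hR.decides .var))).congr fun y => (encodeVertexSet_eq (h (Γ.base y))).symm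

theorem Writes.encodeGraph {G : ∀ x, SimpleGraph (Fin (n x))} {R : X → ℕ → ℕ → Prop} (hn : Scalar w n)
    (hR : Relation w R) (h : ∀ x, ReprBy (R x) (G x)) (Γ : Context X Y) :
    Writes w Γ fun y => encodeGraph (G (Γ.base y)) :=
  ((Writes.concat (hn _ Γ) (Writes.singleton true)).append ((Writes.singleton false).append
    (Writes.concat (hn _ Γ) (Writes.concat (hn _ Γ.extend)
      (Writes.bit (hR.decides Expressible.var.weaken .var)))))).congr fun y => (encodeGraph_eq (h (Γ.base y))).symm

end Write

section Closure

variable {A X : Type} {w : X → List A}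

theorem Scalar.const (c : ℕ) : Scalar w fun _ => c := fun _ _ => .const c

theorem Scalar.add {f g : X → ℕ} (hf : Scalar w f) (hg : Scalar w g) : Scalar w fun x => f x + g x :=
  fun _ Γ => (hf _ Γ).add (hg _ Γ)

theorem Scalar.mul {f g : X → ℕ} (hf : Scalar w f) (hg : Scalar w g) : Scalar w fun x => f x * g x :=
  fun _ Γ => (hf _ Γ).mul (hg _ Γ)

theorem Scalar.pow {f : X → ℕ} (hf : Scalar w f) (k : ℕ) : Scalar w fun x => f x ^ k :=
  fun _ Γ => (hf _ Γ).pow k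

theorem Relation.sumRel {n : X → ℕ} {R R' : X → ℕ → ℕ → Prop} (hn : Scalar w n) (hR : Relation w R)
    (hR' : Relation w R') : Relation w fun x => sumRel (n x) (R x) (R' x) := ⟨fun {_ Γ _ _} ha hb =>
  ((Decides.lt ha (hn _ Γ)).and ((Decides.lt hb (hn _ Γ)).and (hR.decides ha hb))).or
    ((Decides.le (hn _ Γ) ha).and ((Decides.le (hn _ Γ) hb).and
      (hR'.decides (ha.sub (hn _ Γ)) (hb.sub (hn _ Γ)))))⟩

theorem Relation.gadgetRel {p q : X → ℕ} {R R' : X → ℕ → ℕ → Prop} (hp : Scalar w p)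
    (hq : Scalar w q) (hR : Relation w R) (hR' : Relation w R') :
    Relation w fun x => gadgetRel (p x) (q x) (R x) (R' x) := ⟨fun {_ Γ a b} ha hb => by
  have hp := hp _ Γ
  have hq := hq _ Γ
  have hqq := hq.add hq
  exact ((Decides.lt ha hq).and ((Decides.lt hb hq).and (hR.decides ha hb))).or <|
    ((Decides.le hq ha).and <| (Decides.lt ha hqq).and <| (Decides.le hq hb).and <|
      (Decides.lt hb hqq).and <| hR.decides (ha.sub hq) (hb.sub hq)).or <|
    ((Decides.lt ha hq).and <| (Decides.le hq hb).and (Decides.lt hb hqq)).or <|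
    ((Decides.le hq ha).and <| (Decides.lt ha hqq).and (Decides.lt hb hq)).or <|
    ((Decides.le hqq ha).and <| (Decides.le hqq hb).and <| hR'.decides (ha.sub hqq) (hb.sub hqq)).or <|
    ((Decides.le hqq ha).and <| (Decides.lt hb hqq).and <|
      ((Decides.le hp hb).and (Decides.lt hb hq)).or (Decides.le (hq.add hp) hb)).or <|
    ((Decides.le hqq hb).and <| (Decides.lt ha hqq).and <|
      ((Decides.le hp ha).and (Decides.lt ha hq)).or (Decides.le (hq.add hp) ha))⟩

/-- The graph `K` is independent of the input, so its adjacency is a fixed finite disjunction over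
pairs of vertices. -/
theorem Relation.adjRel_const {n : ℕ} (K : SimpleGraph (Fin n)) :
    Relation w fun _ => adjRel K := by
  classical
  refine ⟨fun {Y Γ a b} ha hb => ?_⟩
  have key : ∀ s : Finset (Fin n × Fin n),
      Decides w Γ fun y => ∃ z ∈ s, K.Adj z.1 z.2 ∧ a y = z.1 ∧ b y = z.2 := by
    intro s
    induction s using Finset.induction_on with
    | empty => exact (Decides.const False).congr fun y => by simp
    | insert z s _ ih =>
      refine (((Decides.const (K.Adj z.1 z.2)).and ((Decides.eq ha (.const z.1)).and
        (Decides.eq hb (.const z.2)))).or ih).congr fun y => ?_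
      simp
  refine (key Finset.univ).congr fun y => ⟨?_, ?_⟩
  · rintro ⟨z, -, h, h1, h2⟩
    exact ⟨h1 ▸ z.1.2, h2 ▸ z.2.2, by simpa [h1, h2] using h⟩
  · rintro ⟨h1, h2, h⟩
    exact ⟨(⟨_, h1⟩, ⟨_, h2⟩), Finset.mem_univ _, h, rfl, rfl⟩

end Closure

end Reconf

/-! ### Reading encoded graphs and sets; the reduction -/

namespace Reconf

open Function Turing

/-- The word `l` can be read off the word `w` from the position `o` on, when the symbols are
translated by `tr`. -/
def Reads {A : Type} (tr : Option A → Bool) (w : List A) (o : ℕ) (l : List Bool) : Prop :=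
  ∀ i b, l[i]? = some b → tr w[o + i]? = b

section Reads

variable {A : Type} {tr : Option A → Bool} {w : List A} {o : ℕ} {l l' : List Bool}

theorem Reads.left (h : Reads tr w o (l ++ l')) : Reads tr w o l := fun i b hi => h i b <| by
  rwa [List.getElem?_append_left (List.getElem?_eq_some_iff.1 hi).1]

theorem Reads.right (h : Reads tr w o (l ++ l')) : Reads tr w (o + l.length) l' := fun i b hi => by
  rw [Nat.add_assoc]
  exact h _ b (by rwa [List.getElem?_append_right (by omega), Nat.add_sub_cancel_left])

end Reads

theorem length_flatMap_range {α : Type} {m : ℕ} {f : ℕ → List α} (hf : ∀ i, (f i).length = m) (n : ℕ) :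
    ((List.range n).flatMap f).length = n * m := by
  induction n with
  | zero => simp
  | succ n ih => simp [List.range_succ, ih, hf, Nat.succ_mul]

theorem getElem?_flatMap_range {α : Type} {m : ℕ} {f : ℕ → List α} (hf : ∀ i, (f i).length = m)
    {n i j : ℕ} (hi : i < n) (hj : j < m) : ((List.range n).flatMap f)[i * m + j]? = (f i)[j]? := by
  induction n with
  | zero => omega
  | succ n ih =>
    rw [List.range_succ, List.flatMap_append]
    rcases Nat.lt_succ_iff_lt_or_eq.1 hi with hi | rfl
    · rw [List.getElem?_append_left, ih hi]
      rw [length_flatMap_range hf]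
      nlinarith
    · rw [List.getElem?_append_right] <;> rw [length_flatMap_range hf]
      · simp
      · omega

theorem length_encodeVertexSet {n : ℕ} (S : Finset (Fin n)) : (encodeVertexSet S).length = n := by
  simp [encodeVertexSet]

theorem getElem?_encodeVertexSet {n : ℕ} (S : Finset (Fin n)) (i : Fin n) :
    (encodeVertexSet S)[(i : ℕ)]? = some (decide (i ∈ S)) := by
  simp [encodeVertexSet]

open Classical in
theorem getElem?_adjacency {n : ℕ} (G : SimpleGraph (Fin n)) (i j : Fin n) :
    ((List.range n).flatMap fun i => (List.range n).flatMap fun j =>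
      [decide (adjRel G i j)])[i * n + j]? = some (decide (G.Adj i j)) := by
  have h1 : ∀ i : ℕ, ((List.range n).flatMap fun j => [decide (adjRel G i j)]).length = n := fun i => by
    rw [length_flatMap_range (m := 1) fun _ => rfl, Nat.mul_one]
  rw [getElem?_flatMap_range h1 i.2 j.2]
  have := getElem?_flatMap_range (m := 1) (f := fun j => [decide (adjRel G i j)]) (fun _ => rfl) j.2
    Nat.zero_lt_one
  simp only [Nat.mul_one, Nat.add_zero] at this
  rw [this]
  simp [reprBy_adjRel G i j]

theorem length_encodeGraph {n : ℕ} (G : SimpleGraph (Fin n)) :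
    (encodeGraph G).length = n + 1 + n * n := by
  rw [encodeGraph_eq (reprBy_adjRel G), List.length_append, List.length_append,
    length_flatMap_range (m := 1) fun _ => rfl, length_flatMap_range (m := n) fun i => by
      rw [length_flatMap_range (m := 1) fun _ => rfl, Nat.mul_one]]
  simp
  omega

theorem getElem?_encodeGraph_of_lt {n : ℕ} (G : SimpleGraph (Fin n)) {i : ℕ} (hi : i < n) :
    (encodeGraph G)[i]? = some true := by
  rw [encodeGraph, List.getElem?_append_left (by simpa using hi)]
  simp [hi]

theorem getElem?_encodeGraph_self {n : ℕ} (G : SimpleGraph (Fin n)) :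
    (encodeGraph G)[n]? = some false := by
  rw [encodeGraph, List.getElem?_append_right (by simp)]
  simp

open Classical in
theorem getElem?_encodeGraph {n : ℕ} (G : SimpleGraph (Fin n)) (i j : Fin n) :
    (encodeGraph G)[n + 1 + (i * n + j)]? = some (decide (G.Adj i j)) := by
  have h : ((List.range n).flatMap fun _ => [true]).length = n := by
    rw [length_flatMap_range (m := 1) fun _ => rfl, Nat.mul_one]
  rw [encodeGraph_eq (reprBy_adjRel G), List.getElem?_append_right (by omega), h,
    List.getElem?_append_right (by simp; omega), ← getElem?_adjacency G i j]
  congr 1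
  simp
  omega

section Read

variable {A X : Type} {tr : Option A → Bool} {w : X → List A} {o n : X → ℕ}

/-- The number of vertices is the length of the leading block of `true`s, obtained by counting the
`i` for which the first `i + 1` symbols are all `true`. The closing `false` ends the count, and
`htr` keeps the block within the word, so that summing up to the length of the word suffices. -/
theorem scalar_of_reads (htr : tr none = false) (ho : Scalar w o) {G : ∀ x, SimpleGraph (Fin (n x))}
    (h : ∀ x, Reads tr (w x) (o x) (encodeGraph (G x))) : Scalar w n := fun Y Γ => by
  have : Expressible w Γ fun y => ∑ i ∈ Finset.range (w (Γ.base y)).length,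
      @ite _ (∀ j < i + 1, tr (w (Γ.base y))[o (Γ.base y) + j]? = true) (Classical.propDecidable _) 1 0 :=
    Expressible.length.sum (Decides.forall (Expressible.var.add (.const 1))
      (Decides.bit tr ((ho _ _).add .var)))
  refine this.congr fun y => ?_
  generalize Γ.base y = x
  have ht : ∀ i < n x, tr (w x)[o x + i]? = true := fun i hi =>
    h x i true (getElem?_encodeGraph_of_lt _ hi)
  have hle : n x ≤ (w x).length := by
    rcases Nat.eq_zero_or_pos (n x) with h0 | h0
    · omega
    · by_contra hlt
      have := ht (n x - 1) (by omega)
      rw [List.getElem?_eq_none (by omega), htr] at this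
      cases this
  have key (i : ℕ) : (∀ j < i + 1, tr (w x)[o x + j]? = true) ↔ i < n x := by
    refine ⟨fun hi => ?_, fun hi j hj => ht j (by omega)⟩
    by_contra hlt
    have h1 := hi (n x) (by omega)
    rw [h x (n x) false (getElem?_encodeGraph_self _)] at h1
    cases h1
  trans ∑ i ∈ Finset.range (w x).length, if i < n x then 1 else 0
  · refine Finset.sum_congr rfl fun i _ => ?_
    simp only [key]
  rw [Finset.sum_boole]
  have : (Finset.range (w x).length).filter (fun i => i < n x) = Finset.range (n x) := by
    ext i
    simp only [Finset.mem_filter, Finset.mem_range]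
    omega
  simp [this]

theorem relation_of_reads (ho : Scalar w o) (hn : Scalar w n) {G : ∀ x, SimpleGraph (Fin (n x))}
    (h : ∀ x, Reads tr (w x) (o x) (encodeGraph (G x))) : Relation w fun x => adjRel (G x) :=
  ⟨fun {Y Γ a b} ha hb => by
    refine ((Decides.lt ha (hn _ Γ)).and ((Decides.lt hb (hn _ Γ)).and (Decides.bit tr
      ((ho _ Γ).add (((hn _ Γ).add (.const 1)).add ((ha.mul (hn _ Γ)).add hb)))))).congr fun y => ?_
    have key : ∀ i j : Fin (n (Γ.base y)), tr (w (Γ.base y))[o (Γ.base y) + (n (Γ.base y) + 1 +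
        (i * n (Γ.base y) + j))]? = true ↔ (G (Γ.base y)).Adj i j := fun i j => by
      classical
      rw [h (Γ.base y) _ _ (getElem?_encodeGraph _ i j), decide_eq_true_iff]
    exact ⟨fun ⟨h1, h2, h3⟩ => ⟨h1, h2, (key ⟨_, h1⟩ ⟨_, h2⟩).1 h3⟩,
      fun ⟨h1, h2, h3⟩ => ⟨h1, h2, (key ⟨_, h1⟩ ⟨_, h2⟩).2 h3⟩⟩⟩

theorem predicate_of_reads (ho : Scalar w o) (hn : Scalar w n) {S : ∀ x, Finset (Fin (n x))}
    (h : ∀ x, Reads tr (w x) (o x) (encodeVertexSet (S x))) : Predicate w fun x => memRel (S x) :=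
  ⟨fun {Y Γ a} ha => by
    refine ((Decides.lt ha (hn _ Γ)).and (Decides.bit tr ((ho _ Γ).add ha))).congr fun y => ?_
    have key : ∀ i : Fin (n (Γ.base y)), tr (w (Γ.base y))[o (Γ.base y) + i]? = true ↔
        i ∈ S (Γ.base y) := fun i => by
      rw [h (Γ.base y) _ _ (getElem?_encodeVertexSet _ i), decide_eq_true_iff]
    exact ⟨fun ⟨h1, h2⟩ => ⟨h1, (key ⟨_, h1⟩).1 h2⟩, fun ⟨h1, h2⟩ => ⟨h1, (key ⟨_, h1⟩).2 h2⟩⟩⟩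

end Read

/-! ### Hardness -/

/-- Reducing the empty language to a hard problem exhibits a no-instance of that problem. -/
theorem DecisionProblem.empty_inNP : (DecisionProblem.ofLanguage ∅).InNP := by
  refine ⟨fun _ => false, 0, Writes.computableInPolyTime (Writes.singleton false), fun a => ?_⟩
  exact iff_of_false (fun h => h) (by simp)

/-- An additive class for which Induced Subgraph Isomorphism is hard contains large graphs. -/
theorem exists_large_mem {ℋ : GraphClass} (hℋ : ℋ.Additive)
    (hard : (ISIso GraphClass.general ℋ).NPHard) (μ : ℕ) :
    ∃ (κ : ℕ) (K : SimpleGraph (Fin κ)), μ ≤ κ ∧ ℋ.Mem K := by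
  -- The pattern of a no-instance has a vertex, since the empty graph embeds everywhere. Disjoint
  -- unions of copies of this pattern then become arbitrarily large.
  obtain ⟨f, -, hf⟩ := hard ∅ DecisionProblem.empty_inNP
  have hm : 1 ≤ (f []).m := by
    by_contra hm
    have hm : IsEmpty (Fin (f []).m) := by
      rw [Nat.lt_one_iff.1 (not_le.1 hm)]
      infer_instance
    exact ((hf []).2 (exists_isInducedIsoSet_iff.2 ⟨⟨⟨hm.elim, fun x => hm.elim x⟩,
      fun {x} => hm.elim x⟩⟩) : _ ∈ (∅ : Set (List Bool)))
  induction μ with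
  | zero => exact ⟨_, _, Nat.zero_le _, (f []).pattern_mem⟩
  | succ μ ih =>
    obtain ⟨κ, K, hκ, hK⟩ := ih
    exact ⟨_, sumFin K (f []).pattern, by omega, hℋ _ _ _ hK (f []).pattern_mem ⟨(sumFinIso _ _).symm⟩⟩

variable {ℋ : GraphClass} {μ κ : ℕ}

/-- The instance of the reconfiguration problem that belongs to an instance of the subgraph problem. -/
def reduction (hℋ : ℋ.Additive) (K : SimpleGraph (Fin κ)) (hK : ℋ.Mem K) (hμ : 1 ≤ μ) (hκ : μ ≤ κ)
    (I : ISIsoInstance GraphClass.general ℋ) : ISIsoRInstance μ GraphClass.general ℋ where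
  n := _
  m := _
  -- The summand `K` serves to give `P` at least `μ` vertices; it occurs in `Q` as well so that it
  -- can be cancelled.
  host := gadgetFin (sumFin K I.pattern) (sumFin (sumFin K I.pattern) (sumFin K I.host))
  pattern := tripleFin (sumFin K I.pattern)
  host_mem := trivial
  pattern_mem := by
    have h := hℋ _ _ _ hK I.pattern_mem ⟨(sumFinIso K I.pattern).symm⟩
    exact hℋ _ _ _ h (hℋ _ _ _ h h ⟨(sumFinIso _ _).symm⟩) ⟨(sumFinIso _ _).symm⟩
  source := (side false).map (gadgetFinIso _ _).toEquiv.toEmbedding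
  target := (side true).map (gadgetFinIso _ _).toEquiv.toEmbedding
  source_isInducedIsoSet := (side_isInducedIsoSet _ _ false).map (gadgetFinIso _ _) (tripleFinIso _)
  target_isInducedIsoSet := (side_isInducedIsoSet _ _ true).map (gadgetFinIso _ _) (tripleFinIso _)
  μ_lt := by omega

theorem inl_mem_side {V U : Type} [Fintype V] {s s' : Bool} {x : V ⊕ (V ⊕ V)} :
    (.inl (s', x) : (Bool × (V ⊕ (V ⊕ V))) ⊕ U) ∈ side s ↔ s' = s := by
  rw [side, Finset.mem_map]
  refine ⟨fun ⟨y, _, hy⟩ => (congrArg Prod.fst (Sum.inl.inj hy)).symm, ?_⟩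
  rintro rfl
  exact ⟨x, Finset.mem_univ _, rfl⟩

theorem inr_notMem_side {V U : Type} [Fintype V] {s : Bool} {u : U} :
    (.inr u : (Bool × (V ⊕ (V ⊕ V))) ⊕ U) ∉ side s := by
  rw [side, Finset.mem_map]
  rintro ⟨y, _, hy⟩
  cases hy

section Reduction

variable (hℋ : ℋ.Additive) (K : SimpleGraph (Fin κ)) (hK : ℋ.Mem K) (hμ : 1 ≤ μ) (hκ : μ ≤ κ)

/-- Cancelling `P` and then `K` turns an embedding of `2P` in `P ⊔ (K ⊔ G)` into one of `H` in `G`;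
adding the same summands goes back. -/
theorem reduction_yes_iff (I : ISIsoInstance GraphClass.general ℋ) :
    (ISIsoR μ GraphClass.general ℋ).yes (reduction hℋ K hK hμ hκ I) ↔
      (ISIso GraphClass.general ℋ).yes I := by
  have h1 := (reconfigurableTJ_map_iff (gadgetFinIso (sumFin K I.pattern)
    (sumFin (sumFin K I.pattern) (sumFin K I.host))) (tripleFinIso _)).trans
    (gadget_reconfigurable_iff (sumFin K I.pattern)
      (sumFin (sumFin K I.pattern) (sumFin K I.host)) hμ (by simp; omega))
  simp only [Fintype.card_fin] at h1
  refine h1.trans (Iff.trans ?_ exists_isInducedIsoSet_iff.symm)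
  have e1 := sumFinIso K I.pattern
  have e2 := sumFinIso K I.host
  have e3 := sumFinIso (sumFin K I.pattern) (sumFin K I.host)
  constructor
  · rintro ⟨f⟩
    obtain ⟨g⟩ := sum_cancel (e3.symm.toEmbedding.comp f)
    exact sum_cancel (e2.symm.toEmbedding.comp (g.comp e1.toEmbedding))
  · rintro ⟨f⟩
    have g : sumFin K I.pattern ↪g sumFin K I.host :=
      e2.toEmbedding.comp ((SimpleGraph.Embedding.sum .refl f).comp e1.symm.toEmbedding)
    exact ⟨e3.toEmbedding.comp (SimpleGraph.Embedding.sum .refl g)⟩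

/-- The enumeration of the host lists the side `false`, then the side `true`, then `Q`, so source
and target are intervals. -/
theorem mem_source_reduction (I : ISIsoInstance GraphClass.general ℋ)
    (i : Fin (reduction hℋ K hK hμ hκ I).n) :
    (i : ℕ) < (reduction hℋ K hK hμ hκ I).m ↔ i ∈ (reduction hℋ K hK hμ hκ I).source := by
  obtain ⟨x, rfl⟩ := (gadgetFinIso (sumFin K I.pattern)
    (sumFin (sumFin K I.pattern) (sumFin K I.host))).surjective i
  refine Iff.trans ?_ (Finset.mem_map' _).symm
  rcases x with ⟨_ | _, x⟩ | x
  · exact iff_of_true (tripleFinIso _ x).2 (inl_mem_side.2 rfl)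
  · exact iff_of_false (Nat.not_lt.2 (Nat.le_add_right _ _)) (by simp [inl_mem_side])
  · exact iff_of_false (Nat.not_lt.2 (Nat.le_add_right _ _)) inr_notMem_side

theorem mem_target_reduction (I : ISIsoInstance GraphClass.general ℋ)
    (i : Fin (reduction hℋ K hK hμ hκ I).n) :
    ((reduction hℋ K hK hμ hκ I).m ≤ (i : ℕ) ∧
      (i : ℕ) < (reduction hℋ K hK hμ hκ I).m + (reduction hℋ K hK hμ hκ I).m) ↔
      i ∈ (reduction hℋ K hK hμ hκ I).target := by
  obtain ⟨x, rfl⟩ := (gadgetFinIso (sumFin K I.pattern)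
    (sumFin (sumFin K I.pattern) (sumFin K I.host))).surjective i
  refine Iff.trans ?_ (Finset.mem_map' _).symm
  rcases x with ⟨_ | _, x⟩ | x
  · exact iff_of_false (fun h => Nat.not_lt.2 h.1 (tripleFinIso _ x).2) (by simp [inl_mem_side])
  · exact iff_of_true ⟨Nat.le_add_right _ _, Nat.add_lt_add_left (tripleFinIso _ x).2 _⟩
      (inl_mem_side.2 rfl)
  · exact iff_of_false (fun h => Nat.not_lt.2 (Nat.add_le_add_left (Nat.le_add_right _ _) _) h.2)
      inr_notMem_side

/-- Each graph and each set of the new instance is an arithmetic combination of relations read off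
the input and the fixed relation of `K`, hence can be written by a `WordExpr`. -/
theorem reduction_computable : Nonempty (TM2ComputableInPolyTime
    (ISIso GraphClass.general ℋ).encode (ISIsoR μ GraphClass.general ℋ).encode
    (reduction hℋ K hK hμ hκ)) := by
  let w : ISIsoInstance GraphClass.general ℋ → List Bool := (ISIso GraphClass.general ℋ).encode
  let tr : Option Bool → Bool := fun x => x == some true
  have hread : ∀ I, Reads tr (w I) 0 (encodeGraph I.host ++ encodeGraph I.pattern) := by
    intro I i b hi
    have : (w I)[0 + i]? = some b := by rwa [Nat.zero_add]
    rw [this]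
    cases b <;> rfl
  have hn : Scalar w fun I => I.n := scalar_of_reads (tr := tr) rfl (Scalar.const 0) fun I => (hread I).left
  have ho : Scalar w fun I => 0 + (encodeGraph I.host).length := by
    simp only [length_encodeGraph]
    exact (Scalar.const 0).add ((hn.add (.const 1)).add (hn.mul hn))
  have hm : Scalar w fun I => I.m := scalar_of_reads (tr := tr) rfl ho fun I => (hread I).right
  have hG : Relation w fun I => adjRel I.host :=
    relation_of_reads (tr := tr) (Scalar.const 0) hn fun I => (hread I).left
  have hH : Relation w fun I => adjRel I.pattern := relation_of_reads (tr := tr) ho hm fun I => (hread I).right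
  have hp : Scalar w fun I => κ + I.m := (Scalar.const κ).add hm
  have hq : Scalar w fun I => (reduction hℋ K hK hμ hκ I).m := hp.add (hp.add hp)
  have hN : Scalar w fun I => (reduction hℋ K hK hμ hκ I).n :=
    hq.add (hq.add (hp.add ((Scalar.const κ).add hn)))
  have hK' := Relation.adjRel_const (w := w) K
  have hP := Relation.sumRel (Scalar.const κ) hK' hH
  have hQ := Relation.sumRel hp hP (Relation.sumRel (Scalar.const κ) hK' hG)
  have h3 := Relation.sumRel hp hP (Relation.sumRel hp hP hP)
  have rP (I : ISIsoInstance GraphClass.general ℋ) :=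
    (reprBy_adjRel K).sumFin (reprBy_adjRel I.pattern)
  have r3 (I : ISIsoInstance GraphClass.general ℋ) := (rP I).sumFin ((rP I).sumFin (rP I))
  have rQ (I : ISIsoInstance GraphClass.general ℋ) :=
    (rP I).sumFin ((reprBy_adjRel K).sumFin (reprBy_adjRel I.host))
  have hhost := Writes.encodeGraph hN (Relation.gadgetRel hp hq h3 hQ)
    (fun I => (r3 I).gadgetFin (rQ I)) (.empty _)
  have hpattern := Writes.encodeGraph hq h3 r3 (.empty _)
  have hsource := Writes.encodeVertexSet
    (R := fun I i => i < (reduction hℋ K hK hμ hκ I).m) hN ⟨fun {_ Γ _} ha => Decides.lt ha (hq _ Γ)⟩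
    (mem_source_reduction hℋ K hK hμ hκ) (.empty _)
  have htarget := Writes.encodeVertexSet
    (R := fun I i => (reduction hℋ K hK hμ hκ I).m ≤ i ∧
      i < (reduction hℋ K hK hμ hκ I).m + (reduction hℋ K hK hμ hκ I).m) hN
    ⟨fun {_ Γ _} ha => (Decides.le (hq _ Γ) ha).and (Decides.lt ha ((hq _ Γ).add (hq _ Γ)))⟩
    (mem_target_reduction hℋ K hK hμ hκ) (.empty _)
  exact Writes.computableInPolyTime (((hhost.append hpattern).append hsource).append htarget)

end Reduction

/-- The graph `K` depends on the class and on `μ` alone, so it is a constant of the reduction. -/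
theorem ISIsoR_NPHard (hℋ : ℋ.Additive) (hμ : 1 ≤ μ)
    (hard : (ISIso GraphClass.general ℋ).NPHard) : (ISIsoR μ GraphClass.general ℋ).NPHard := by
  obtain ⟨κ, K, hκ, hK⟩ := exists_large_mem hℋ hard μ
  intro L hL
  obtain ⟨f, ⟨hf⟩, hf'⟩ := hard L hL
  obtain ⟨hr⟩ := reduction_computable hℋ K hK hμ hκ
  exact ⟨_, comp_computableInPolyTime hf hr,
    fun a => (hf' a).trans (reduction_yes_iff hℋ K hK hμ hκ _).symm⟩

end Reconf

namespace Reconf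

open Function Turing

/-! ### Membership in NP -/

section ShortSequence

variable {n : ℕ}

theorem tokenJump_iff {S T : Finset (Fin n)} {m μ : ℕ} (hS : S.card = m) (hT : T.card = m) (hμ : μ ≤ m) :
    TokenJump (m - μ) S T ↔ μ ≤ (S ∩ T).card := by
  have := Finset.card_sdiff_add_card_inter S T
  rw [TokenJump]
  omega

/-- A reconfiguration sequence whose length is bounded by a power of the number of vertices, continued
by repeating the last set. -/
theorem ReconfigurableTJ.exists_short {m μ : ℕ} {G : SimpleGraph (Fin n)} {H : SimpleGraph (Fin m)}
    (hμ : μ ≤ m) {S T : Finset (Fin n)} (h : ReconfigurableTJ G H (m - μ) S T) :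
    ∃ σ : ℕ → Finset (Fin n), σ 0 = S ∧ σ (n ^ μ) = T ∧ (∀ i, IsInducedIsoSet G H (σ i)) ∧
      ∀ i, μ ≤ (σ i ∩ σ (i + 1)).card := by
  classical
  have hcard {i : ℕ} {σ : ℕ → Finset (Fin n)} (h : IsInducedIsoSet G H (σ i)) : (σ i).card = m := by
    simpa using h.card_eq
  have hmin := Nat.find_spec h
  -- The sequence is taken of minimal length.
  set l := Nat.find h with hl
  obtain ⟨σ, h0, hT, hσ, hstep⟩ := hmin
  have hinter : ∀ i < l, μ ≤ (σ i ∩ σ (i + 1)).card := fun i hi =>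
    (tokenJump_iff (hcard (hσ i hi.le)) (hcard (hσ (i + 1) hi)) hμ).1 (hstep i hi)
  have hM : ∀ i, ∃ M : Finset (Fin n), i < l → M ⊆ σ i ∩ σ (i + 1) ∧ M.card = μ := fun i => by
    by_cases hi : i < l
    · obtain ⟨M, hM⟩ := Finset.exists_subset_card_eq (hinter i hi)
      exact ⟨M, fun _ => hM⟩
    · exact ⟨∅, fun h => absurd h hi⟩
  choose M hM using hM
  have hne : ∀ i j, i < j → j < l → M i ≠ M j := by
    -- A repeated `μ`-set is contained in both `σ i` and `σ (j + 1)`, so one jump leads from the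
    -- former to the latter and saves `j - i` steps.
    intro i j hij hj hMij
    refine Nat.find_min h (m := l - (j - i)) (by omega)
      ⟨fun t => if t ≤ i then σ t else σ (t + (j - i)), by simp [h0], ?_, fun t ht => ?_,
        fun t ht => ?_⟩
    · dsimp only
      rw [if_neg (by omega), show l - (j - i) + (j - i) = l by omega, hT]
    · dsimp only
      split_ifs
      · exact hσ _ (by omega)
      · exact hσ _ (by omega)
    · dsimp only
      rcases lt_trichotomy t i with hti | rfl | hti
      · rw [if_pos hti.le, if_pos (by omega)]
        exact hstep t (by omega)
      · rw [if_pos le_rfl, if_neg (by omega), show t + 1 + (j - t) = j + 1 by omega,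
          tokenJump_iff (hcard (hσ _ (by omega))) (hcard (hσ _ (by omega))) hμ, ← (hM t (by omega)).2]
        refine Finset.card_le_card fun x hx => Finset.mem_inter.2 ⟨?_, ?_⟩
        · exact (Finset.mem_inter.1 ((hM t (by omega)).1 hx)).1
        · rw [hMij] at hx
          exact (Finset.mem_inter.1 ((hM j hj).1 hx)).2
      · rw [if_neg (by omega), if_neg (by omega), Nat.add_right_comm]
        exact hstep _ (by omega)
  have hle : l ≤ n ^ μ := by
    have h1 : (Finset.range l).card ≤ (Finset.powersetCard μ (Finset.univ : Finset (Fin n))).card := by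
      refine Finset.card_le_card_of_injOn M (fun i hi => ?_) fun i hi j hj hij => ?_
      · exact Finset.mem_powersetCard.2 ⟨Finset.subset_univ _, (hM i (by simpa using hi)).2⟩
      · have hi : i < l := by simpa using hi
        have hj : j < l := by simpa using hj
        rcases lt_trichotomy i j with h | h | h
        · exact absurd hij (hne i j h hj)
        · exact h
        · exact absurd hij.symm (hne j i h hi)
    rw [Finset.card_range, Finset.card_powersetCard, Finset.card_univ, Fintype.card_fin] at h1
    exact h1.trans (Nat.choose_le_pow _ _)
  -- Repeating the last set is legitimate, since it meets itself in `m ≥ μ` vertices; all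
  -- certificates then have the same length.
  refine ⟨fun t => σ (min t l), by simpa using h0, by simpa [hle] using hT,
    fun i => hσ _ (min_le_right _ _), fun i => ?_⟩
  dsimp only
  rcases lt_or_ge i l with hi | hi
  · rw [min_eq_left hi.le, min_eq_left (by omega)]
    exact hinter i hi
  · rw [min_eq_right hi, min_eq_right (by omega), Finset.inter_self, hcard (hσ l le_rfl)]
    exact hμ

end ShortSequence

/-! ### Certificates and their verification -/

/-- The image of the map with graph `C t`. -/
def imageRel (m : ℕ) (C : ℕ → ℕ → ℕ → Prop) (t x : ℕ) : Prop := ∃ a < m, C t a x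

/-- The relations `C t`, for `t ≤ L`, are the graphs of embeddings of `H` into `G` whose images form a
reconfiguration sequence from `S` to `T`. -/
structure IsCertificate {n m : ℕ} (G : SimpleGraph (Fin n)) (H : SimpleGraph (Fin m))
    (S T : Finset (Fin n)) (μ L : ℕ) (C : ℕ → ℕ → ℕ → Prop) : Prop where
  total : ∀ t < L + 1, ∀ a < m, ∃ x < n, C t a x
  -- The equivalence of the two equalities says at once that the relation is single-valued and
  -- injective.
  adj : ∀ t < L + 1, ∀ a < m, ∀ b < m, ∀ x < n, ∀ y < n, C t a x ∧ C t b y →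
    (a = b ↔ x = y) ∧ (adjRel H a b ↔ adjRel G x y)
  source : ∀ x < n, imageRel m C 0 x ↔ memRel S x
  target : ∀ x < n, imageRel m C L x ↔ memRel T x
  inter : ∀ t < L, μ ≤ ∑ x ∈ Finset.range n,
    @ite _ (imageRel m C t x ∧ imageRel m C (t + 1) x) (Classical.propDecidable _) 1 0

section Certificate

variable {n m μ L : ℕ} {G : SimpleGraph (Fin n)} {H : SimpleGraph (Fin m)} {S T : Finset (Fin n)}
  {C : ℕ → ℕ → ℕ → Prop}

theorem sum_range_eq_card_inter {S T : Finset (Fin n)} {R R' : ℕ → Prop}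
    (hR : ∀ x : Fin n, R x ↔ x ∈ S) (hR' : ∀ x : Fin n, R' x ↔ x ∈ T) :
    ∑ x ∈ Finset.range n, @ite _ (R x ∧ R' x) (Classical.propDecidable _) 1 0 = (S ∩ T).card := by
  classical
  have : S ∩ T = Finset.univ.filter fun x : Fin n => R x ∧ R' x := by
    ext x
    simp [hR, hR']
  rw [this, Finset.card_filter, Finset.sum_range]
  refine Finset.sum_congr rfl fun x _ => ?_
  congr

theorem IsCertificate.reconfigurable (hμ : μ ≤ m) (h : IsCertificate G H S T μ L C) :
    ReconfigurableTJ G H (m - μ) S T := by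
  classical
  let σ : ℕ → Finset (Fin n) := fun t => Finset.univ.filter fun x => imageRel m C t x
  have hmem (t : ℕ) (x : Fin n) : imageRel m C t x ↔ x ∈ σ t := by simp [σ]
  have hσ : ∀ t ≤ L, IsInducedIsoSet G H (σ t) := by
    intro t ht
    have ht := Nat.lt_succ_of_le ht
    have (a : Fin m) : ∃ x : Fin n, C t a x := by
      obtain ⟨x, hx, h⟩ := h.total t ht a a.2
      exact ⟨⟨x, hx⟩, h⟩
    choose f hf using this
    have hadj (a b : Fin m) (x y : Fin n) (hx : C t a x) (hy : C t b y) :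
        (a = b ↔ x = y) ∧ (H.Adj a b ↔ G.Adj x y) := by
      have := h.adj t ht a a.2 b b.2 x x.2 y y.2 ⟨hx, hy⟩
      rwa [reprBy_adjRel H a b, reprBy_adjRel G x y, Fin.val_inj, Fin.val_inj] at this
    refine isInducedIsoSet_iff.2 ⟨⟨⟨f, fun a b hab => ?_⟩, fun {a b} => ?_⟩, ?_⟩
    · exact (hadj a b _ _ (hf a) (hf b)).1.2 hab
    · exact (hadj a b _ _ (hf a) (hf b)).2.symm
    · ext x
      rw [← hmem]
      simp only [Finset.mem_map, Finset.mem_univ, true_and]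
      constructor
      · rintro ⟨a, rfl⟩
        exact ⟨a, a.2, hf a⟩
      · rintro ⟨a, ha, hx⟩
        exact ⟨⟨a, ha⟩, (hadj ⟨a, ha⟩ ⟨a, ha⟩ _ _ (hf _) hx).1.1 rfl⟩
  refine ⟨L, σ, ?_, ?_, hσ, fun t ht => ?_⟩
  · ext x
    rw [← hmem, h.source x x.2, memRel_val]
  · ext x
    rw [← hmem, h.target x x.2, memRel_val]
  · rw [tokenJump_iff (by simpa using (hσ t ht.le).card_eq) (by simpa using (hσ (t + 1) ht).card_eq) hμ,
      ← sum_range_eq_card_inter (hmem t) (hmem (t + 1))]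
    exact h.inter t ht

/-- Quantifying over all `C` that agree with `F` on the relevant range makes the values elsewhere
immaterial; a relation listed in a word is controlled only on that range. -/
theorem ReconfigurableTJ.exists_isCertificate (hμ : μ ≤ m) (h : ReconfigurableTJ G H (m - μ) S T) :
    ∃ F : ℕ → ℕ → ℕ → Prop, ∀ C : ℕ → ℕ → ℕ → Prop,
      (∀ t < n ^ μ + 1, ∀ a < m, ∀ x < n, C t a x ↔ F t a x) →
        IsCertificate G H S T μ (n ^ μ) C := by
  obtain ⟨σ, h0, hT, hσ, hinter⟩ := h.exists_short hμ
  choose f hf using fun t => isInducedIsoSet_iff.1 (hσ t)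
  refine ⟨fun t a x => ∃ ha : a < m, (f t ⟨a, ha⟩ : ℕ) = x, fun C hC => ?_⟩
  have hC' (t : ℕ) (ht : t < n ^ μ + 1) (a : Fin m) (x : Fin n) : C t a x ↔ f t a = x := by
    rw [hC t ht a a.2 x x.2]
    exact ⟨fun ⟨_, h⟩ => Fin.ext h, fun h => ⟨a.2, congrArg _ h⟩⟩
  have himage (t : ℕ) (ht : t < n ^ μ + 1) (x : Fin n) : imageRel m C t x ↔ x ∈ σ t := by
    rw [← hf t]
    simp only [Finset.mem_map, Finset.mem_univ, true_and]
    exact ⟨fun ⟨a, ha, h⟩ => ⟨⟨a, ha⟩, (hC' t ht ⟨a, ha⟩ x).1 h⟩,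
      fun ⟨a, h⟩ => ⟨a, a.2, (hC' t ht a x).2 h⟩⟩
  constructor
  · intro t ht a ha
    exact ⟨f t ⟨a, ha⟩, (f t ⟨a, ha⟩).2, (hC' t ht ⟨a, ha⟩ _).2 rfl⟩
  · rintro t ht a ha b hb x hx y hy ⟨h1, h2⟩
    obtain rfl := congrArg Fin.val ((hC' t ht ⟨a, ha⟩ ⟨x, hx⟩).1 h1)
    obtain rfl := congrArg Fin.val ((hC' t ht ⟨b, hb⟩ ⟨y, hy⟩).1 h2)
    rw [reprBy_adjRel G (f t ⟨a, ha⟩) (f t ⟨b, hb⟩), (f t).map_adj_iff, Fin.val_inj,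
      (f t).injective.eq_iff, Fin.mk.injEq]
    exact ⟨Iff.rfl, reprBy_adjRel H ⟨a, ha⟩ ⟨b, hb⟩⟩
  · intro x hx
    rw [himage 0 (by omega) ⟨x, hx⟩, h0, ← memRel_val]
  · intro x hx
    rw [himage _ (by omega) ⟨x, hx⟩, hT, ← memRel_val]
  · intro t ht
    rw [sum_range_eq_card_inter (himage t (by omega)) (himage (t + 1) (by omega))]
    exact hinter t

/-- The relations that are listed in a word. -/
def listedRel (n m : ℕ) (l : List Bool) (t a x : ℕ) : Prop := l[(t * m + a) * n + x]? = some true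

theorem exists_listedRel (n m N : ℕ) (F : ℕ → ℕ → ℕ → Prop) : ∃ c : List Bool, c.length ≤ N * m * n ∧
    ∀ t < N, ∀ a < m, ∀ x < n, listedRel n m c t a x ↔ F t a x := by
  classical
  -- Quotients and remainders decode the mixed-radix index `(t * m + a) * n + x`.
  refine ⟨(List.range (N * m * n)).map fun i => decide (F (i / n / m) (i / n % m) (i % n)), by simp,
    fun t ht a ha x hx => ?_⟩
  have h1 : t * m + a < N * m := by nlinarith
  have h2 : (t * m + a) * n + x < N * m * n := by nlinarith
  have e1 : ((t * m + a) * n + x) / n = t * m + a := by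
    rw [Nat.mul_comm, Nat.mul_add_div (by omega), Nat.div_eq_of_lt hx, Nat.add_zero]
  have e2 : (t * m + a) / m = t := by
    rw [Nat.mul_comm, Nat.mul_add_div (by omega), Nat.div_eq_of_lt ha, Nat.add_zero]
  have e3 : ((t * m + a) * n + x) % n = x := by
    rw [Nat.mul_comm, Nat.mul_add_mod, Nat.mod_eq_of_lt hx]
  have e4 : (t * m + a) % m = a := by
    rw [Nat.mul_comm, Nat.mul_add_mod, Nat.mod_eq_of_lt ha]
  rw [listedRel, List.getElem?_map, List.getElem?_range h2]
  simp [e1, e2, e3, e4]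

theorem ReconfigurableTJ.exists_listed (hμ : μ ≤ m) (h : ReconfigurableTJ G H (m - μ) S T) :
    ∃ c : List Bool, c.length ≤ (n ^ μ + 1) * m * n ∧
      IsCertificate G H S T μ (n ^ μ) (listedRel n m c) := by
  obtain ⟨F, hF⟩ := h.exists_isCertificate hμ
  obtain ⟨c, hc, hcF⟩ := exists_listedRel n m (n ^ μ + 1) F
  exact ⟨c, hc, hF _ hcF⟩

end Certificate

/-- All quantifiers of `IsCertificate` have bounds that are expressible in the input, among them `n
^ μ` because `μ` is fixed, so each clause is decided by an expression. -/
theorem ISIsoR_verifier_computable (𝒢 ℋ : GraphClass) (μ : ℕ) :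
    Nonempty (TM2ComputableInPolyTime (ISIsoR μ 𝒢 ℋ).encodeWithCertificate (fun b : Bool => [b])
      (open Classical in fun q => decide (IsCertificate q.1.host q.1.pattern q.1.source q.1.target μ
        (q.1.n ^ μ) (listedRel q.1.n q.1.m q.2)))) := by
  let w : ISIsoRInstance μ 𝒢 ℋ × List Bool → List (Option Bool) :=
    (ISIsoR μ 𝒢 ℋ).encodeWithCertificate
  -- The separator and positions beyond the end both read as `false`.
  let tr : Option (Option Bool) → Bool := fun x => x == some (some true)
  have hread : ∀ q, Reads tr (w q) 0 ((((encodeGraph q.1.host ++ encodeGraph q.1.pattern) ++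
      encodeVertexSet q.1.source) ++ encodeVertexSet q.1.target)) := by
    intro q i b hi
    have : (w q)[0 + i]? = some (some b) := by
      rw [Nat.zero_add]
      refine (List.getElem?_append_left ?_).trans ?_
      · rw [List.length_map]
        exact (List.getElem?_eq_some_iff.1 hi).1
      · rw [List.getElem?_map]
        exact congrArg _ hi
    rw [this]
    cases b <;> rfl
  have hn : Scalar w fun q => q.1.n :=
    scalar_of_reads (tr := tr) rfl (Scalar.const 0) fun q => (hread q).left.left.left
  have ho : Scalar w fun q => 0 + (encodeGraph q.1.host).length := by
    simp only [length_encodeGraph]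
    exact Scalar.add (Scalar.const 0) ((hn.add (Scalar.const 1)).add (hn.mul hn))
  have hm : Scalar w fun q => q.1.m := scalar_of_reads (tr := tr) rfl ho fun q => (hread q).left.left.right
  have hs : Scalar w fun q => 0 + (encodeGraph q.1.host ++ encodeGraph q.1.pattern).length := by
    simp only [List.length_append, length_encodeGraph]
    exact Scalar.add (Scalar.const 0) (((hn.add (Scalar.const 1)).add (hn.mul hn)).add
      ((hm.add (Scalar.const 1)).add (hm.mul hm)))
  have ht : Scalar w fun q => 0 + ((encodeGraph q.1.host ++ encodeGraph q.1.pattern) ++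
      encodeVertexSet q.1.source).length := by
    simp only [List.length_append, length_encodeGraph, length_encodeVertexSet]
    exact Scalar.add (Scalar.const 0) ((((hn.add (Scalar.const 1)).add (hn.mul hn)).add
      ((hm.add (Scalar.const 1)).add (hm.mul hm))).add hn)
  have he : Scalar w fun q => ((ISIsoR μ 𝒢 ℋ).encode q.1).length := by
    simp only [ISIsoR, List.length_append, length_encodeGraph, length_encodeVertexSet]
    exact ((((hn.add (Scalar.const 1)).add (hn.mul hn)).add
      ((hm.add (Scalar.const 1)).add (hm.mul hm))).add hn).add hn
  have hG : Relation w fun q => adjRel q.1.host :=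
    relation_of_reads (tr := tr) (Scalar.const 0) hn fun q => (hread q).left.left.left
  have hH : Relation w fun q => adjRel q.1.pattern :=
    relation_of_reads (tr := tr) ho hm fun q => (hread q).left.left.right
  have hS : Predicate w fun q => memRel q.1.source :=
    predicate_of_reads (tr := tr) hs hn fun q => (hread q).left.right
  have hT : Predicate w fun q => memRel q.1.target :=
    predicate_of_reads (tr := tr) ht hn fun q => (hread q).right
  have hC {Y : Type} {Γ : Context _ Y} {t a x : Y → ℕ} (ht : Expressible w Γ t)
      (ha : Expressible w Γ a) (hx : Expressible w Γ x) : Decides w Γ fun y =>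
        listedRel (Γ.base y).1.n (Γ.base y).1.m (Γ.base y).2 (t y) (a y) (x y) := by
    -- The certificate starts after the encoded instance and one separator symbol, hence the `1`.
    refine (Decides.bit tr (((he _ Γ).add (.const 1)).add
      ((((ht.mul (hm _ Γ)).add ha).mul (hn _ Γ)).add hx))).congr fun y => ?_
    rw [listedRel]
    generalize (t y * (Γ.base y).1.m + a y) * (Γ.base y).1.n + x y = i
    generalize Γ.base y = q
    have : (w q)[((ISIsoR μ 𝒢 ℋ).encode q.1).length + 1 + i]? = (q.2.map some)[i]? := by
      refine (List.getElem?_append_right (by simp; omega)).trans ?_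
      rw [List.length_map, Nat.add_assoc, Nat.add_sub_cancel_left, Nat.add_comm, List.getElem?_cons_succ]
    rw [this, List.getElem?_map]
    rcases q.2[i]? with _ | _ | _ <;> simp [tr]
  have hI {Y : Type} {Γ : Context _ Y} {t x : Y → ℕ} (ht : Expressible w Γ t)
      (hx : Expressible w Γ x) : Decides w Γ fun y =>
        imageRel (Γ.base y).1.m (listedRel (Γ.base y).1.n (Γ.base y).1.m (Γ.base y).2) (t y) (x y) :=
    Decides.exists (hm _ Γ) (hC ht.weaken .var hx.weaken)
  have hv {Y : Type} {Γ : Context (ISIsoRInstance μ 𝒢 ℋ × List Bool) Y} :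
      Expressible w Γ.extend fun y => y.2 := .var
  refine Writes.computableInPolyTime (Writes.bit ?_)
  have h1 := Decides.forall (w := w) (Γ := .empty _) (((hn.pow μ).add (Scalar.const 1)) _ _)
    (Decides.forall (hm _ _) (Decides.exists (hn _ _) (hC hv.weaken.weaken hv.weaken hv)))
  have h2 := Decides.forall (w := w) (Γ := .empty _) (((hn.pow μ).add (Scalar.const 1)) _ _)
    (Decides.forall (hm _ _) (Decides.forall (hm _ _) (Decides.forall (hn _ _) (Decides.forall (hn _ _)
      (((hC hv.weaken.weaken.weaken.weaken hv.weaken.weaken.weaken hv.weaken).and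
        (hC hv.weaken.weaken.weaken.weaken hv.weaken.weaken hv)).imp
      (((Decides.eq hv.weaken.weaken.weaken hv.weaken.weaken).iff (Decides.eq hv.weaken hv)).and
        ((hH.decides hv.weaken.weaken.weaken hv.weaken.weaken).iff (hG.decides hv.weaken hv))))))))
  have h3 := Decides.forall (w := w) (Γ := .empty _) (hn _ _) ((hI (.const 0) hv).iff (hS.decides hv))
  have h4 := Decides.forall (w := w) (Γ := .empty _) (hn _ _)
    ((hI ((hn.pow μ) _ _) hv).iff (hT.decides hv))
  have h5 := Decides.forall (w := w) (Γ := .empty _) ((hn.pow μ) _ _)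
    (Decides.le (.const μ) (Expressible.sum (hn _ _)
      ((hI hv.weaken hv).and (hI (hv.weaken.add (.const 1)) hv))))
  exact (h1.and (h2.and (h3.and (h4.and h5)))).congr fun q =>
    ⟨fun ⟨a, b, c, d, e⟩ => ⟨a, b, c, d, e⟩, fun ⟨a, b, c, d, e⟩ => ⟨a, b, c, d, e⟩⟩

theorem ISIsoR_inNP (𝒢 ℋ : GraphClass) (μ : ℕ) : (ISIsoR μ 𝒢 ℋ).InNP := by
  classical
  -- A certificate has one bit for each of `n ^ μ + 1` times, `m` pattern vertices and `n` host
  -- vertices, and the encoding is at least as long as `n` and `m`.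
  refine ⟨_, (.X ^ μ + 1) * .X * .X, ISIsoR_verifier_computable 𝒢 ℋ μ, fun I => ?_⟩
  have hN : ((ISIsoR μ 𝒢 ℋ).encode I).length = I.n + 1 + I.n * I.n + (I.m + 1 + I.m * I.m) + I.n + I.n := by
    simp only [ISIsoR, List.length_append, length_encodeGraph, length_encodeVertexSet]
  constructor
  · intro h
    obtain ⟨c, hc, hcert⟩ := ReconfigurableTJ.exists_listed I.μ_lt.le h
    refine ⟨c, hc.trans ?_, decide_eq_true hcert⟩
    simp only [Polynomial.eval_mul, Polynomial.eval_add, Polynomial.eval_pow, Polynomial.eval_X,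
      Polynomial.eval_one]
    have hn : I.n ≤ ((ISIsoR μ 𝒢 ℋ).encode I).length := by rw [hN]; omega
    have hm : I.m ≤ ((ISIsoR μ 𝒢 ℋ).encode I).length := by rw [hN]; omega
    gcongr
  · rintro ⟨c, -, hc⟩
    exact (of_decide_eq_true hc).reconfigurable I.μ_lt.le

end Reconf

theorem theorem2 (ℋ : Reconf.GraphClass) (hℋ : ℋ.Additive) (μ : ℕ) (hμ : 1 ≤ μ)
    (hNP : (Reconf.ISIso Reconf.GraphClass.general ℋ).NPComplete) :
    (Reconf.ISIsoR μ Reconf.GraphClass.general ℋ).NPComplete :=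
  ⟨Reconf.ISIsoR_inNP _ _ _, Reconf.ISIsoR_NPHard hℋ hμ hNP.2⟩
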